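/- Let $n$ be a prime. For $a\in\mathbb Z_n=\mathbb Z/n\mathbb Z$ and an integer $k\ge 0$ let $AP(a,k)=\{0,a,2a,\dots,ka\}$, an arithmetic progression of *length* $k$. A sumset $\sum_{i\in\mathbb Z_n}AP(i,A[i])$ is represented by the array $A:\mathbb Z_n\to\mathbb N$ of its lengths; its total length is $\sum_i A[i]$, and it consists of the progressions with $A[i]\neq 0$. The following operations may be made on a sumset. - *Drop*: decrease some $A[a]$ to any smaller value $\ge 0$. - *Operation 1*: if $a\ne b$, $ya=xb$ with integers $y>x\ge 1$, $A[a]\ge y$ and $A[b]\ge x$, put $A[b]\leftarrow A[b]-x$ and $A[a]\leftarrow A[a]+y$. (Several successive operations 1 with the same $a,b,x,y$ may be recorded as one.) - *Operation 2*: if $a\neq b$ are nonzero, $va=wb$ with coprime $v,w\in\{1,\dots,n-1\}$, $v\le t\le A[a]$ and $w\le s\le A[b]$, decrease $A[a]$ by $t$ and $A[b]$ by $s$, and then increase $A[z]$ by $tw+sv-2(vw-v-w+1)$, where $z=a/w=b/v$ in $\mathbb Z_n$. An *initial sumset* is one with $A[0]=0$ and $\sum_i A[i]=n-1$. It *has a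 collision* if $ci=dj$ for some $i\neq j$, $1\le c\le A[i]$, $1\le d\le A[j]$. **Statement.** There is an algorithm, that is, one fixed program for a unit-cost RAM whose words are integers bounded by a fixed power of $n$, which on input of a prime $n$ and the array $A$ of an initial sumset halts after $O(n\log\log\log n)$ steps (precisely, after at most $C\,n\max(1,\log_2\log_2\log_2 n)$ steps for a constant $C$, where the maximum is read as $1$ if the triple logarithm is undefined) with the following result. 1. If the initial sumset has a collision, the algorithm outputs a list of operations which, made one after the other on $A$, are all valid, together with the resulting array $A'$; the sumset of $A'$ consists of at most $n/\log_2 n$ arithmetic progressions, and their total length is at least $n$. 2. If the initial sumset has no collision, the algorithm reports this and outputs a table that gives for each nonzero $x\in\mathbb Z_n$ a representation $x=ci$ with $1\le c\le A[i]$. -/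

import Mathlib

namespace EGZ

/-! ### Arithmetic progressions and the operations on a sumset

A sumset `∑ i, AP(i, A i)` of progressions `AP(i, k) = {0, i, 2i, …, k i}` in `ZMod n` is
represented by the array `A : ZMod n → ℕ`, where `A i` is the length of the progression with common
difference `i` and the value `0` means that this progression is absent. -/

/-- The operations that may be made on a sumset.

* `drop a x` replaces `AP(a, A a)` by `AP(a, A a - x)`;
* `exchange a b y x r` makes `r` successive replacements of `AP(a, y) + AP(b, x)` by `AP(a, 2 y)`;
* `fuse a b v w t s` replaces `AP(a, t) + AP(b, s)` by `AP(z, u)`, where `z = a / w = b / v`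
  and `u = t w + s v - 2 (v w - v - w + 1)`.
-/
inductive Op (n : ℕ) : Type
  | drop (a : ZMod n) (x : ℕ) : Op n
  | exchange (a b : ZMod n) (y x r : ℕ) : Op n
  | fuse (a b : ZMod n) (v w t s : ℕ) : Op n

/-- The condition under which an operation may be made on the sumset `A`. -/
def Op.Valid {n : ℕ} (A : ZMod n → ℕ) : Op n → Prop
  | .drop a x => x ≤ A a
  | .exchange a b y x r =>
      a ≠ b ∧ (y : ZMod n) * a = (x : ZMod n) * b ∧ 1 ≤ x ∧ x < y ∧ y ≤ A a ∧ r * x ≤ A b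
  | .fuse a b v w t s =>
      a ≠ 0 ∧ b ≠ 0 ∧ a ≠ b ∧ 1 ≤ v ∧ v < n ∧ 1 ≤ w ∧ w < n ∧ Nat.Coprime v w ∧
        (v : ZMod n) * a = (w : ZMod n) * b ∧ v ≤ t ∧ t ≤ A a ∧ w ≤ s ∧ s ≤ A b

/-- The sumset after an operation. No subtraction truncates if the operation is valid; note that
`v w - v - w + 1 = (v - 1) (w - 1)`. -/
def Op.result {n : ℕ} (A : ZMod n → ℕ) : Op n → (ZMod n → ℕ)
  | .drop a x => A - Pi.single a x
  | .exchange a b y x r => A - Pi.single b (r * x) + Pi.single a (r * y)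
  | .fuse a b v w t s =>
      A - Pi.single a t - Pi.single b s +
        Pi.single (a * (w : ZMod n)⁻¹) (t * w + s * v - 2 * ((v - 1) * (w - 1)))

/-- The operations in the list, made one after the other, are all valid and turn `A` into `A'`. -/
def Transforms {n : ℕ} : List (Op n) → (ZMod n → ℕ) → (ZMod n → ℕ) → Prop
  | [], A, A' => A' = A
  | o :: os, A, A' => o.Valid A ∧ Transforms os (o.result A) A'

/-- Two different progressions of the sumset have a common member `c i = d j` with
`1 ≤ c ≤ A i` and `1 ≤ d ≤ A j`. -/
def HasCollision {n : ℕ} (A : ZMod n → ℕ) : Prop :=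
  ∃ (i j : ZMod n) (c d : ℕ), i ≠ j ∧ 1 ≤ c ∧ c ≤ A i ∧ 1 ≤ d ∧ d ≤ A j ∧
    (c : ZMod n) * i = (d : ZMod n) * j

/-! ### The machine model: a unit-cost word RAM -/

/-- The store of the machine: scalar variables and arrays of words. `mem a i` is the `i`-th cell of
the array `a`. A program mentions only finitely many variables and arrays. -/
@[ext]
structure Store where
  reg : ℕ → ℕ
  mem : ℕ → ℕ → ℕ

/-- Assign the value `v` to the variable `x`. -/
def Store.setReg (σ : Store) (x v : ℕ) : Store :=
  { σ with reg := Function.update σ.reg x v }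

/-- Write the value `v` to the `i`-th cell of the array `a`. -/
def Store.setMem (σ : Store) (a i v : ℕ) : Store :=
  { σ with mem := Function.update σ.mem a (Function.update (σ.mem a) i v) }

/-- The arithmetic instructions: `sub` is truncated, `div` and `mod` are integer quotient and
remainder, `lt` and `eq` are comparisons with value `1` (true) or `0` (false). -/
inductive BinOp : Type
  | add | sub | mul | div | mod | lt | eq

def BinOp.eval : BinOp → ℕ → ℕ → ℕ
  | .add, x, y => x + y
  | .sub, x, y => x - y
  | .mul, x, y => x * y
  | .div, x, y => x / y
  | .mod, x, y => x % y
  | .lt, x, y => if x < y then 1 else 0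
  | .eq, x, y => if x = y then 1 else 0

/-- Expressions: constants, variables, array cells, arithmetic. -/
inductive Expr : Type
  | const (v : ℕ) : Expr
  | var (x : ℕ) : Expr
  | cell (a : ℕ) (i : Expr) : Expr
  | bin (o : BinOp) (e f : Expr) : Expr

def Expr.eval (σ : Store) : Expr → ℕ
  | .const v => v
  | .var x => σ.reg x
  | .cell a i => σ.mem a (i.eval σ)
  | .bin o e f => o.eval (e.eval σ) (f.eval σ)

/-- The time to evaluate an expression: one unit for each constant, variable, array access and
arithmetic instruction in it. -/
def Expr.cost : Expr → ℕ
  | .const _ => 1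
  | .var _ => 1
  | .cell _ i => i.cost + 1
  | .bin _ e f => e.cost + f.cost + 1

/-- All the values that occur in the evaluation of the expression (addresses included) fit into a
machine word, that is, are at most `B`. -/
def Expr.Fits (B : ℕ) (σ : Store) : Expr → Prop
  | .const v => v ≤ B
  | .var x => σ.reg x ≤ B
  | .cell a i => i.Fits B σ ∧ σ.mem a (i.eval σ) ≤ B
  | .bin o e f => e.Fits B σ ∧ f.Fits B σ ∧ o.eval (e.eval σ) (f.eval σ) ≤ B

/-- Programs. In `cond` and `loop` the test succeeds if its value is not `0`. -/
inductive Prog : Type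
  | skip : Prog
  | assign (x : ℕ) (e : Expr) : Prog
  | write (a : ℕ) (i e : Expr) : Prog
  | seq (p q : Prog) : Prog
  | cond (e : Expr) (p q : Prog) : Prog
  | loop (e : Expr) (p : Prog) : Prog

/-- `Exec B p σ t τ`: started in the store `σ`, the program `p` halts after `t` units of time in the
store `τ`, and every value that it computes on the way is at most `B`. -/
inductive Exec (B : ℕ) : Prog → Store → ℕ → Store → Prop
  | skip (σ : Store) : Exec B .skip σ 1 σ
  | assign (σ : Store) (x : ℕ) (e : Expr) (he : e.Fits B σ) :
      Exec B (.assign x e) σ (e.cost + 1) (σ.setReg x (e.eval σ))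
  | write (σ : Store) (a : ℕ) (i e : Expr) (hi : i.Fits B σ) (he : e.Fits B σ) :
      Exec B (.write a i e) σ (i.cost + e.cost + 1) (σ.setMem a (i.eval σ) (e.eval σ))
  | seq (p q : Prog) (σ τ υ : Store) (t u : ℕ) (hp : Exec B p σ t τ) (hq : Exec B q τ u υ) :
      Exec B (.seq p q) σ (t + u) υ
  | cond_true (e : Expr) (p q : Prog) (σ τ : Store) (t : ℕ) (he : e.Fits B σ)
      (h : e.eval σ ≠ 0) (hp : Exec B p σ t τ) : Exec B (.cond e p q) σ (e.cost + t + 1) τ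
  | cond_false (e : Expr) (p q : Prog) (σ τ : Store) (t : ℕ) (he : e.Fits B σ)
      (h : e.eval σ = 0) (hq : Exec B q σ t τ) : Exec B (.cond e p q) σ (e.cost + t + 1) τ
  | loop_done (e : Expr) (p : Prog) (σ : Store) (he : e.Fits B σ) (h : e.eval σ = 0) :
      Exec B (.loop e p) σ (e.cost + 1) σ
  | loop_step (e : Expr) (p : Prog) (σ τ υ : Store) (t u : ℕ) (he : e.Fits B σ)
      (h : e.eval σ ≠ 0) (hp : Exec B p σ t τ) (hl : Exec B (.loop e p) τ u υ) :
      Exec B (.loop e p) σ (e.cost + t + u + 1) υ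

/-! ### Input and output -/

/-- The initial store: the variable `0` holds `n`, the cells `0, …, n - 1` of the array `0` hold the
array `A`, and everything else is `0`. -/
def inputStore (n : ℕ) (A : ZMod n → ℕ) : Store where
  reg := fun x => if x = 0 then n else 0
  mem := fun a i => if a = 0 ∧ i < n then A (i : ZMod n) else 0

/-- The sumset that is stored in the array `0`. -/
def Store.sumset (n : ℕ) (σ : Store) : ZMod n → ℕ :=
  fun i => σ.mem 0 i.val

/-- The `l`-th operation in the record that is stored in the arrays `1, …, 7`: its kind is in the
array `1`, its parameters are in the following arrays. -/
def Store.opAt (n : ℕ) (σ : Store) (l : ℕ) : Op n :=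
  match σ.mem 1 l with
  | 0 => .drop (σ.mem 2 l : ZMod n) (σ.mem 3 l)
  | 1 => .exchange (σ.mem 2 l : ZMod n) (σ.mem 3 l : ZMod n) (σ.mem 4 l) (σ.mem 5 l) (σ.mem 6 l)
  | _ => .fuse (σ.mem 2 l : ZMod n) (σ.mem 3 l : ZMod n) (σ.mem 4 l) (σ.mem 5 l) (σ.mem 6 l)
      (σ.mem 7 l)

/-- The recorded operations in the order in which they are made; their number is in the
variable `1`. -/
def Store.record (n : ℕ) (σ : Store) : List (Op n) :=
  (List.range (σ.reg 1)).map (σ.opAt n)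

/-- The main outcome, for the input `A`: the variable `0` holds `1`, the recorded operations turn
`A` into the stored sumset, and this sumset consists of at most `n / log₂ n` progressions whose
total length is at least `n`. -/
def Reached {n : ℕ} [NeZero n] (A : ZMod n → ℕ) (σ : Store) : Prop :=
  σ.reg 0 = 1 ∧
  Transforms (σ.record n) A (σ.sumset n) ∧
  ((Finset.univ.filter fun i : ZMod n => σ.sumset n i ≠ 0).card : ℝ) ≤
    (n : ℝ) / Real.logb 2 (n : ℝ) ∧
  n ≤ ∑ i : ZMod n, σ.sumset n i

/-- The degenerate outcome, for the input `A`: the variable `0` holds `0`, and the arrays `1` and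
`2` display every nonzero residue `x` as a multiple `c i` with `1 ≤ c ≤ A i`. -/
def Tabulated {n : ℕ} (A : ZMod n → ℕ) (σ : Store) : Prop :=
  σ.reg 0 = 0 ∧
  ∀ x : ZMod n, x ≠ 0 →
    1 ≤ σ.mem 1 x.val ∧ σ.mem 1 x.val ≤ A (σ.mem 2 x.val : ZMod n) ∧
      (σ.mem 1 x.val : ZMod n) * (σ.mem 2 x.val : ZMod n) = x

end EGZ

namespace EGZ

/-! ### Weakest preconditions for the machine -/

/-! Enter multiples c·i of the differences i into a table indexed by ℤ_n. While all lengths are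
below n these multiples are nonzero, so there are only n − 1 slots. If a slot is needed twice, then
y·a = x·b with y > x, and an operation on these two progressions gains length: an exchange if x = 1
or y/x is large, a fusion otherwise.

Linear time per phase comes from sparse entries. With q = e², only coefficients c ≡ 1 mod q with 2c
≤ A[i] + 1 are entered. The gcd of two such coefficients y > x is prime to q, so after division by
it q still divides v − w, whence v > e². If y < e·x, then w > v/e > e, and a fusion gains a factor
of order e; if y ≥ e·x, an exchange does (`params_two`). A progression of length l has about l/q
entries, so deleting and re-entering them, and Euclid's algorithm too, costs time proportional to
the consumed length over q, and hence to the gain over κq, where κ = e. The total length only has to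
grow to order e³n = κqn, so a phase takes time O(n) (`wp_operate`, `wp_advance`, `wp_phase`).

A phase cannot get stuck with everything entered: the entries occupy distinct nonzero slots, so the
total length would be below 2qn (`TableInv.sum_le_of_complete`, `TableInv.sum_kc_lt`), whereas the
phase starts with at least 2e²n. It ends with at least 2e'²n, where e'² ≥ e³. So log e grows by the
factor 3/2 per round until e² ≥ 2 log n, which takes O(log log log n) rounds (`roundPot_step`,
`roundPot_le`). Then dropping all progressions shorter than e² costs at most half of the total
length, and long ones are kept only until their total is n, so at most about n/e² survive
(`wp_prune`). A progression that reaches length n on the way suffices alone.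

The first phase has q = 1 and starts from length n − 1. Without a collision all n − 1 multiples are
entered, they fill every nonzero slot, and the table is the required output
(`tabulated_of_complete`). A collision raises the length to at least n, after which the phase cannot
get stuck and reaches 32n = 2·4²·n. Here the congruence is void, but all smaller multiples are
already in the table, so a collision that is found has coprime coefficients (`TableInv.coprime`). -/

@[simp] theorem Store.setReg_reg (σ : Store) (x v y : ℕ) :
    (σ.setReg x v).reg y = if y = x then v else σ.reg y := by
  simp [Store.setReg, Function.update_apply]

@[simp] theorem Store.setReg_mem (σ : Store) (x v : ℕ) : (σ.setReg x v).mem = σ.mem := rfl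

@[simp] theorem Store.setMem_reg (σ : Store) (a i v : ℕ) : (σ.setMem a i v).reg = σ.reg := rfl

@[simp] theorem Store.setMem_mem (σ : Store) (a i v b : ℕ) :
    (σ.setMem a i v).mem b =
      if b = a then Function.update (σ.mem a) i v else σ.mem b := by
  simp [Store.setMem, Function.update_apply]

instance : Add Expr := ⟨Expr.bin .add⟩
instance : Sub Expr := ⟨Expr.bin .sub⟩
instance : Mul Expr := ⟨Expr.bin .mul⟩
instance : Div Expr := ⟨Expr.bin .div⟩
instance : Mod Expr := ⟨Expr.bin .mod⟩

/-- The comparison as an expression. -/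
def Expr.lt (e f : Expr) : Expr := .bin .lt e f

/-- The test for equality as an expression. -/
def Expr.eq (e f : Expr) : Expr := .bin .eq e f

section
variable (σ : Store) (e f : Expr)

@[simp] theorem Expr.eval_const (v : ℕ) : (Expr.const v).eval σ = v := rfl
@[simp] theorem Expr.eval_var (x : ℕ) : (Expr.var x).eval σ = σ.reg x := rfl
@[simp] theorem Expr.eval_cell (a : ℕ) : (Expr.cell a e).eval σ = σ.mem a (e.eval σ) := rfl
@[simp] theorem Expr.eval_add : (e + f).eval σ = e.eval σ + f.eval σ := rfl
@[simp] theorem Expr.eval_sub : (e - f).eval σ = e.eval σ - f.eval σ := rfl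
@[simp] theorem Expr.eval_mul : (e * f).eval σ = e.eval σ * f.eval σ := rfl
@[simp] theorem Expr.eval_div : (e / f).eval σ = e.eval σ / f.eval σ := rfl
@[simp] theorem Expr.eval_mod : (e % f).eval σ = e.eval σ % f.eval σ := rfl
@[simp] theorem Expr.eval_lt :
    (Expr.lt e f).eval σ = if e.eval σ < f.eval σ then 1 else 0 := rfl
@[simp] theorem Expr.eval_eq :
    (Expr.eq e f).eval σ = if e.eval σ = f.eval σ then 1 else 0 := rfl

@[simp] theorem Expr.cost_const (v : ℕ) : (Expr.const v).cost = 1 := rfl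
@[simp] theorem Expr.cost_var (x : ℕ) : (Expr.var x).cost = 1 := rfl
@[simp] theorem Expr.cost_cell (a : ℕ) : (Expr.cell a e).cost = e.cost + 1 := rfl
@[simp] theorem Expr.cost_add : (e + f).cost = e.cost + f.cost + 1 := rfl
@[simp] theorem Expr.cost_sub : (e - f).cost = e.cost + f.cost + 1 := rfl
@[simp] theorem Expr.cost_mul : (e * f).cost = e.cost + f.cost + 1 := rfl
@[simp] theorem Expr.cost_div : (e / f).cost = e.cost + f.cost + 1 := rfl
@[simp] theorem Expr.cost_mod : (e % f).cost = e.cost + f.cost + 1 := rfl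
@[simp] theorem Expr.cost_lt : (Expr.lt e f).cost = e.cost + f.cost + 1 := rfl
@[simp] theorem Expr.cost_eq : (Expr.eq e f).cost = e.cost + f.cost + 1 := rfl
end

/-- All registers and all cells of the store hold values at most `M`. -/
structure Small (M : ℕ) (σ : Store) : Prop where
  reg : ∀ x, σ.reg x ≤ M
  mem : ∀ a i, σ.mem a i ≤ M

theorem Small.setReg {M : ℕ} {σ : Store} (h : Small M σ) {x v : ℕ} (hv : v ≤ M) :
    Small M (σ.setReg x v) :=
  ⟨fun y => by rw [Store.setReg_reg]; split_ifs; exacts [hv, h.reg y], h.mem⟩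

theorem Small.setMem {M : ℕ} {σ : Store} (h : Small M σ) {a i v : ℕ} (hv : v ≤ M) :
    Small M (σ.setMem a i v) :=
  ⟨h.reg, fun b j => by
    rw [Store.setMem_mem]
    split_ifs
    · rw [Function.update_apply]; split_ifs; exacts [hv, h.mem a j]
    · exact h.mem b j⟩

/-- The constants of the expression are at most `64`. -/
def Expr.ok : Expr → Bool
  | .const v => Nat.ble v 64
  | .var _ => true
  | .cell _ i => i.ok
  | .bin _ e f => e.ok && f.ok

theorem Expr.cost_pos (e : Expr) : 1 ≤ e.cost := by
  cases e <;> simp [Expr.cost]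

/-- Multiplication is the worst case and adds exponents. Addition is no worse, since two powers of M
with positive exponents have a sum at most their product. -/
theorem Expr.eval_le {M : ℕ} (hM : 64 ≤ M) {σ : Store} (h : Small M σ) (e : Expr)
    (he : e.ok = true) : e.eval σ ≤ M ^ e.cost := by
  induction e with
  | const v =>
    simp only [Expr.ok, Nat.ble_eq] at he
    simpa using he.trans hM
  | var x => simpa using h.reg x
  | cell a i _ =>
    exact (h.mem a _).trans (Nat.le_self_pow (by simp) M)
  | bin o e f ihe ihf =>
    simp only [Expr.ok, Bool.and_eq_true] at he
    have h1 := ihe he.1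
    have h2 := ihf he.2
    have hMp : 0 < M := by omega
    have p1 : M ≤ M ^ e.cost := Nat.le_self_pow (by have := e.cost_pos; omega) M
    have p2 : M ≤ M ^ f.cost := Nat.le_self_pow (by have := f.cost_pos; omega) M
    have hmul : M ^ e.cost * M ^ f.cost ≤ M ^ (e.cost + f.cost + 1) := by
      rw [← pow_add]; exact Nat.pow_le_pow_right hMp (by omega)
    have hle : M ^ e.cost ≤ M ^ (e.cost + f.cost + 1) :=
      Nat.pow_le_pow_right hMp (by omega)
    change o.eval (e.eval σ) (f.eval σ) ≤ M ^ (e.cost + f.cost + 1)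
    have hone : 1 ≤ M ^ (e.cost + f.cost + 1) := Nat.one_le_pow _ _ hMp
    cases o with
    | add =>
      refine le_trans (show e.eval σ + f.eval σ ≤ M ^ e.cost * M ^ f.cost from ?_) hmul
      nlinarith
    | sub => exact ((Nat.sub_le _ _).trans h1).trans hle
    | mul => exact (Nat.mul_le_mul h1 h2).trans hmul
    | div => exact ((Nat.div_le_self _ _).trans h1).trans hle
    | mod => exact ((Nat.mod_le _ _).trans h1).trans hle
    | lt => simp only [BinOp.eval]; split_ifs <;> omega
    | eq => simp only [BinOp.eval]; split_ifs <;> omega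

theorem Expr.fits {B M : ℕ} (hM : 64 ≤ M) {σ : Store} (h : Small M σ) (e : Expr)
    (he : e.ok = true) (hB : M ^ e.cost ≤ B) : e.Fits B σ := by
  have hMp : 0 < M := by omega
  induction e with
  | const v => exact (Expr.eval_le hM h _ he).trans hB
  | var x => exact (h.reg x).trans (by simpa using hB)
  | cell a i ih =>
    refine ⟨ih he (le_trans (Nat.pow_le_pow_right hMp (by simp)) hB), ?_⟩
    exact (h.mem a _).trans ((Nat.le_self_pow (by simp) M).trans hB)
  | bin o e f ihe ihf =>
    have hev := Expr.eval_le hM h _ he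
    simp only [Expr.ok, Bool.and_eq_true] at he
    refine ⟨ihe he.1 (le_trans (Nat.pow_le_pow_right hMp ?_) hB),
      ihf he.2 (le_trans (Nat.pow_le_pow_right hMp ?_) hB), hev.trans hB⟩
    · simp only [Expr.cost]; omega
    · simp only [Expr.cost]; omega

/-- Started in the small store `σ`, the program `p` halts in a small store, and the running time
and this store satisfy `R`. -/
def WP (B M : ℕ) (p : Prog) (σ : Store) (R : ℕ → Store → Prop) : Prop :=
  -- Two bounds are kept apart: stored values are at most `M`, while intermediate values of
  -- expressions of cost at most 40 are at most `M ^ 40`. The word size then needs no attention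
  -- inside the programs.
  64 ≤ M → M ^ 40 ≤ B → Small M σ → ∃ t τ, Exec B p σ t τ ∧ Small M τ ∧ R t τ

section
variable {B M : ℕ} {σ : Store} {R : ℕ → Store → Prop}

theorem WP.mono {p : Prog} {R' : ℕ → Store → Prop} (h : WP B M p σ R')
    (hR : ∀ t τ, R' t τ → R t τ) : WP B M p σ R := fun hM hB hS => by
  obtain ⟨t, τ, h1, h2, h3⟩ := h hM hB hS
  exact ⟨t, τ, h1, h2, hR t τ h3⟩

theorem WP.skip (h : R 1 σ) : WP B M .skip σ R :=
  fun _ _ hS => ⟨1, σ, .skip σ, hS, h⟩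

/-- The expression has small constants and is not too long. -/
def Expr.fine (e : Expr) : Bool := e.ok && Nat.ble e.cost 40

theorem Expr.fine_fits {e : Expr} (he : e.fine = true) (hM : 64 ≤ M) (hB : M ^ 40 ≤ B)
    (h : Small M σ) : e.Fits B σ := by
  simp only [Expr.fine, Bool.and_eq_true, Nat.ble_eq] at he
  exact Expr.fits hM h e he.1 (le_trans (Nat.pow_le_pow_right (by omega) he.2) hB)

/-- Only the value that is stored has to be estimated; the intermediate values fit by
`Expr.fine_fits`, whose syntactic condition is decided by computation. -/
theorem WP.assign {x : ℕ} {e : Expr} (hv : 64 ≤ M → Small M σ → e.eval σ ≤ M)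
    (hR : R (e.cost + 1) (σ.setReg x (e.eval σ))) (he : e.fine = true := by rfl) :
    WP B M (.assign x e) σ R := fun hM hB hS =>
  ⟨_, _, .assign σ x e (Expr.fine_fits he hM hB hS), hS.setReg (hv hM hS), hR⟩

theorem WP.write {a : ℕ} {i e : Expr} (hv : 64 ≤ M → Small M σ → e.eval σ ≤ M)
    (hR : R (i.cost + e.cost + 1) (σ.setMem a (i.eval σ) (e.eval σ)))
    (hi : i.fine = true := by rfl) (he : e.fine = true := by rfl) :
    WP B M (.write a i e) σ R := fun hM hB hS =>
  ⟨_, _, .write σ a i e (Expr.fine_fits hi hM hB hS) (Expr.fine_fits he hM hB hS),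
    hS.setMem (hv hM hS), hR⟩

theorem WP.seq {p q : Prog}
    (h : WP B M p σ fun t τ => WP B M q τ fun u υ => R (t + u) υ) :
    WP B M (.seq p q) σ R := fun hM hB hS => by
  obtain ⟨t, τ, h1, h2, h3⟩ := h hM hB hS
  obtain ⟨u, υ, h4, h5, h6⟩ := h3 hM hB h2
  exact ⟨_, _, .seq p q σ τ υ t u h1 h4, h5, h6⟩

theorem WP.cond {e : Expr} {p q : Prog}
    (hp : e.eval σ ≠ 0 → WP B M p σ fun t τ => R (e.cost + t + 1) τ)
    (hq : e.eval σ = 0 → WP B M q σ fun t τ => R (e.cost + t + 1) τ)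
    (he : e.fine = true := by rfl) : WP B M (.cond e p q) σ R := fun hM hB hS => by
  by_cases h : e.eval σ = 0
  · obtain ⟨t, τ, h1, h2, h3⟩ := hq h hM hB hS
    exact ⟨_, _, .cond_false e p q σ τ t (Expr.fine_fits he hM hB hS) h h1, h2, h3⟩
  · obtain ⟨t, τ, h1, h2, h3⟩ := hp h hM hB hS
    exact ⟨_, _, .cond_true e p q σ τ t (Expr.fine_fits he hM hB hS) h h1, h2, h3⟩

/-- The rule for loops: the invariant `I` is kept, and the time of each turn, in units of `1 / w`,
is paid from the potential `Ψ`. -/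
theorem WP.loop {e : Expr} {p : Prog} (w : ℕ) (hw : 0 < w) (Ψ : Store → ℕ) (I : Store → Prop)
    (hbody : ∀ σ, I σ → e.eval σ ≠ 0 →
      WP B M p σ fun t τ => I τ ∧ (t + e.cost + 1) * w + Ψ τ ≤ Ψ σ)
    (hI : I σ)
    (hR : ∀ t τ, I τ → e.eval τ = 0 → t * w + Ψ τ ≤ Ψ σ + (e.cost + 1) * w → R t τ)
    (he : e.fine = true := by rfl) : WP B M (.loop e p) σ R := fun hM hB hS => by
  have key : ∀ k σ, Ψ σ = k → I σ → Small M σ → ∃ t τ, Exec B (.loop e p) σ t τ ∧ Small M τ ∧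
      I τ ∧ e.eval τ = 0 ∧ t * w + Ψ τ ≤ Ψ σ + (e.cost + 1) * w := by
    intro k
    induction k using Nat.strong_induction_on with
    | _ k ih =>
      intro σ hk hI hS
      by_cases h : e.eval σ = 0
      · exact ⟨_, _, .loop_done e p σ (Expr.fine_fits he hM hB hS) h, hS, hI, h, by omega⟩
      · obtain ⟨t, τ, h1, h2, h3, h4⟩ := hbody σ hI h hM hB hS
        -- Each turn takes positive time and `w > 0`, so the potential that pays for the time also
        -- proves termination.
        have hlt : Ψ τ < k := by
          have : 0 < (t + e.cost + 1) * w := by positivity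
          omega
        obtain ⟨u, υ, h5, h6, h7, h8, h9⟩ := ih _ hlt τ rfl h3 h2
        refine ⟨_, _, .loop_step e p σ τ υ t u (Expr.fine_fits he hM hB hS) h h1 h5, h6, h7, h8, ?_⟩
        have : (e.cost + t + u + 1) * w = (t + e.cost + 1) * w + u * w := by ring
        omega
  obtain ⟨t, τ, h1, h2, h3, h4, h5⟩ := key _ σ rfl hI hS
  exact ⟨t, τ, h1, h2, hR t τ h3 h4 h5⟩

/-- Consecutive execution of a list of programs. -/
def Prog.block : List Prog → Prog
  | [] => .skip
  | p :: ps => .seq p (Prog.block ps)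

theorem WP.block_nil (h : R 1 σ) : WP B M (.block []) σ R := WP.skip h

theorem WP.block_cons {p : Prog} {ps : List Prog}
    (h : WP B M p σ fun t τ => WP B M (.block ps) τ fun u υ => R (t + u) υ) :
    WP B M (.block (p :: ps)) σ R := WP.seq h

end

/-- The stores agree except for the registers in `rs` and the arrays in `as`. -/
def AgreeOff (rs as : List ℕ) (σ τ : Store) : Prop :=
  (∀ x, x ∉ rs → τ.reg x = σ.reg x) ∧ ∀ a, a ∉ as → τ.mem a = σ.mem a

theorem AgreeOff.refl (rs as : List ℕ) (σ : Store) : AgreeOff rs as σ σ :=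
  ⟨fun _ _ => rfl, fun _ _ => rfl⟩

theorem AgreeOff.trans {rs as : List ℕ} {σ τ υ : Store} (h : AgreeOff rs as σ τ)
    (h' : AgreeOff rs as τ υ) : AgreeOff rs as σ υ :=
  ⟨fun x hx => (h'.1 x hx).trans (h.1 x hx), fun a ha => (h'.2 a ha).trans (h.2 a ha)⟩

theorem AgreeOff.mono {rs as rs' as' : List ℕ} {σ τ : Store} (h : AgreeOff rs as σ τ)
    (hr : rs ⊆ rs') (ha : as ⊆ as') : AgreeOff rs' as' σ τ :=
  ⟨fun x hx => h.1 x fun h' => hx (hr h'), fun a hx => h.2 a fun h' => hx (ha h')⟩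

theorem AgreeOff.setReg {rs as : List ℕ} {σ τ : Store} (h : AgreeOff rs as σ τ) {x v : ℕ}
    (hx : x ∈ rs) : AgreeOff rs as σ (τ.setReg x v) :=
  ⟨fun y hy => by
    rw [Store.setReg_reg, if_neg (fun h' : y = x => hy (h' ▸ hx)), h.1 y hy], h.2⟩

theorem AgreeOff.setMem {rs as : List ℕ} {σ τ : Store} (h : AgreeOff rs as σ τ) {a i v : ℕ}
    (ha : a ∈ as) : AgreeOff rs as σ (τ.setMem a i v) :=
  ⟨h.1, fun b hb => by
    rw [Store.setMem_mem, if_neg (fun h' : b = a => hb (h' ▸ ha)), h.2 b hb]⟩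

/-! ### The table of registered multiples -/

theorem zmod_mul_eq_iff {n : ℕ} (c i d j : ℕ) :
    (c : ZMod n) * (i : ZMod n) = (d : ZMod n) * (j : ZMod n) ↔ c * i % n = d * j % n := by
  have := ZMod.natCast_eq_natCast_iff' (c * i) (d * j) n
  push_cast at this
  exact this

theorem natCast_ne_zero_of_lt {n i : ℕ} (h0 : i ≠ 0) (h : i < n) : (i : ZMod n) ≠ 0 := by
  intro h'
  rw [ZMod.natCast_eq_zero_iff] at h'
  exact h0 (Nat.eq_zero_of_dvd_of_lt h' h)

theorem natCast_inj_of_lt {n i j : ℕ} (hi : i < n) (hj : j < n)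
    (h : (i : ZMod n) = (j : ZMod n)) : i = j := by
  rw [ZMod.natCast_eq_natCast_iff'] at h
  rwa [Nat.mod_eq_of_lt hi, Nat.mod_eq_of_lt hj] at h

/-- The multiples `(k q + 1) i`, `k < kc i`, are registered in the table: `tbl` shows the owner `i`
and `D` the coefficient. The coefficients `c` satisfy `h c < A i + h`. -/
structure TableInv (n q h : ℕ) (A tbl D kc : ℕ → ℕ) : Prop where
  kc_zero : kc 0 = 0
  bound : ∀ i < n, ∀ k < kc i, h * (k * q + 1) < A i + h
  entry : ∀ i < n, ∀ k < kc i,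
    tbl ((k * q + 1) * i % n) = i ∧ D ((k * q + 1) * i % n) = k * q + 1
  owner : ∀ x < n, tbl x ≠ 0 →
    tbl x < n ∧ ∃ k < kc (tbl x), D x = k * q + 1 ∧ x = (k * q + 1) * tbl x % n

namespace TableInv

variable {n q h : ℕ} {A tbl D kc : ℕ → ℕ}

theorem empty (hz : ∀ i < n, kc i = 0) (ht : ∀ x < n, tbl x = 0) (hn : 0 < n) :
    TableInv n q h A tbl D kc where
  kc_zero := hz 0 hn
  bound i hi k hk := by rw [hz i hi] at hk; omega
  entry i hi k hk := by rw [hz i hi] at hk; omega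
  owner x hx h := absurd (ht x hx) h

/-- Lengths enter only through the bound on the registered coefficients, which survives if the
progressions that own slots do not become shorter. -/
theorem congr_A (H : TableInv n q h A tbl D kc) {A' : ℕ → ℕ}
    (hA : ∀ i < n, kc i ≠ 0 → A i ≤ A' i) : TableInv n q h A' tbl D kc where
  kc_zero := H.kc_zero
  bound i hi k hk := lt_of_lt_of_le (H.bound i hi k hk) (by have := hA i hi (by omega); omega)
  entry := H.entry
  owner := H.owner

theorem register (H : TableInv n q h A tbl D kc) {i : ℕ} (hi : i < n) (h0 : i ≠ 0)
    (hc : h * (kc i * q + 1) < A i + h) (hx : tbl ((kc i * q + 1) * i % n) = 0) :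
    TableInv n q h A (Function.update tbl ((kc i * q + 1) * i % n) i)
      (Function.update D ((kc i * q + 1) * i % n) (kc i * q + 1))
      (Function.update kc i (kc i + 1)) where
  kc_zero := by rw [Function.update_of_ne (Ne.symm h0)]; exact H.kc_zero
  bound j hj k hk := by
    rcases eq_or_ne j i with rfl | hji
    · rw [Function.update_self] at hk
      rcases Nat.lt_succ_iff_lt_or_eq.mp hk with hk | rfl
      · exact H.bound j hj k hk
      · exact hc
    · rw [Function.update_of_ne hji] at hk
      exact H.bound j hj k hk
  entry j hj k hk := by
    -- The new slot was free, that is, marked with 0, and no entry belongs to the difference 0, so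
    -- no old entry is overwritten.
    have old : k < kc j → (Function.update tbl ((kc i * q + 1) * i % n) i)
        ((k * q + 1) * j % n) = j ∧ (Function.update D ((kc i * q + 1) * i % n) (kc i * q + 1))
        ((k * q + 1) * j % n) = k * q + 1 := by
      intro hk
      have he := H.entry j hj k hk
      have hj0 : j ≠ 0 := by rintro rfl; rw [H.kc_zero] at hk; omega
      have hne : (k * q + 1) * j % n ≠ (kc i * q + 1) * i % n := by
        intro hh; rw [hh, hx] at he; exact hj0 he.1.symm
      rw [Function.update_of_ne hne, Function.update_of_ne hne]
      exact he
    rcases eq_or_ne j i with rfl | hji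
    · rw [Function.update_self] at hk
      rcases Nat.lt_succ_iff_lt_or_eq.mp hk with hk | rfl
      · exact old hk
      · simp
    · rw [Function.update_of_ne hji] at hk
      exact old hk
  owner x hxn ht := by
    rcases eq_or_ne x ((kc i * q + 1) * i % n) with rfl | hne
    · simp only [Function.update_self]
      exact ⟨hi, kc i, by omega, rfl, rfl⟩
    · rw [Function.update_of_ne hne] at ht ⊢
      rw [Function.update_of_ne hne]
      obtain ⟨h1, k, h2, h3⟩ := H.owner x hxn ht
      refine ⟨h1, k, ?_, h3⟩
      rw [Function.update_apply]
      split_ifs with h4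
      · rw [h4] at h2; omega
      · exact h2

/-- The largest coefficient is removed, so the remaining ones are again all `k` below a bound. The
stale value in `D` does no harm, as `owner` speaks only of slots with nonzero `tbl`. -/
theorem unregister (H : TableInv n q h A tbl D kc) (hq : 0 < q) {i k : ℕ} (hi : i < n)
    (hk : kc i = k + 1) :
    TableInv n q h A (Function.update tbl ((k * q + 1) * i % n) 0) D
      (Function.update kc i k) where
  kc_zero := by
    rcases eq_or_ne i 0 with rfl | h0
    · rw [H.kc_zero] at hk; omega
    · rw [Function.update_of_ne (Ne.symm h0)]; exact H.kc_zero
  bound j hj l hl := by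
    refine H.bound j hj l ?_
    rw [Function.update_apply] at hl
    split_ifs at hl with h1
    · rw [h1]; omega
    · exact hl
  entry j hj l hl := by
    have hl' : l < kc j := by
      rw [Function.update_apply] at hl
      split_ifs at hl with h1
      · rw [h1]; omega
      · exact hl
    have he := H.entry j hj l hl'
    have he' := H.entry i hi k (by omega)
    have hne : (l * q + 1) * j % n ≠ (k * q + 1) * i % n := by
      intro hh
      rw [hh] at he
      have hij : i = j := he'.1.symm.trans he.1
      have hlk : k * q + 1 = l * q + 1 := he'.2.symm.trans he.2
      have hlk' : k = l := Nat.eq_of_mul_eq_mul_right hq (by omega)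
      subst hij hlk'
      rw [Function.update_self] at hl
      omega
    rw [Function.update_of_ne hne]
    exact he
  owner x hxn ht := by
    rcases eq_or_ne x ((k * q + 1) * i % n) with rfl | hne
    · simp at ht
    · rw [Function.update_of_ne hne] at ht ⊢
      obtain ⟨h1, l, h2, h3, h4⟩ := H.owner x hxn ht
      refine ⟨h1, l, ?_, h3, h4⟩
      rw [Function.update_apply]
      split_ifs with h5
      · rw [h5] at h2 h4
        rcases eq_or_ne l k with rfl | hlk
        · exact absurd h4 hne
        · omega
      · exact h2

/-- Registered coefficients do not exceed the length. -/
theorem coeff_le (hh : 0 < h) {c l : ℕ} (hb : h * c < l + h) (hc : 1 ≤ c) : c ≤ l := by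
  obtain ⟨h', rfl⟩ : ∃ h', h = h' + 1 := ⟨h - 1, by omega⟩
  obtain ⟨c', rfl⟩ : ∃ c', c = c' + 1 := ⟨c - 1, by omega⟩
  nlinarith [Nat.zero_le (h' * c')]

/-- The registered pairs `(i, k)` are mapped injectively to the slots of the table. -/
theorem injOn (H : TableInv n q h A tbl D kc) (hq : 0 < q) :
    Set.InjOn (fun s : (_ : ℕ) × ℕ => (s.2 * q + 1) * s.1 % n)
      ((Finset.range n).sigma fun i => Finset.range (kc i)) := by
  rintro ⟨i, k⟩ h1 ⟨j, l⟩ h2 he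
  simp only [Finset.coe_sigma, Set.mem_sigma_iff, Finset.coe_range, Set.mem_Iio] at h1 h2 he
  have e1 := H.entry i h1.1 k h1.2
  have e2 := H.entry j h2.1 l h2.2
  rw [he] at e1
  have hij : i = j := e1.1.symm.trans e2.1
  have hlk : k * q + 1 = l * q + 1 := e1.2.symm.trans e2.2
  have hlk' : k = l := Nat.eq_of_mul_eq_mul_right hq (by omega)
  subst hij hlk'
  rfl

section prime
variable [hp : Fact n.Prime]

theorem index_ne_zero {c i : ℕ} (hc : 0 < c) (hcn : c < n) (hi : i ≠ 0) (hin : i < n) :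
    c * i % n ≠ 0 := by
  intro h0
  rcases (hp.out.dvd_mul.mp (Nat.dvd_of_mod_eq_zero h0)) with h1 | h1
  · exact absurd (Nat.le_of_dvd hc h1) (by omega)
  · exact absurd (Nat.le_of_dvd (by omega) h1) (by omega)

/-- Registered coefficients are positive and at most `A i < n`, hence units modulo the prime `n`;
slot 0 is therefore never used. -/
theorem maps (H : TableInv n q h A tbl D kc) (hh : 0 < h) (hA : ∀ i < n, A i < n)
    (s : (_ : ℕ) × ℕ) (hs : s ∈ (Finset.range n).sigma fun i => Finset.range (kc i)) :
    (s.2 * q + 1) * s.1 % n ∈ (Finset.range n).erase 0 := by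
  simp only [Finset.mem_sigma, Finset.mem_range] at hs
  have hb := H.bound _ hs.1 _ hs.2
  have hc := coeff_le hh hb (by omega)
  have hn := hA _ hs.1
  have h0 : s.1 ≠ 0 := by
    intro h0
    have := hs.2
    rw [h0, H.kc_zero] at this
    omega
  exact Finset.mem_erase.mpr ⟨index_ne_zero (by omega) (by omega) h0 hs.1,
    Finset.mem_range.mpr (Nat.mod_lt _ hp.out.pos)⟩

/-- Pigeonhole in the n − 1 nonzero slots. This is what prevents a phase with large total length
from ending with everything registered. -/
theorem sum_kc_lt (H : TableInv n q h A tbl D kc) (hq : 0 < q) (hh : 0 < h)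
    (hA : ∀ i < n, A i < n) : ∑ i ∈ Finset.range n, kc i < n := by
  have h1 := Finset.card_le_card_of_injOn _ (H.maps hh hA) (H.injOn hq)
  rw [Finset.card_sigma, Finset.card_erase_of_mem (by simpa using hp.out.pos)] at h1
  simp only [Finset.card_range] at h1
  have := hp.out.pos
  omega

/-- If there are `n - 1` registered multiples, then every nonzero slot of the table is used. -/
theorem full (H : TableInv n q h A tbl D kc) (hq : 0 < q) (hh : 0 < h)
    (hA : ∀ i < n, A i < n) (hs : ∑ i ∈ Finset.range n, kc i + 1 = n) {x : ℕ} (hx : x < n)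
    (h0 : x ≠ 0) : tbl x ≠ 0 := by
  have h1 := Finset.surjOn_of_injOn_of_card_le _ (H.maps hh hA) (H.injOn hq) (by
    rw [Finset.card_sigma, Finset.card_erase_of_mem (by simpa using hp.out.pos)]
    simp only [Finset.card_range]
    omega)
  obtain ⟨⟨i, k⟩, h2, h3⟩ := h1 (show x ∈ (((Finset.range n).erase 0 : Finset ℕ) : Set ℕ) by
    simp [hx, h0])
  simp only [Finset.coe_sigma, Set.mem_sigma_iff, Finset.coe_range, Set.mem_Iio] at h2 h3
  rw [← h3, (H.entry i h2.1 k h2.2).1]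
  rintro rfl
  rw [H.kc_zero] at h2
  omega

/-- The owner of the slot that is needed for the next multiple of `i` is different from `i`. -/
theorem owner_ne (H : TableInv n q h A tbl D kc) (hq : 0 < q) (hh : 0 < h)
    (hA : ∀ i < n, A i < n) {i : ℕ} (hi : i < n) (hc : h * (kc i * q + 1) < A i + h)
    (h0 : i ≠ 0) :
    tbl ((kc i * q + 1) * i % n) ≠ i := by
  intro he
  have hn := hA i hi
  have hx : (kc i * q + 1) * i % n < n := Nat.mod_lt _ hp.out.pos
  obtain ⟨-, k, h2, h3, h4⟩ := H.owner _ hx (by rw [he]; exact h0)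
  rw [he] at h2 h4
  have := coeff_le hh (H.bound i hi k h2) (by omega)
  have := coeff_le hh hc (by omega)
  rw [← zmod_mul_eq_iff] at h4
  have h5 := natCast_inj_of_lt (by omega) (by omega)
    (mul_right_cancel₀ (natCast_ne_zero_of_lt h0 hi) h4)
  have : kc i = k := Nat.eq_of_mul_eq_mul_right hq (by omega)
  omega

/-- With `q = 1`, the first collision found has coprime coefficients. -/
theorem coprime (H : TableInv n 1 h A tbl D kc) {i j c d : ℕ} (hi : i < n) (hj : j < n)
    (hij : i ≠ j) (hc : c ≤ kc i + 1) (hd : d ≤ kc j) (hc0 : 0 < c) (hd0 : 0 < d) (hcn : c < n)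
    (he : c * i % n = d * j % n) : Nat.Coprime c d := by
  by_contra hg
  obtain ⟨g, c', d', hgd⟩ : ∃ g c' d', g = Nat.gcd c d ∧ c = g * c' ∧ d = g * d' := by
    obtain ⟨c', hc'⟩ := Nat.gcd_dvd_left c d
    obtain ⟨d', hd'⟩ := Nat.gcd_dvd_right c d
    exact ⟨_, c', d', rfl, hc', hd'⟩
  obtain ⟨hg1, rfl, rfl⟩ := hgd
  have hg2 : 2 ≤ g := by
    have : g ≠ 1 := by rw [hg1]; exact hg
    have : g ≠ 0 := by rintro rfl; simp at hc0
    omega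
  have hc'0 : 0 < c' := Nat.pos_of_mul_pos_left hc0
  have hd'0 : 0 < d' := Nat.pos_of_mul_pos_left hd0
  have hgn : g < n := lt_of_le_of_lt (Nat.le_mul_of_pos_right g hc'0) hcn
  rw [← zmod_mul_eq_iff] at he
  push_cast at he
  rw [mul_assoc, mul_assoc] at he
  have h1 := mul_left_cancel₀ (natCast_ne_zero_of_lt (by omega) hgn) he
  rw [zmod_mul_eq_iff] at h1
  -- The reduced coefficients are at most half of `c` and `d`, so both reduced multiples are already
  -- registered. They share a slot, which would then have two owners.
  have hc'k : c' - 1 < kc i := by nlinarith [Nat.sub_add_cancel hc'0]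
  have hd'k : d' - 1 < kc j := by nlinarith [Nat.sub_add_cancel hd'0]
  have e1 := (H.entry i hi _ hc'k).1
  have e2 := (H.entry j hj _ hd'k).1
  rw [mul_one, Nat.sub_add_cancel hc'0] at e1
  rw [mul_one, Nat.sub_add_cancel hd'0] at e2
  rw [h1, e2] at e1
  exact hij e1.symm

end prime

/-- If all progressions are completely registered, then the total length is bounded. -/
theorem sum_le_of_complete (hc : ∀ i < n, A i + h ≤ h * (kc i * q + 1)) :
    ∑ i ∈ Finset.range n, A i ≤ h * q * ∑ i ∈ Finset.range n, kc i := by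
  rw [Finset.mul_sum]
  refine Finset.sum_le_sum fun i hi => ?_
  have := hc i (Finset.mem_range.mp hi)
  nlinarith

/-- The number of registered multiples of `i` is about `A i / q`. -/
theorem kc_mul_le (H : TableInv n q h A tbl D kc) (hh : 0 < h) {i : ℕ} (hi : i < n) :
    q * kc i ≤ A i + q := by
  rcases Nat.eq_zero_or_pos (kc i) with h0 | h0
  · simp [h0]
  · have := coeff_le hh (H.bound i hi (kc i - 1) (by omega)) (by omega)
    obtain ⟨k, hk⟩ : ∃ k, kc i = k + 1 := ⟨kc i - 1, by omega⟩
    rw [hk] at this ⊢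
    simp only [Nat.add_sub_cancel] at this
    nlinarith

end TableInv

/-! ### The gain of an operation -/

/-- If x = 1, all of s is multiplied by y ≥ 1 + q. Otherwise x ≤ s implies that the part of s that
is exchanged, a multiple of x, exceeds s/2, and it is multiplied by at least E; the loss of the
remainder costs only a factor 2. -/
theorem exchange_gain {s y x E κ q : ℕ} (hx : 1 ≤ x) (hxs : x ≤ s) (hyx : x + q ≤ y)
    (hE : 4 ≤ E) (hκE : κ ≤ E) (hκq : κ ≤ 4 * q) (h : x = 1 ∨ E * x ≤ y) :
    κ * s + 4 * s ≤ 4 * (s / x * y) := by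
  rcases h with rfl | h
  · rw [Nat.div_one]; nlinarith
  · have h1 : s < (s / x + 1) * x := by
      rw [mul_comm]; exact Nat.lt_mul_div_succ s (by omega)
    have h2 : 1 ≤ s / x := (Nat.one_le_div_iff (by omega)).mpr hxs
    set r := s / x
    have h3 : s + 1 ≤ 2 * (r * x) := by nlinarith
    have h4 : r * (E * x) ≤ r * y := Nat.mul_le_mul_left r h
    have h5 : E * s ≤ 2 * (r * (E * x)) := by nlinarith
    have h6 : 4 * s ≤ E * s := Nat.mul_le_mul_right s hE
    have h7 : κ * s ≤ E * s := Nat.mul_le_mul_right s hκE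
    nlinarith

/-- For t = v and s = w the new length is 2(v + w − 1), and each further unit of t or s adds w or v.
As v + w ≥ 4 and v, w ≥ 2, this is at least 3/2 times the length consumed. -/
theorem fuse_gain_one {t s v w : ℕ} (hv : v ≤ t) (hw : w ≤ s) (hw2 : 2 ≤ w) (hvw : w < v) :
    2 * (t + s) + 4 * (t + s) + 8 * ((v - 1) * (w - 1)) ≤ 4 * (t * w + s * v) := by
  obtain ⟨t, rfl⟩ := Nat.exists_eq_add_of_le hv
  obtain ⟨s, rfl⟩ := Nat.exists_eq_add_of_le hw
  obtain ⟨w, rfl⟩ := Nat.exists_eq_add_of_le hw2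
  obtain ⟨v, rfl⟩ := Nat.exists_eq_add_of_le hvw
  have e1 : 2 + w + 1 + v - 1 = 2 + w + v := by omega
  have e2 : 2 + w - 1 = 1 + w := by omega
  rw [show (2 + w).succ + v - 1 = 2 + w + v by omega, e2]
  simp only [Nat.succ_eq_add_one]
  nlinarith [Nat.zero_le (t * w), Nat.zero_le (s * w), Nat.zero_le (s * v)]

/-- The factor 2 in the hypotheses makes tw + sv at least 4(v − 1)(w − 1), so the subtracted term
takes at most half of it. The other half is at least e(t + s)/2, and e ≥ 4. -/
theorem fuse_gain_two {t s v w e : ℕ} (hv : 2 * v ≤ t + 1) (hw : 2 * w ≤ s + 1) (he : 4 ≤ e)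
    (hev : e ≤ v) (hew : e ≤ w) :
    e * (t + s) + 4 * (t + s) + 8 * ((v - 1) * (w - 1)) ≤ 4 * (t * w + s * v) := by
  obtain ⟨v, rfl⟩ : ∃ v', v = v' + 1 := ⟨v - 1, by omega⟩
  obtain ⟨w, rfl⟩ : ∃ w', w = w' + 1 := ⟨w - 1, by omega⟩
  simp only [Nat.add_sub_cancel]
  have h1 : 2 * v * w ≤ t * w := Nat.mul_le_mul_right w (by omega)
  have h2 : 2 * w * v ≤ s * v := Nat.mul_le_mul_right v (by omega)
  have h3 : t * e ≤ t * (w + 1) := Nat.mul_le_mul_left t hew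
  have h4 : s * e ≤ s * (v + 1) := Nat.mul_le_mul_left s hev
  have h5 : 4 * t ≤ e * t := Nat.mul_le_mul_right t he
  have h6 : 4 * s ≤ e * s := Nat.mul_le_mul_right s he
  nlinarith

/-- The fixed parameters of a phase: multiples with coefficients `c ≡ 1 (mod q)` and
`h c < A i + h` are registered, two progressions are fused if the ratio of the coefficients is less
than `E`, and every operation increases the total length by at least `κ / 4` times the length that
it consumes. -/
structure Params (q h E κ : ℕ) : Prop where
  q_pos : 0 < q
  h_pos : 0 < h
  κ_pos : 0 < κ
  E_ge : 4 ≤ E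
  κ_le_E : κ ≤ E
  κ_le_q : κ ≤ 4 * q
  -- With L the length made by the fusion this says 4L ≥ (κ + 4)(t + s); the subtracted term is
  -- moved to the left because of truncation.
  fuse : ∀ t s y x, 1 < x → x + q ≤ y → y < E * x → Nat.Coprime y q → y % q = x % q →
    h * y < t + h → h * x < s + h → (q = 1 → Nat.Coprime y x) →
    κ * (t + s) + 4 * (t + s) + 8 * ((y / y.gcd x - 1) * (x / y.gcd x - 1)) ≤
      4 * (t * (x / y.gcd x) + s * (y / y.gcd x))

/-- For q = 1 the congruence is empty, and the coprimality of the coefficients, supplied by the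
complete table, takes its place. -/
theorem params_one : Params 1 1 4 2 where
  q_pos := by omega
  h_pos := by omega
  κ_pos := by omega
  E_ge := le_rfl
  κ_le_E := by omega
  κ_le_q := by omega
  fuse t s y x hx hxy _ _ _ hy hx' hc := by
    rw [Nat.Coprime.gcd_eq_one (hc rfl), Nat.div_one, Nat.div_one]
    exact fuse_gain_one (by omega) (by omega) (by omega) (by omega)

/-- The reason for registering only c ≡ 1 mod e²: the gcd is prime to e², so e² divides v − w also
after reduction. Thus v > e², and v < e·w forces w ≥ e: the reduced coefficients cannot be small,
however large the gcd is. -/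
theorem params_two {e : ℕ} (he : 4 ≤ e) : Params (e * e) 2 e e where
  q_pos := by positivity
  h_pos := by omega
  κ_pos := by omega
  E_ge := he
  κ_le_E := le_rfl
  κ_le_q := by nlinarith
  fuse t s y x hx hxy hyE hcop hmod hy hx' _ := by
    have hg : 0 < y.gcd x := Nat.gcd_pos_of_pos_right _ (by omega)
    obtain ⟨v, hv⟩ := Nat.gcd_dvd_left y x
    obtain ⟨w, hw⟩ := Nat.gcd_dvd_right y x
    have hgc : Nat.Coprime (y.gcd x) (e * e) := Nat.Coprime.coprime_dvd_left (Nat.gcd_dvd_left _ _) hcop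
    set g := y.gcd x
    rw [show y / g = v by rw [hv, Nat.mul_div_cancel_left _ hg],
      show x / g = w by rw [hw, Nat.mul_div_cancel_left _ hg]]
    have hwv : w < v := by
      by_contra hcon
      have := Nat.mul_le_mul_left g (not_lt.mp hcon)
      have : 0 < e * e := by positivity
      omega
    have hd : e * e ∣ y - x := (Nat.modEq_iff_dvd' (by omega)).mp hmod.symm
    have hd2 : e * e ∣ v - w := by
      rw [hv, hw, ← Nat.mul_sub] at hd
      exact Nat.Coprime.dvd_of_dvd_mul_left hgc.symm hd
    have hq := Nat.le_of_dvd (by omega) hd2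
    have hvE : v < e * w := by
      by_contra hcon
      have := Nat.mul_le_mul_left g (not_lt.mp hcon)
      have : g * (e * w) = e * (g * w) := by ring
      rw [← hw] at this
      omega
    have hew : e ≤ w := by
      by_contra hcon
      have := Nat.mul_le_mul_left e (not_le.mp hcon).le
      omega
    have hvy : v ≤ y := by rw [hv]; exact Nat.le_mul_of_pos_left _ hg
    have hwx : w ≤ x := by rw [hw]; exact Nat.le_mul_of_pos_left _ hg
    exact fuse_gain_two (by omega) (by omega) he (by omega) hew

/-- The factor q of y − x is prime to y and can be removed. Starting Euclid's algorithm with (y −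
x)/q bounds its turns by a number of table entries instead of by y. -/
theorem gcd_eq_gcd_sub_div {y x q : ℕ} (hxy : x ≤ y) (hc : Nat.Coprime y q)
    (hmod : y % q = x % q) : y.gcd ((y - x) / q) = y.gcd x := by
  obtain ⟨d, hd⟩ := (Nat.modEq_iff_dvd' hxy).mp hmod.symm
  rcases Nat.eq_zero_or_pos q with rfl | hq
  · have : y = x := by omega
    subst this
    simp at hc
    simp [hc]
  · rw [hd, Nat.mul_div_cancel_left _ hq, ← Nat.Coprime.gcd_mul_left_cancel_right d hc.symm, ← hd,
      Nat.gcd_self_sub_right hxy]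

/-! ### Sumsets indexed by natural numbers -/

/-- The sumset whose lengths are `A 0, …, A (n - 1)`. -/
def toZ (n : ℕ) (A : ℕ → ℕ) : ZMod n → ℕ := fun i => A i.val

theorem toZ_natCast {n : ℕ} (A : ℕ → ℕ) {a : ℕ} (ha : a < n) : toZ n A (a : ZMod n) = A a := by
  rw [toZ, ZMod.val_natCast, Nat.mod_eq_of_lt ha]

theorem toZ_update {n : ℕ} [NeZero n] (A : ℕ → ℕ) {a : ℕ} (ha : a < n) (v : ℕ) :
    toZ n (Function.update A a v) = Function.update (toZ n A) (a : ZMod n) v := by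
  funext i
  rw [toZ, Function.update_apply, Function.update_apply]
  have : i.val = a ↔ i = (a : ZMod n) := by
    constructor
    · rintro rfl; simp
    · rintro rfl; rw [ZMod.val_natCast, Nat.mod_eq_of_lt ha]
  simp only [this, toZ]

theorem Transforms.append {n : ℕ} {l l' : List (Op n)} {A A' A'' : ZMod n → ℕ}
    (h : Transforms l A A') (h' : Transforms l' A' A'') : Transforms (l ++ l') A A'' := by
  induction l generalizing A with
  | nil => obtain rfl : A' = A := h; exact h'
  | cons o os ih => exact ⟨h.1, ih h.2⟩

theorem Transforms.snoc {n : ℕ} {l : List (Op n)} {A A' : ZMod n → ℕ} (h : Transforms l A A')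
    {o : Op n} (ho : o.Valid A') : Transforms (l ++ [o]) A (o.result A') :=
  h.append ⟨ho, rfl⟩

theorem drop_spec {n : ℕ} [NeZero n] (A : ℕ → ℕ) {a : ℕ} (ha : a < n) :
    (Op.drop (a : ZMod n) (A a)).Valid (toZ n A) ∧
      (Op.drop (a : ZMod n) (A a)).result (toZ n A) = toZ n (Function.update A a 0) := by
  refine ⟨(toZ_natCast A ha).ge, ?_⟩
  rw [toZ_update A ha]
  funext i
  simp only [Op.result, Pi.sub_apply, Function.update_apply, Pi.single_apply]
  split_ifs with h
  · rw [h, toZ_natCast A ha, Nat.sub_self]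
  · simp

theorem exchange_spec {n : ℕ} [NeZero n] (A : ℕ → ℕ) {a b y x r : ℕ} (ha : a < n) (hb : b < n)
    (hab : a ≠ b) (he : y * a % n = x * b % n) (hx : 1 ≤ x) (hxy : x < y) (hy : y ≤ A a)
    (hr : r * x ≤ A b) :
    (Op.exchange (a : ZMod n) (b : ZMod n) y x r).Valid (toZ n A) ∧
      (Op.exchange (a : ZMod n) (b : ZMod n) y x r).result (toZ n A) =
        toZ n (Function.update (Function.update A b (A b - r * x)) a (A a + r * y)) := by
  have hne : (a : ZMod n) ≠ (b : ZMod n) := fun h => hab (natCast_inj_of_lt ha hb h)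
  refine ⟨⟨hne, (zmod_mul_eq_iff _ _ _ _).mpr he, hx, hxy, ?_, ?_⟩, ?_⟩
  · rwa [toZ_natCast A ha]
  · rwa [toZ_natCast A hb]
  · rw [toZ_update _ ha, toZ_update _ hb]
    funext i
    simp only [Op.result, Pi.sub_apply, Pi.add_apply, Function.update_apply, Pi.single_apply]
    split_ifs with h1 h2 h2
    · exact absurd (h2.symm.trans h1) hne
    · rw [h1, toZ_natCast A hb]; omega
    · rw [h2, toZ_natCast A ha]; omega
    · simp

theorem fuse_spec {n : ℕ} [Fact n.Prime] (A : ℕ → ℕ) {a b v w z : ℕ} (ha : a < n) (hb : b < n)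
    (hz : z < n) (ha0 : a ≠ 0) (hb0 : b ≠ 0) (hab : a ≠ b) (he : v * a % n = w * b % n)
    (hv : 1 ≤ v) (hvn : v < n) (hw : 1 ≤ w) (hwn : w < n) (hc : Nat.Coprime v w)
    (hva : v ≤ A a) (hwb : w ≤ A b) (hzw : (z : ZMod n) * (w : ZMod n) = (a : ZMod n)) :
    (Op.fuse (a : ZMod n) (b : ZMod n) v w (A a) (A b)).Valid (toZ n A) ∧
      (Op.fuse (a : ZMod n) (b : ZMod n) v w (A a) (A b)).result (toZ n A) =
        toZ n (Function.update (Function.update (Function.update A a 0) b 0) z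
          (Function.update (Function.update A a 0) b 0 z +
            (A a * w + A b * v - 2 * ((v - 1) * (w - 1))))) := by
  have hne : (a : ZMod n) ≠ (b : ZMod n) := fun h => hab (natCast_inj_of_lt ha hb h)
  refine ⟨⟨natCast_ne_zero_of_lt ha0 ha, natCast_ne_zero_of_lt hb0 hb, hne, hv, hvn, hw, hwn, hc,
    (zmod_mul_eq_iff _ _ _ _).mpr he, hva, (toZ_natCast A ha).ge, hwb, (toZ_natCast A hb).ge⟩, ?_⟩
  have hw0 : (w : ZMod n) ≠ 0 := natCast_ne_zero_of_lt (by omega) hwn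
  have hzz : (a : ZMod n) * (w : ZMod n)⁻¹ = (z : ZMod n) := by
    rw [← hzw, mul_assoc, mul_inv_cancel₀ hw0, mul_one]
  have key : toZ n A - Pi.single (a : ZMod n) (A a) - Pi.single (b : ZMod n) (A b) =
      toZ n (Function.update (Function.update A a 0) b 0) := by
    rw [toZ_update _ hb, toZ_update _ ha]
    funext i
    simp only [Pi.sub_apply, Function.update_apply, Pi.single_apply]
    split_ifs with h1 h2 h2
    · exact absurd (h1.symm.trans h2) hne
    · rw [h1, toZ_natCast A ha]; omega
    · rw [h2, toZ_natCast A hb]; omega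
    · simp
  rw [Op.result, key, hzz, toZ_update _ hz, ← toZ_natCast (Function.update (Function.update A a 0) b 0) hz]
  funext i
  simp only [Pi.add_apply, Function.update_apply, Pi.single_apply]
  split_ifs with h1
  · rw [h1]
  · simp

/-! ### Total length and number of progressions -/

theorem sum_update {n : ℕ} (A : ℕ → ℕ) {a : ℕ} (ha : a < n) (v : ℕ) :
    ∑ i ∈ Finset.range n, Function.update A a v i + A a = ∑ i ∈ Finset.range n, A i + v := by
  have h := Finset.mem_range.mpr ha
  rw [Finset.sum_update_of_mem h, ← Finset.sum_sdiff (Finset.singleton_subset_iff.mpr h)]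
  simp only [Finset.sum_singleton]
  omega

/-- The number of progressions of a sumset. -/
def numAP (n : ℕ) (A : ℕ → ℕ) : ℕ := ∑ i ∈ Finset.range n, if A i = 0 then 0 else 1

theorem numAP_update {n : ℕ} (A : ℕ → ℕ) {a : ℕ} (ha : a < n) (v : ℕ) :
    numAP n (Function.update A a v) + (if A a = 0 then 0 else 1) =
      numAP n A + (if v = 0 then 0 else 1) := by
  have := sum_update (fun i => if A i = 0 then 0 else 1) ha (if v = 0 then 0 else 1)
  rw [numAP, numAP, ← this]
  congr 1
  refine Finset.sum_congr rfl fun i _ => ?_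
  rw [Function.update_apply, Function.update_apply]
  split_ifs <;> simp_all

theorem numAP_le (n : ℕ) (A : ℕ → ℕ) : numAP n A ≤ n := by
  calc numAP n A ≤ ∑ i ∈ Finset.range n, 1 := Finset.sum_le_sum fun i _ => by split_ifs <;> omega
    _ = n := by simp

theorem exchange_count {n : ℕ} (A : ℕ → ℕ) {a b : ℕ} (ha : a < n) (hb : b < n) (hab : a ≠ b)
    (hA : A a ≠ 0) (hB : A b ≠ 0) (u : ℕ) :
    ∑ i ∈ Finset.range n, Function.update (Function.update A b 0) a (A a + u) i + A b =
        ∑ i ∈ Finset.range n, A i + u ∧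
      numAP n (Function.update (Function.update A b 0) a (A a + u)) + 1 = numAP n A := by
  have h1 := sum_update (Function.update A b 0) ha (A a + u)
  have h2 := sum_update A hb 0
  have h3 := numAP_update (Function.update A b 0) ha (A a + u)
  have h4 := numAP_update A hb 0
  rw [Function.update_of_ne hab] at h1 h3
  rw [if_neg hA, if_neg (by omega)] at h3
  rw [if_neg hB, if_pos rfl] at h4
  omega

/-- The difference z may be new, or carry a third progression, or equal a or b; in each case at
least one progression disappears. -/
theorem fuse_count {n : ℕ} (A : ℕ → ℕ) {a b z : ℕ} (ha : a < n) (hb : b < n) (hz : z < n)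
    (hab : a ≠ b) (hA : A a ≠ 0) (hB : A b ≠ 0) (u : ℕ) :
    ∑ i ∈ Finset.range n, Function.update (Function.update (Function.update A a 0) b 0) z
          (Function.update (Function.update A a 0) b 0 z + u) i + A a + A b =
        ∑ i ∈ Finset.range n, A i + u ∧
      numAP n (Function.update (Function.update (Function.update A a 0) b 0) z
          (Function.update (Function.update A a 0) b 0 z + u)) + 1 ≤ numAP n A := by
  have h1 := sum_update A ha 0
  have h2 := sum_update (Function.update A a 0) hb 0
  have h3 := sum_update (Function.update (Function.update A a 0) b 0) hz
    (Function.update (Function.update A a 0) b 0 z + u)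
  have h4 := numAP_update A ha 0
  have h5 := numAP_update (Function.update A a 0) hb 0
  have h6 := numAP_update (Function.update (Function.update A a 0) b 0) hz
    (Function.update (Function.update A a 0) b 0 z + u)
  rw [Function.update_of_ne hab.symm] at h2 h5
  rw [if_neg hA, if_pos rfl] at h4
  rw [if_neg hB, if_pos rfl] at h5
  constructor
  · omega
  · have : (if Function.update (Function.update A a 0) b 0 z + u = 0 then 0 else 1) ≤ 1 := by
      split_ifs <;> omega
    omega

/-! ### The program -/

notation "regN" => (0 : ℕ)
notation "regK" => (1 : ℕ)
notation "regCur" => (2 : ℕ)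
notation "regP" => (3 : ℕ)
notation "regT" => (4 : ℕ)
notation "regF" => (5 : ℕ)
notation "regQ" => (6 : ℕ)
notation "regH" => (7 : ℕ)
notation "regE" => (8 : ℕ)
notation "regG" => (9 : ℕ)
notation "regC" => (10 : ℕ)
notation "regX" => (11 : ℕ)
notation "regJ" => (12 : ℕ)
notation "reg_a" => (13 : ℕ)
notation "reg_b" => (14 : ℕ)
notation "reg_y" => (15 : ℕ)
notation "reg_x" => (16 : ℕ)
notation "reg_r" => (17 : ℕ)
notation "reg_s" => (18 : ℕ)
notation "reg_t" => (19 : ℕ)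
notation "reg_v" => (20 : ℕ)
notation "reg_w" => (21 : ℕ)
notation "reg_g" => (22 : ℕ)
notation "reg_d" => (23 : ℕ)
notation "regTmp" => (24 : ℕ)
notation "reg_z" => (25 : ℕ)
notation "regLg" => (26 : ℕ)
notation "regPow" => (27 : ℕ)
notation "regS" => (28 : ℕ)
notation "regThr" => (29 : ℕ)
notation "reg_i" => (30 : ℕ)
notation "regRoot" => (31 : ℕ)
notation "arrA" => (0 : ℕ)
notation "arrTbl" => (8 : ℕ)
notation "arrKc" => (9 : ℕ)
notation "arrD" => (10 : ℕ)
notation "arrInv" => (11 : ℕ)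

open EGZ.Expr EGZ.Prog

/-- Append an operation to the record; its parameters are in the given registers. -/
def emit (kind r2 r3 r4 r5 r6 r7 : ℕ) : Prog := block [
  write 1 (var regK) (const kind),
  write 2 (var regK) (var r2),
  write 3 (var regK) (var r3),
  write 4 (var regK) (var r4),
  write 5 (var regK) (var r5),
  write 6 (var regK) (var r6),
  write 7 (var regK) (var r7),
  assign regK (var regK + const 1)]

/-- Remove all the multiples of the difference in the register `rb` from the table. -/
def unregister (rb : ℕ) : Prog :=
  loop (cell arrKc (var rb)) (block [
    assign regTmp (cell arrKc (var rb) - const 1),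
    write arrTbl ((var regTmp * var regQ + const 1) * var rb % var regN) (const 0),
    write arrKc (var rb) (var regTmp)])

/-- Euclid's algorithm. -/
def euclid : Prog :=
  loop (var reg_d) (block [
    assign regTmp (var reg_g % var reg_d),
    assign reg_g (var reg_d),
    assign reg_d (var regTmp)])

/-- Move the progression with difference `b` to the one with difference `a`. -/
def exchange : Prog := block [
  assign reg_s (cell arrA (var reg_b)),
  assign reg_r (var reg_s / var reg_x),
  emit 1 reg_a reg_b reg_y reg_x reg_r reg_r,
  assign regT (var regT + var reg_r * var reg_y - var reg_s),
  write arrA (var reg_b) (var reg_s - var reg_r * var reg_x),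
  write arrA (var reg_a) (cell arrA (var reg_a) + var reg_r * var reg_y),
  -- The remainder, shorter than x, is dropped, so that every exchange removes a progression for
  -- good.
  assign regTmp (cell arrA (var reg_b)),
  emit 0 reg_b regTmp reg_b reg_b reg_b reg_b,
  write arrA (var reg_b) (const 0),
  assign regCur (var reg_a)]

/-- Replace the progressions with differences `a` and `b` by one with difference `z`. -/
def fuse : Prog := block [
  unregister reg_a,
  assign reg_g (var reg_y),
  assign reg_d ((var reg_y - var reg_x) / var regQ),
  euclid,
  assign reg_v (var reg_y / var reg_g),
  assign reg_w (var reg_x / var reg_g),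
  assign reg_t (cell arrA (var reg_a)),
  assign reg_s (cell arrA (var reg_b)),
  emit 2 reg_a reg_b reg_v reg_w reg_t reg_s,
  assign reg_z (var reg_a * cell arrInv (var reg_w) % var regN),
  assign reg_r (var reg_t * var reg_w + var reg_s * var reg_v -
    const 2 * ((var reg_v - const 1) * (var reg_w - const 1))),
  assign regT (var regT + var reg_r - var reg_t - var reg_s),
  write arrA (var reg_a) (const 0),
  write arrA (var reg_b) (const 0),
  write arrA (var reg_z) (cell arrA (var reg_z) + var reg_r),
  assign regCur (var reg_z)]

/-! ### The record -/

/-- The operation with the given kind and parameters. -/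
def opOf (n kind p2 p3 p4 p5 p6 p7 : ℕ) : Op n :=
  match kind with
  | 0 => .drop (p2 : ZMod n) p3
  | 1 => .exchange (p2 : ZMod n) (p3 : ZMod n) p4 p5 p6
  | _ => .fuse (p2 : ZMod n) (p3 : ZMod n) p4 p5 p6 p7

theorem Store.opAt_eq (n : ℕ) (σ : Store) (l : ℕ) :
    σ.opAt n l = opOf n (σ.mem 1 l) (σ.mem 2 l) (σ.mem 3 l) (σ.mem 4 l) (σ.mem 5 l) (σ.mem 6 l)
      (σ.mem 7 l) := rfl

theorem Store.sumset_eq (n : ℕ) (σ : Store) : σ.sumset n = toZ n (σ.mem 0) := rfl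

theorem Store.record_congr {n : ℕ} {σ τ : Store} (h1 : τ.reg 1 = σ.reg 1)
    (h : ∀ a, 1 ≤ a → a ≤ 7 → τ.mem a = σ.mem a) : τ.record n = σ.record n := by
  rw [Store.record, Store.record, h1]
  congr 1
  funext l
  rw [Store.opAt_eq, Store.opAt_eq, h 1, h 2, h 3, h 4, h 5, h 6, h 7] <;> omega

theorem AgreeOff.record {n : ℕ} {rs as : List ℕ} {σ τ : Store} (h : AgreeOff rs as σ τ)
    (hr : 1 ∉ rs) (ha : ∀ a ∈ as, a = 0 ∨ 8 ≤ a) : τ.record n = σ.record n :=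
  Store.record_congr (h.1 1 hr) fun a h1 h2 => h.2 a fun h3 => by
    have := ha a h3
    omega

section
variable {B M : ℕ} {σ : Store} {R : ℕ → Store → Prop}

theorem wp_emit {kind r2 r3 r4 r5 r6 r7 : ℕ} (hk : kind ≤ 64) (hK : σ.reg 1 + 1 ≤ M)
    (h : ∀ τ, AgreeOff [1] [1, 2, 3, 4, 5, 6, 7] σ τ → τ.reg 1 = σ.reg 1 + 1 →
      (∀ n, τ.record n = σ.record n ++ [opOf n kind (σ.reg r2) (σ.reg r3) (σ.reg r4) (σ.reg r5)
        (σ.reg r6) (σ.reg r7)]) → R 26 τ) :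
    WP B M (emit kind r2 r3 r4 r5 r6 r7) σ R := by
  have hf : (Expr.const kind).fine = true := by simp [Expr.fine, Expr.ok, hk]
  refine WP.block_cons (WP.write (fun hM _ => hk.trans hM) ?_ rfl hf)
  refine WP.block_cons (WP.write (fun _ hS => hS.reg _) ?_)
  refine WP.block_cons (WP.write (fun _ hS => hS.reg _) ?_)
  refine WP.block_cons (WP.write (fun _ hS => hS.reg _) ?_)
  refine WP.block_cons (WP.write (fun _ hS => hS.reg _) ?_)
  refine WP.block_cons (WP.write (fun _ hS => hS.reg _) ?_)
  refine WP.block_cons (WP.write (fun _ hS => hS.reg _) ?_)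
  refine WP.block_cons (WP.assign (fun _ _ => hK) ?_)
  refine WP.block_nil (h _ ?_ ?_ ?_)
  · refine AgreeOff.setReg ?_ (by simp)
    repeat refine AgreeOff.setMem ?_ (by simp)
    exact AgreeOff.refl _ _ _
  · simp
  · intro n
    rw [Store.record]
    simp only [Store.setReg_reg, Store.setMem_reg, eval_var, eval_add, eval_const, if_true]
    rw [List.range_succ, List.map_append]
    congr 1
    · refine List.map_congr_left fun l hl => ?_
      have hl' : l ≠ σ.reg 1 := (List.mem_range.mp hl).ne
      rw [Store.opAt_eq, Store.opAt_eq]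
      simp [Function.update_of_ne hl']
    · rw [List.map_singleton, Store.opAt_eq]
      simp

theorem wp_unregister {n q h b rb : ℕ} {A : ℕ → ℕ} (hrb : rb ≠ 24) (hb : σ.reg rb = b)
    (hbn : b < n) (hn : σ.reg 0 = n) (hq : σ.reg 6 = q) (hq0 : 0 < q)
    (H : TableInv n q h A (σ.mem 8) (σ.mem 10) (σ.mem 9))
    (hR : ∀ t τ, AgreeOff [24] [8, 9] σ τ → TableInv n q h A (τ.mem 8) (τ.mem 10) (τ.mem 9) →
      τ.mem 9 = Function.update (σ.mem 9) b 0 → t ≤ 40 * σ.mem 9 b + 10 → R t τ) :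
    WP B M (unregister rb) σ R := by
  refine WP.loop 1 one_pos (fun τ => 40 * τ.mem 9 b)
    (fun τ => AgreeOff [24] [8, 9] σ τ ∧ TableInv n q h A (τ.mem 8) (τ.mem 10) (τ.mem 9) ∧
      ∃ k, τ.mem 9 = Function.update (σ.mem 9) b k) ?_
    ⟨AgreeOff.refl _ _ _, H, σ.mem 9 b, (Function.update_eq_self _ _).symm⟩ ?_
  · rintro τ ⟨h1, h2, k, h3⟩ hne
    have e0 : τ.reg 0 = n := (h1.1 0 (by simp)).trans hn
    have e6 : τ.reg 6 = q := (h1.1 6 (by simp)).trans hq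
    have eb : τ.reg rb = b := (h1.1 rb (by simpa using hrb)).trans hb
    simp only [eval_cell, eval_var, eb] at hne
    obtain ⟨l, hl⟩ : ∃ l, τ.mem 9 b = l + 1 := ⟨τ.mem 9 b - 1, by omega⟩
    refine WP.block_cons (WP.assign (fun _ hS => (Nat.sub_le _ _).trans (hS.mem _ _)) ?_)
    refine WP.block_cons (WP.write (fun _ _ => Nat.zero_le _) ?_)
    refine WP.block_cons (WP.write (fun _ hS => hS.reg _) ?_)
    refine WP.block_nil ⟨⟨?_, ?_, ?_⟩, ?_⟩
    · exact ((h1.setReg (by simp)).setMem (by simp)).setMem (by simp)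
    · have := h2.unregister hq0 hbn hl
      simpa [hrb, eb, e0, e6, hl] using this
    · refine ⟨l, ?_⟩
      simp [hrb, eb, hl, h3]
    · simp [hrb, eb, hl]
      omega
  · rintro t τ ⟨h1, h2, k, h3⟩ hz ht
    have eb : τ.reg rb = b := (h1.1 rb (by simpa using hrb)).trans hb
    simp only [eval_cell, eval_var, eb] at hz
    refine hR t τ h1 h2 ?_ ?_
    · rw [h3] at hz ⊢
      rw [Function.update_self] at hz
      rw [hz]
    · simp at ht
      omega

/-- The crude bound by the second argument suffices, since that argument will be charged to table
entries. -/
theorem wp_euclid (hR : ∀ t τ, AgreeOff [22, 23, 24] [] σ τ →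
      τ.reg 22 = (σ.reg 22).gcd (σ.reg 23) → t ≤ 40 * σ.reg 23 + 10 → R t τ) :
    WP B M euclid σ R := by
  refine WP.loop 1 one_pos (fun τ => 40 * τ.reg 23)
    (fun τ => AgreeOff [22, 23, 24] [] σ τ ∧
      (τ.reg 22).gcd (τ.reg 23) = (σ.reg 22).gcd (σ.reg 23)) ?_ ⟨AgreeOff.refl _ _ _, rfl⟩ ?_
  · rintro τ ⟨h1, h2⟩ hne
    simp only [eval_var] at hne
    have hlt : τ.reg 22 % τ.reg 23 < τ.reg 23 := Nat.mod_lt _ (by omega)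
    refine WP.block_cons (WP.assign (fun _ hS => (Nat.mod_le _ _).trans (hS.reg _)) ?_)
    refine WP.block_cons (WP.assign (fun _ hS => hS.reg _) ?_)
    refine WP.block_cons (WP.assign (fun _ hS => hS.reg _) ?_)
    refine WP.block_nil ⟨⟨?_, ?_⟩, ?_⟩
    · exact ((h1.setReg (by simp)).setReg (by simp)).setReg (by simp)
    · rw [← h2]
      simp only [Store.setReg_reg, eval_var, eval_mod]
      simp only [reduceIte, Nat.reduceEqDiff]
      rw [Nat.gcd_comm, ← Nat.gcd_rec, Nat.gcd_comm]
    · simp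
      omega
  · rintro t τ ⟨h1, h2⟩ hz ht
    simp only [eval_var] at hz
    refine hR t τ h1 ?_ ?_
    · rw [← h2, hz, Nat.gcd_zero_right]
    · simp at ht
      omega

end


/-! ### The two operations on the machine -/

section
variable {B M : ℕ} {σ : Store} {R : ℕ → Store → Prop}

theorem wp_exchange {n a b y x s : ℕ} [Fact n.Prime] {A0 : ZMod n → ℕ} (hra : σ.reg 13 = a)
    (hrb : σ.reg 14 = b) (hry : σ.reg 15 = y) (hrx : σ.reg 16 = x) (ha : a < n) (hb : b < n)
    (hab : a ≠ b) (he : y * a % n = x * b % n) (hx : 1 ≤ x) (hxy : x < y)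
    (hs : σ.mem 0 b = s) (hy : y ≤ σ.mem 0 a) (hxs : x ≤ s) (hA : ∀ i < n, σ.mem 0 i < n)
    (hsT : s ≤ σ.reg 4) (hT : σ.reg 4 ≤ n * n) (hK : σ.reg 1 + 2 ≤ M) (hM : n ^ 4 ≤ M)
    (htr : Transforms (σ.record n) A0 (σ.sumset n))
    (hR : ∀ t τ, t ≤ 150 → AgreeOff [1, 2, 4, 17, 18, 24] [0, 1, 2, 3, 4, 5, 6, 7] σ τ →
      τ.reg 1 = σ.reg 1 + 2 → τ.reg 2 = a → τ.reg 4 + s = σ.reg 4 + s / x * y →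
      τ.mem 0 = Function.update (Function.update (σ.mem 0) b 0) a (σ.mem 0 a + s / x * y) →
      Transforms (τ.record n) A0 (τ.sumset n) → R t τ) :
    WP B M exchange σ R := by
  have hn2 : 2 ≤ n := (Fact.out : n.Prime).two_le
  have hrs : s / x ≤ s := Nat.div_le_self _ _
  have hrx' : s / x * x ≤ s := Nat.div_mul_le_self _ _
  have hsn : s < n := hs ▸ hA b hb
  have hyn : y < n := hy.trans_lt (hA a ha)
  have hryn : s / x * y ≤ n * n := Nat.mul_le_mul (by omega) hyn.le
  have h4 : 4 * (n * n) ≤ n ^ 4 := by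
    have : 4 ≤ n * n := by nlinarith
    calc 4 * (n * n) ≤ n * n * (n * n) := Nat.mul_le_mul_right _ this
      _ = n ^ 4 := by ring
  have hnn : n ≤ n * n := Nat.le_mul_self n
  have hAa := hA a ha
  obtain ⟨hv1, hr1⟩ := exchange_spec (σ.mem 0) ha hb hab he hx hxy hy (hs ▸ hrx')
  rw [hs] at hv1 hr1
  have hbA := drop_spec (n := n) (Function.update (Function.update (σ.mem 0) b (s - s / x * x)) a
    (σ.mem 0 a + s / x * y)) hb
  rw [Function.update_of_ne hab.symm, Function.update_self] at hbA
  refine WP.block_cons (WP.assign (fun _ hS => hS.mem _ _) ?_)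
  refine WP.block_cons (WP.assign (fun _ hS => (Nat.div_le_self _ _).trans (hS.reg _)) ?_)
  refine WP.block_cons (wp_emit (by omega) (by simp; omega) ?_)
  intro τ g1 g2 g3
  have g3 := g3 n
  simp [hra, hrb, hry, hrx, hs] at g2 g3
  have c4 : τ.reg 4 = σ.reg 4 := by simpa using g1.1 4 (by simp)
  have c13 : τ.reg 13 = a := by simpa [hra] using g1.1 13 (by simp)
  have c14 : τ.reg 14 = b := by simpa [hrb] using g1.1 14 (by simp)
  have c15 : τ.reg 15 = y := by simpa [hry] using g1.1 15 (by simp)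
  have c16 : τ.reg 16 = x := by simpa [hrx] using g1.1 16 (by simp)
  have c17 : τ.reg 17 = s / x := by simpa [hrb, hrx, hs] using g1.1 17 (by simp)
  have c18 : τ.reg 18 = s := by simpa [hrb, hs] using g1.1 18 (by simp)
  have c0 : τ.mem 0 = σ.mem 0 := by simpa using g1.2 0 (by simp)
  refine WP.block_cons (WP.assign (fun _ _ => ?_) ?_)
  · simp [c4, c15, c17, c18]; omega
  refine WP.block_cons (WP.write (fun _ _ => ?_) ?_)
  · simp [c16, c17, c18]; omega
  refine WP.block_cons (WP.write (fun _ _ => ?_) ?_)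
  · simp [c13, c14, c15, c16, c17, c18, c0, Function.update_of_ne hab]; omega
  refine WP.block_cons (WP.assign (fun _ hS => hS.mem _ _) ?_)
  refine WP.block_cons (wp_emit (by omega) (by simp; omega) ?_)
  intro υ k1 k2 k3
  have k3 := k3 n
  simp [c4, c13, c14, c15, c16, c17, c18, c0, Function.update_of_ne hab,
    Function.update_of_ne hab.symm] at k2 k3
  have d4 : υ.reg 4 = σ.reg 4 + s / x * y - s := by
    simpa [c4, c15, c17, c18] using k1.1 4 (by simp)
  have d13 : υ.reg 13 = a := by simpa [c13] using k1.1 13 (by simp)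
  have d14 : υ.reg 14 = b := by simpa [c14] using k1.1 14 (by simp)
  have d0 : υ.mem 0 = Function.update (Function.update (σ.mem 0) b (s - s / x * x)) a
      (σ.mem 0 a + s / x * y) := by
    have := k1.2 0 (by simp)
    simpa [c13, c14, c15, c16, c17, c18, c0, Function.update_of_ne hab] using this
  refine WP.block_cons (WP.write (fun _ _ => Nat.zero_le _) ?_)
  refine WP.block_cons (WP.assign (fun _ hS => hS.reg _) ?_)
  have hfin : Function.update (Function.update (Function.update (σ.mem 0) b (s - s / x * x)) a
      (σ.mem 0 a + s / x * y)) b 0 =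
      Function.update (Function.update (σ.mem 0) b 0) a (σ.mem 0 a + s / x * y) := by
    rw [Function.update_comm hab, Function.update_idem]
  refine WP.block_nil (hR _ _ ?_ ?_ ?_ ?_ ?_ ?_ ?_)
  · simp
  · have f1 : AgreeOff [1, 2, 4, 17, 18, 24] [0, 1, 2, 3, 4, 5, 6, 7] σ τ :=
      AgreeOff.trans (((AgreeOff.refl _ _ _).setReg (by simp)).setReg (by simp))
        (g1.mono (by simp) (by simp))
    have f2 : AgreeOff [1, 2, 4, 17, 18, 24] [0, 1, 2, 3, 4, 5, 6, 7] σ υ :=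
      AgreeOff.trans ((((f1.setReg (by simp)).setMem (by simp)).setMem (by simp)).setReg (by simp))
        (k1.mono (by simp) (by simp))
    exact (f2.setMem (by simp)).setReg (by simp)
  · simp [k2, g2]
  · simp [d13]
  · simp [d4]; omega
  · simp [d0, d14, hfin]
  · rw [Store.record_congr (σ := υ) (by simp) (fun c _ _ => by
      simp [show c ≠ 0 by omega]), k3, Store.record_congr (σ := τ) (by simp) (fun c _ _ => by
      simp [show c ≠ 0 by omega]), g3]
    rw [Store.sumset_eq]
    simp only [Store.setReg_mem, Store.setMem_mem, eval_var, eval_const, d14, d0, if_true, hfin]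
    rw [← hfin, ← hbA.2, ← hr1]
    refine Transforms.snoc (Transforms.snoc ?_ hv1) ?_
    · rw [Store.record_congr (σ := σ) (by simp) (fun c _ _ => by simp)]
      exact htr
    · rw [hr1]
      exact hbA.1

/-- The array `inv` holds the inverses modulo `n`. -/
def InvTable (n : ℕ) (inv : ℕ → ℕ) : Prop := ∀ i, 0 < i → i < n → i * inv i % n = 1 ∧ inv i < n

theorem InvTable.mul_eq {n w a : ℕ} [Fact n.Prime] {inv : ℕ → ℕ} (h : InvTable n inv)
    (hw : 0 < w) (hwn : w < n) : ((a * inv w % n : ℕ) : ZMod n) * (w : ZMod n) = (a : ZMod n) := by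
  have h1 : ((w * inv w : ℕ) : ZMod n) = ((1 : ℕ) : ZMod n) := by
    rw [ZMod.natCast_eq_natCast_iff', (h w hw hwn).1,
      Nat.mod_eq_of_lt (Fact.out : n.Prime).one_lt]
  rw [ZMod.natCast_mod]
  push_cast at h1 ⊢
  rw [mul_assoc, mul_comm _ (w : ZMod n), h1, mul_one]

/-- Both variable costs, deleting the entries of a and the gcd with at most (y − x)/q turns, are
bounded by the number of entries of a. The gain hypothesis makes the subtractions in the update of
the total length exact. -/
theorem wp_fuse {n q h a b y x : ℕ} [Fact n.Prime] {A0 : ZMod n → ℕ} (hn : σ.reg 0 = n)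
    (hq : σ.reg 6 = q) (hq0 : 0 < q) (hra : σ.reg 13 = a)
    (hrb : σ.reg 14 = b) (hry : σ.reg 15 = y) (hrx : σ.reg 16 = x) (ha : a < n) (hb : b < n)
    (ha0 : a ≠ 0) (hb0 : b ≠ 0)
    (hab : a ≠ b) (he : y * a % n = x * b % n) (hx : 1 ≤ x) (hxy : x < y)
    (hy : y ≤ σ.mem 0 a) (hxs : x ≤ σ.mem 0 b) (hA : ∀ i < n, σ.mem 0 i < n)
    (hcop : Nat.Coprime y q) (hmod : y % q = x % q) (hδ : (y - x) / q ≤ σ.mem 9 a)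
    (H : TableInv n q h (σ.mem 0) (σ.mem 8) (σ.mem 10) (σ.mem 9)) (hinv : InvTable n (σ.mem 11))
    {L : ℕ} (hL : L = σ.mem 0 a * (x / y.gcd x) + σ.mem 0 b * (y / y.gcd x) -
      2 * ((y / y.gcd x - 1) * (x / y.gcd x - 1)))
    (hgain : σ.mem 0 a + σ.mem 0 b ≤ L)
    (hT : σ.reg 4 ≤ n * n) (hK : σ.reg 1 + 1 ≤ M) (hM : n ^ 4 ≤ M)
    (htr : Transforms (σ.record n) A0 (σ.sumset n))
    (hR : ∀ t τ z, t ≤ 80 * σ.mem 9 a + 250 →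
      AgreeOff [1, 2, 4, 17, 18, 19, 20, 21, 22, 23, 24, 25] [0, 1, 2, 3, 4, 5, 6, 7, 8, 9] σ τ →
      z < n → z ≠ 0 → τ.reg 1 = σ.reg 1 + 1 → τ.reg 2 = z →
      τ.reg 4 + σ.mem 0 a + σ.mem 0 b = σ.reg 4 + L →
      τ.mem 0 = Function.update (Function.update (Function.update (σ.mem 0) a 0) b 0) z
          (Function.update (Function.update (σ.mem 0) a 0) b 0 z + L) →
      τ.mem 9 = Function.update (σ.mem 9) a 0 →
      TableInv n q h (σ.mem 0) (τ.mem 8) (τ.mem 10) (τ.mem 9) →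
      Transforms (τ.record n) A0 (τ.sumset n) → R t τ) :
    WP B M fuse σ R := by
  have hprime : n.Prime := Fact.out
  have hn2 : 2 ≤ n := hprime.two_le
  have h4 : 4 * (n * n) ≤ n ^ 4 := by
    have : 4 ≤ n * n := by nlinarith
    calc 4 * (n * n) ≤ n * n * (n * n) := Nat.mul_le_mul_right _ this
      _ = n ^ 4 := by ring
  have hnn : n ≤ n * n := Nat.le_mul_self n
  have hAa := hA a ha
  have hAb := hA b hb
  have hg : 0 < y.gcd x := Nat.gcd_pos_of_pos_right _ (by omega)
  have hgy : y.gcd x ∣ y := Nat.gcd_dvd_left _ _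
  have hgx : y.gcd x ∣ x := Nat.gcd_dvd_right _ _
  have hgn : y.gcd x < n := (Nat.le_of_dvd (by omega) hgx).trans_lt (by omega)
  have hcvw : Nat.Coprime (y / y.gcd x) (x / y.gcd x) := Nat.coprime_div_gcd_div_gcd hg
  have hvy : y / y.gcd x ≤ y := Nat.div_le_self _ _
  have hwx : x / y.gcd x ≤ x := Nat.div_le_self _ _
  have hw1 : 1 ≤ x / y.gcd x := Nat.div_pos (Nat.le_of_dvd hx hgx) hg
  have hv1 : 1 ≤ y / y.gcd x := Nat.div_pos (Nat.le_of_dvd (by omega) hgy) hg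
  have hevw : y / y.gcd x * a % n = x / y.gcd x * b % n := by
    rw [← zmod_mul_eq_iff] at he ⊢
    -- The gcd is at most x < n, hence a unit modulo n and can be cancelled.
    refine mul_left_cancel₀ (natCast_ne_zero_of_lt (by omega) hgn) ?_
    have h1 : (y.gcd x : ZMod n) * ((y / y.gcd x : ℕ) : ZMod n) = y := by
      rw [← Nat.cast_mul, Nat.mul_div_cancel' hgy]
    have h2 : (y.gcd x : ZMod n) * ((x / y.gcd x : ℕ) : ZMod n) = x := by
      rw [← Nat.cast_mul, Nat.mul_div_cancel' hgx]
    rw [← mul_assoc, ← mul_assoc, h1, h2]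
    exact he
  have hgd := gcd_eq_gcd_sub_div hxy.le hcop hmod
  set g := y.gcd x with hgdef
  set v := y / g with hvdef
  set w := x / g with hwdef
  have hwn : w < n := by omega
  set z := a * σ.mem 11 w % n with hzdef
  have hzn : z < n := Nat.mod_lt _ hprime.pos
  have hzw : (z : ZMod n) * (w : ZMod n) = (a : ZMod n) := hinv.mul_eq (by omega) hwn
  have hz0 : z ≠ 0 := fun h0 => natCast_ne_zero_of_lt ha0 ha (by rw [← hzw, h0]; simp)
  obtain ⟨hv, hr⟩ := fuse_spec (σ.mem 0) ha hb hzn ha0 hb0 hab hevw hv1 (by omega) hw1 hwn hcvw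
    (by omega) (by omega) hzw
  have hLn : L ≤ 2 * (n * n) := by
    have h1 : σ.mem 0 a * w ≤ n * n := Nat.mul_le_mul hAa.le (by omega)
    have h2 : σ.mem 0 b * v ≤ n * n := Nat.mul_le_mul hAb.le (by omega)
    omega
  refine WP.block_cons (wp_unregister (by omega) hra ha hn hq hq0 H ?_)
  intro t1 τ g1 g2 g3 g4
  have c1 : τ.reg 1 = σ.reg 1 := g1.1 1 (by simp)
  have c4 : τ.reg 4 = σ.reg 4 := g1.1 4 (by simp)
  have c6 : τ.reg 6 = q := by simpa [hq] using g1.1 6 (by simp)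
  have c13 : τ.reg 13 = a := by simpa [hra] using g1.1 13 (by simp)
  have c14 : τ.reg 14 = b := by simpa [hrb] using g1.1 14 (by simp)
  have c15 : τ.reg 15 = y := by simpa [hry] using g1.1 15 (by simp)
  have c16 : τ.reg 16 = x := by simpa [hrx] using g1.1 16 (by simp)
  have c0 : τ.mem 0 = σ.mem 0 := g1.2 0 (by simp)
  refine WP.block_cons (WP.assign (fun _ hS => hS.reg _) ?_)
  refine WP.block_cons (WP.assign (fun _ hS =>
    (Nat.div_le_self _ _).trans ((Nat.sub_le _ _).trans (hS.reg _))) ?_)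
  refine WP.block_cons (wp_euclid ?_)
  intro t2 υ k1 k2 k3
  simp [c15, c16, c6, hgd] at k2 k3
  have d0' : υ.reg 0 = n := by simpa [g1.1 0 (by simp), hn] using k1.1 0 (by simp)
  have d1 : υ.reg 1 = σ.reg 1 := by simpa [c1] using k1.1 1 (by simp)
  have d4 : υ.reg 4 = σ.reg 4 := by simpa [c4] using k1.1 4 (by simp)
  have d13 : υ.reg 13 = a := by simpa [c13] using k1.1 13 (by simp)
  have d14 : υ.reg 14 = b := by simpa [c14] using k1.1 14 (by simp)
  have d15 : υ.reg 15 = y := by simpa [c15] using k1.1 15 (by simp)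
  have d16 : υ.reg 16 = x := by simpa [c16] using k1.1 16 (by simp)
  have d0 : υ.mem 0 = σ.mem 0 := by simpa [c0] using k1.2 0 (by simp)
  have f1 : AgreeOff [1, 2, 4, 17, 18, 19, 20, 21, 22, 23, 24, 25]
      [0, 1, 2, 3, 4, 5, 6, 7, 8, 9] σ υ :=
    AgreeOff.trans (((g1.mono (by simp) (by simp)).setReg (by simp)).setReg (by simp))
      (k1.mono (by simp) (by simp))
  have d11 : υ.mem 11 = σ.mem 11 := f1.2 11 (by simp)
  have d8 : υ.mem 8 = τ.mem 8 := by simpa using k1.2 8 (by simp)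
  have d9 : υ.mem 9 = τ.mem 9 := by simpa using k1.2 9 (by simp)
  have d10 : υ.mem 10 = τ.mem 10 := by simpa using k1.2 10 (by simp)
  have drec : υ.record n = σ.record n := by
    rw [k1.record (by simp) (by simp), ← g1.record (by simp) (by simp)]
    exact Store.record_congr (by simp) (fun c _ _ => by simp)
  refine WP.block_cons (WP.assign (fun _ hS => (Nat.div_le_self _ _).trans (hS.reg _)) ?_)
  refine WP.block_cons (WP.assign (fun _ hS => (Nat.div_le_self _ _).trans (hS.reg _)) ?_)
  refine WP.block_cons (WP.assign (fun _ hS => hS.mem _ _) ?_)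
  refine WP.block_cons (WP.assign (fun _ hS => hS.mem _ _) ?_)
  refine WP.block_cons (wp_emit (by omega) (by simp; omega) ?_)
  intro ω l1 l2 l3
  have l3 := l3 n
  simp [d1, d13, d14, d15, d16, d0, k2] at l2 l3
  have e0' : ω.reg 0 = n := by simpa [d0'] using l1.1 0 (by simp)
  have e4 : ω.reg 4 = σ.reg 4 := by simpa [d4] using l1.1 4 (by simp)
  have e13 : ω.reg 13 = a := by simpa [d13] using l1.1 13 (by simp)
  have e14 : ω.reg 14 = b := by simpa [d14] using l1.1 14 (by simp)
  have e18 : ω.reg 18 = σ.mem 0 b := by simpa [d14, d0] using l1.1 18 (by simp)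
  have e19 : ω.reg 19 = σ.mem 0 a := by simpa [d13, d0] using l1.1 19 (by simp)
  have e20 : ω.reg 20 = v := by simpa [d15, k2] using l1.1 20 (by simp)
  have e21 : ω.reg 21 = w := by simpa [d16, k2] using l1.1 21 (by simp)
  have e0 : ω.mem 0 = σ.mem 0 := by simpa [d0] using l1.2 0 (by simp)
  have e11 : ω.mem 11 = σ.mem 11 := by simpa [d11] using l1.2 11 (by simp)
  have e8 : ω.mem 8 = τ.mem 8 := by simpa [d8] using l1.2 8 (by simp)
  have e9 : ω.mem 9 = τ.mem 9 := by simpa [d9] using l1.2 9 (by simp)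
  have e10 : ω.mem 10 = τ.mem 10 := by simpa [d10] using l1.2 10 (by simp)
  have f2 : AgreeOff [1, 2, 4, 17, 18, 19, 20, 21, 22, 23, 24, 25]
      [0, 1, 2, 3, 4, 5, 6, 7, 8, 9] σ ω :=
    AgreeOff.trans ((((f1.setReg (by simp)).setReg (by simp)).setReg (by simp)).setReg (by simp))
      (l1.mono (by simp) (by simp))
  refine WP.block_cons (WP.assign (fun _ _ => ?_) ?_)
  · simp [e0', e13, e21, e11]; omega
  refine WP.block_cons (WP.assign (fun _ _ => ?_) ?_)
  · simp [e18, e19, e20, e21]; omega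
  refine WP.block_cons (WP.assign (fun _ _ => ?_) ?_)
  · simp [e4, e18, e19, e20, e21]; omega
  refine WP.block_cons (WP.write (fun _ _ => Nat.zero_le _) ?_)
  refine WP.block_cons (WP.write (fun _ _ => Nat.zero_le _) ?_)
  have hzle : Function.update (Function.update (σ.mem 0) a 0) b 0 z ≤ n := by
    have := hA z hzn
    rw [Function.update_apply, Function.update_apply]
    split_ifs <;> omega
  refine WP.block_cons (WP.write (fun _ _ => ?_) ?_)
  · simp [e0', e0, e11, e13, e14, e18, e19, e20, e21, ← hzdef, ← hL]; omega
  refine WP.block_cons (WP.assign (fun _ hS => hS.reg _) ?_)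
  refine WP.block_nil (hR _ _ z ?_ ?_ hzn hz0 ?_ ?_ ?_ ?_ ?_ ?_ ?_)
  · simp; omega
  · exact ((((((f2.setReg (by simp)).setReg (by simp)).setReg (by simp)).setMem (by simp)).setMem
      (by simp)).setMem (by simp)).setReg (by simp)
  · simp [l2]
  · simp [e0', e13, e21, e11, ← hzdef]
  · simp [e4, e18, e19, e20, e21, ← hL]; omega
  · simp [e0', e0, e11, e13, e14, e18, e19, e20, e21, ← hzdef, ← hL]
  · simp [e9, g3]
  · simpa [e8, e9, e10] using g2
  · rw [Store.record_congr (σ := ω) (by simp) (fun c _ _ => by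
      simp [show c ≠ 0 by omega]), l3, Store.record_congr (σ := υ) (by simp) (fun c _ _ => by
      simp), drec]
    rw [Store.sumset_eq]
    have := Transforms.snoc htr hv
    rw [Store.sumset_eq, hr, ← hL] at this
    simpa [e0', e0, e11, e13, e14, e18, e19, e20, e21, ← hzdef, ← hL, opOf, ← hvdef, ← hwdef] using this

end
-- One operation and its amortized cost
/-- Make the operation on the progressions with differences `a` and `b`, where `y a = x b`. -/
def operate : Prog := block [
  unregister reg_b,
  cond (Expr.eq (var reg_x) (const 1) + Expr.lt (var regE * var reg_x) (var reg_y + const 1))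
    exchange fuse]

/-- What an operation does to the stores `σ` (before) and `τ` (after) in the time `t`. -/
structure Step (n q h κ : ℕ) (A0 : ZMod n → ℕ) (σ τ : Store) (t : ℕ) : Prop where
  agree : AgreeOff [1, 2, 4, 17, 18, 19, 20, 21, 22, 23, 24, 25] [0, 1, 2, 3, 4, 5, 6, 7, 8, 9] σ τ
  count_lt : σ.reg 1 < τ.reg 1
  count_le : τ.reg 1 ≤ σ.reg 1 + 2
  cur_lt : τ.reg 2 < n
  total : τ.reg 4 = ∑ i ∈ Finset.range n, τ.mem 0 i
  total_lt : σ.reg 4 < τ.reg 4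
  numAP : numAP n (τ.mem 0) + 1 ≤ numAP n (σ.mem 0)
  table : TableInv n q h (τ.mem 0) (τ.mem 8) (τ.mem 10) (τ.mem 9)
  -- Apart from the new current progression, what was completely registered stays so or vanishes.
  rest : ∀ i < n, i ≠ τ.reg 2 → τ.mem 0 i = 0 ∨ τ.mem 0 i = σ.mem 0 i ∧ τ.mem 9 i = σ.mem 9 i
  gone : ∀ i, i = σ.reg 13 ∨ i = σ.reg 14 → i ≠ τ.reg 2 → τ.mem 0 i = 0
  zero : τ.mem 0 0 = 0
  le : ∀ i < n, τ.mem 0 i ≤ 4 * (n * n)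
  -- Here u is the number of deleted entries: the gain in total length pays for it up to a constant
  -- per operation.
  time : ∃ u, ∑ i ∈ Finset.range n, τ.mem 9 i + u = ∑ i ∈ Finset.range n, σ.mem 9 i ∧
    t ≤ 80 * u + 400 ∧ κ * q * u + 4 * σ.reg 4 ≤ 4 * τ.reg 4 + 2 * (κ * q)
  trans : Transforms (τ.record n) A0 (τ.sumset n)

section
variable {B M : ℕ} {σ : Store} {R : ℕ → Store → Prop}

theorem sum_le_sq {n : ℕ} {A : ℕ → ℕ} (hA : ∀ i < n, A i < n) :
    ∑ i ∈ Finset.range n, A i ≤ n * n := by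
  calc ∑ i ∈ Finset.range n, A i ≤ ∑ i ∈ Finset.range n, n :=
        Finset.sum_le_sum fun i hi => (hA i (Finset.mem_range.mp hi)).le
    _ = n * n := by simp

theorem add_le_sum {n : ℕ} {A : ℕ → ℕ} {a b : ℕ} (ha : a < n) (hb : b < n) (hab : a ≠ b) :
    A a + A b ≤ ∑ i ∈ Finset.range n, A i := by
  rw [← Finset.sum_pair hab]
  exact Finset.sum_le_sum_of_subset (by
    intro i; simp only [Finset.mem_insert, Finset.mem_singleton, Finset.mem_range]; omega)

-- Entries number at most length/q + 1, so κq times the deleted ones is at most κ times the consumed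
-- length plus 2κq, and the gain is at least κ/4 of the consumed length. In an exchange a keeps its
-- entries, since it only becomes longer; in a fusion both sets are deleted.
set_option maxHeartbeats 2000000 in
theorem wp_operate {n q h E κ a b y x ky kx : ℕ} [Fact n.Prime] {A0 : ZMod n → ℕ}
    (hP : Params q h E κ) (hn : σ.reg 0 = n) (hq : σ.reg 6 = q) (hE : σ.reg 8 = E)
    (hra : σ.reg 13 = a) (hrb : σ.reg 14 = b) (hry : σ.reg 15 = y) (hrx : σ.reg 16 = x)
    (ha : a < n) (hb : b < n) (hab : a ≠ b) (he : y * a % n = x * b % n)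
    (hky : y = ky * q + 1) (hkx : x = kx * q + 1) (hk : kx < ky) (hkc : ky ≤ σ.mem 9 a)
    (hhy : h * y < σ.mem 0 a + h) (hhx : h * x < σ.mem 0 b + h)
    (hA : ∀ i < n, σ.mem 0 i < n) (hA0 : σ.mem 0 0 = 0)
    (hcop : q = 1 → Nat.Coprime y x)
    (H : TableInv n q h (σ.mem 0) (σ.mem 8) (σ.mem 10) (σ.mem 9)) (hinv : InvTable n (σ.mem 11))
    (hT : σ.reg 4 = ∑ i ∈ Finset.range n, σ.mem 0 i) (hK : σ.reg 1 + 2 ≤ M) (hM : n ^ 4 ≤ M)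
    (htr : Transforms (σ.record n) A0 (σ.sumset n))
    (hR : ∀ t τ, Step n q h κ A0 σ τ t → R t τ) :
    WP B M operate σ R := by
  have hq0 := hP.q_pos
  have hx1 : 1 ≤ x := by omega
  have hxyq : x + q ≤ y := by
    have := Nat.mul_le_mul_right q (show kx + 1 ≤ ky from hk)
    rw [add_mul] at this
    omega
  have hya := TableInv.coeff_le hP.h_pos hhy (by omega)
  have hxb := TableInv.coeff_le hP.h_pos hhx (by omega)
  have ha0 : a ≠ 0 := by rintro rfl; omega
  have hb0 : b ≠ 0 := by rintro rfl; omega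
  have hycop : Nat.Coprime y q := by rw [hky]; simp
  have hmod : y % q = x % q := by
    rw [hky, hkx, Nat.mul_add_mod_self_right, Nat.mul_add_mod_self_right]
  have hTn : σ.reg 4 ≤ n * n := hT ▸ sum_le_sq hA
  have hAab := add_le_sum (A := σ.mem 0) ha hb hab
  rw [← hT] at hAab
  have hsa := H.kc_mul_le hP.h_pos ha
  have hsb := H.kc_mul_le hP.h_pos hb
  have hκ := hP.κ_pos
  refine WP.block_cons (wp_unregister (by omega) hrb hb hn hq hq0 H ?_)
  intro t1 τ g1 g2 g3 g4
  have c0' : τ.reg 0 = n := by simpa [hn] using g1.1 0 (by simp)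
  have c1 : τ.reg 1 = σ.reg 1 := g1.1 1 (by simp)
  have c4 : τ.reg 4 = σ.reg 4 := g1.1 4 (by simp)
  have c6 : τ.reg 6 = q := by simpa [hq] using g1.1 6 (by simp)
  have c8 : τ.reg 8 = E := by simpa [hE] using g1.1 8 (by simp)
  have c13 : τ.reg 13 = a := by simpa [hra] using g1.1 13 (by simp)
  have c14 : τ.reg 14 = b := by simpa [hrb] using g1.1 14 (by simp)
  have c15 : τ.reg 15 = y := by simpa [hry] using g1.1 15 (by simp)
  have c16 : τ.reg 16 = x := by simpa [hrx] using g1.1 16 (by simp)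
  have c0 : τ.mem 0 = σ.mem 0 := g1.2 0 (by simp)
  have c11 : τ.mem 11 = σ.mem 11 := g1.2 11 (by simp)
  have crec : τ.record n = σ.record n := g1.record (by simp) (by simp)
  have hkcb := sum_update (σ.mem 9) hb 0
  have htr' : Transforms (τ.record n) A0 (τ.sumset n) := by
    rw [crec, Store.sumset_eq, c0]; exact htr
  refine WP.block_cons (WP.cond (fun htest => ?_) (fun htest => ?_))
  · have hc : x = 1 ∨ E * x ≤ y := by
      by_contra hcon
      rw [not_or] at hcon
      apply htest
      simp [c8, c15, c16, hcon.1]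
      omega
    have hgain := exchange_gain (κ := κ) hx1 hxb hxyq hP.E_ge hP.κ_le_E hP.κ_le_q hc
    obtain ⟨hsum, hnum⟩ := exchange_count (σ.mem 0) ha hb hab (by omega) (by omega)
      (σ.mem 0 b / x * y)
    refine wp_exchange (n := n) (s := σ.mem 0 b) c13 c14 c15 c16 ha hb hab he hx1 (by omega)
      (by rw [c0]) (by rw [c0]; exact hya) hxb (by rw [c0]; exact hA) (by omega) (by omega)
      (by omega) hM htr' ?_
    intro t τ' ht k1 k2 k3 k4 k5 k6
    refine WP.block_nil (hR _ _ ?_)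
    rw [c0] at k5
    have k9 : τ'.mem 9 = Function.update (σ.mem 9) b 0 := by rw [k1.2 9 (by simp), g3]
    have hlarge : 4 ≤ n * n := by nlinarith [(Fact.out : n.Prime).two_le]
    have hpos : 0 < κ * σ.mem 0 b := by
      have : 0 < σ.mem 0 b := by omega
      positivity
    refine ⟨(g1.mono (by simp) (by simp)).trans (k1.mono (by simp) (by simp)), by omega, by omega,
      by omega, ?_, by omega, ?_, ?_, ?_, ?_, ?_, ?_, ⟨σ.mem 9 b, ?_, ?_, ?_⟩, k6⟩
    · rw [k5]; omega
    · rw [k5]; omega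
    · rw [k5, k1.2 8 (by simp), k1.2 9 (by simp), k1.2 10 (by simp)]
      refine g2.congr_A fun i hi hne => ?_
      rw [g3] at hne
      have hib : i ≠ b := by rintro rfl; simp at hne
      rcases eq_or_ne i a with rfl | hia
      · rw [Function.update_self]; omega
      · rw [Function.update_of_ne hia, Function.update_of_ne hib]
    · intro i hi hne
      rw [k3] at hne
      rw [k5, k9, Function.update_of_ne hne]
      rcases eq_or_ne i b with rfl | hib
      · left; simp
      · right; simp [hib]
    · intro i hi hne
      rw [k3] at hne
      rw [hra, hrb] at hi
      rw [k5, hi.resolve_left hne, Function.update_of_ne hab.symm, Function.update_self]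
    · rw [k5, Function.update_of_ne (Ne.symm ha0), Function.update_of_ne (Ne.symm hb0), hA0]
    · intro i hi
      have hi' := hA i hi
      have := hA a ha
      have hnn : n ≤ n * n := Nat.le_mul_self n
      have hyn : σ.mem 0 b / x * y ≤ n * n :=
        Nat.mul_le_mul ((Nat.div_le_self _ _).trans (hA b hb).le) (by omega)
      rw [k5, Function.update_apply, Function.update_apply]
      split_ifs <;> omega
    · rw [k9]; omega
    · simp; omega
    · have : κ * (q * σ.mem 9 b) ≤ κ * (σ.mem 0 b + q) := Nat.mul_le_mul_left κ hsb
      rw [mul_add] at this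
      rw [mul_assoc]
      omega
  · have hc : x ≠ 1 ∧ y < E * x := by
      constructor
      · rintro rfl; simp [c16] at htest
      · by_contra hcon
        simp [c8, c15, c16] at htest
        omega
    have hgain := hP.fuse (σ.mem 0 a) (σ.mem 0 b) y x (by omega) hxyq hc.2 hycop hmod hhy hhx hcop
    -- This charges Euclid's algorithm to the entries of a: (y − x)/q is at most ky.
    have hδ : (y - x) / q ≤ σ.mem 9 a := by
      rw [Nat.div_le_iff_le_mul_add_pred hq0]
      have : q * ky ≤ q * σ.mem 9 a := Nat.mul_le_mul_left q hkc
      rw [mul_comm q ky] at this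
      omega
    have hd9 : τ.mem 9 a = σ.mem 9 a := by rw [g3, Function.update_of_ne hab]
    have hpos : 0 < κ * (σ.mem 0 a + σ.mem 0 b) := by
      have : 0 < σ.mem 0 b := by omega
      positivity
    obtain ⟨L, hL⟩ : ∃ L, L = σ.mem 0 a * (x / y.gcd x) + σ.mem 0 b * (y / y.gcd x) -
      2 * ((y / y.gcd x - 1) * (x / y.gcd x - 1)) := ⟨_, rfl⟩
    have hgain' : κ * (σ.mem 0 a + σ.mem 0 b) + 4 * (σ.mem 0 a + σ.mem 0 b) ≤ 4 * L := by omega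
    refine wp_fuse (n := n) (h := h) (q := q) (L := L) c0' c6 hq0 c13 c14 c15 c16 ha hb ha0 hb0 hab
      he hx1 (by omega) (by rw [c0]; exact hya) (by rw [c0]; exact hxb) (by rw [c0]; exact hA)
      hycop hmod (by rw [hd9]; exact hδ) (by rw [c0]; exact g2) (by rw [c11]; exact hinv)
      (by rw [c0]; exact hL) (by rw [c0]; omega) (by omega) (by omega) hM htr' ?_
    intro t τ' z ht k1 hz hz0 k2 k3 k4 k5 k6 k7 k8
    refine WP.block_nil (hR _ _ ?_)
    rw [c0] at k4 k5 k7
    rw [g3] at k6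
    rw [hd9] at ht
    obtain ⟨hsum, hnum⟩ := fuse_count (σ.mem 0) ha hb hz hab (by omega) (by omega) L
    have hkca := sum_update (Function.update (σ.mem 9) b 0) ha 0
    rw [Function.update_of_ne hab] at hkca
    have hnn : n ≤ n * n := Nat.le_mul_self n
    have hLn : L ≤ 2 * (n * n) := by
      have h1 : σ.mem 0 a * (x / y.gcd x) ≤ n * n :=
        Nat.mul_le_mul (hA a ha).le ((Nat.div_le_self _ _).trans (by have := hA b hb; omega))
      have h2 : σ.mem 0 b * (y / y.gcd x) ≤ n * n :=
        Nat.mul_le_mul (hA b hb).le ((Nat.div_le_self _ _).trans (by have := hA a ha; omega))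
      omega
    refine ⟨(g1.mono (by simp) (by simp)).trans k1, by omega, by omega,
      by omega, ?_, by omega, ?_, ?_, ?_, ?_, ?_, ?_, ⟨σ.mem 9 a + σ.mem 9 b, ?_, ?_, ?_⟩, k8⟩
    · rw [k5]; omega
    · rw [k5]; omega
    · rw [k5]
      refine k7.congr_A fun i hi hne => ?_
      rw [k6] at hne
      have hia : i ≠ a := by rintro rfl; simp at hne
      have hib : i ≠ b := by rintro rfl; simp [hia] at hne
      rcases eq_or_ne i z with rfl | hiz
      · simp [hia, hib]
      · simp [hia, hib, hiz]
    · intro i hi hne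
      rw [k3] at hne
      rw [k5, k6, Function.update_of_ne hne]
      rcases eq_or_ne i b with rfl | hib
      · left; simp
      · rcases eq_or_ne i a with rfl | hia
        · left; simp [hib]
        · right; simp [hib, hia]
    · intro i hi hne
      rw [k3] at hne
      rw [hra, hrb] at hi
      rw [k5, Function.update_of_ne hne]
      rcases hi with rfl | rfl
      · rw [Function.update_of_ne hab, Function.update_self]
      · rw [Function.update_self]
    · rw [k5, Function.update_of_ne hz0.symm, Function.update_of_ne hb0.symm,
        Function.update_of_ne ha0.symm, hA0]
    · intro i hi
      have hi' := hA i hi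
      have hz' := hA z hz
      have hzz : Function.update (Function.update (σ.mem 0) a 0) b 0 z ≤ n := by
        rw [Function.update_apply, Function.update_apply]
        split_ifs <;> omega
      rw [k5, Function.update_apply]
      split_ifs
      · omega
      · rw [Function.update_apply, Function.update_apply]
        split_ifs <;> omega
    · rw [k6]; omega
    · simp; omega
    · have : κ * (q * σ.mem 9 a + q * σ.mem 9 b) ≤ κ * (σ.mem 0 a + σ.mem 0 b + 2 * q) :=
        Nat.mul_le_mul_left κ (by omega)
      rw [mul_add, mul_add] at this
      have e1 : κ * q * (σ.mem 9 a + σ.mem 9 b) = κ * (q * σ.mem 9 a) + κ * (q * σ.mem 9 b) := by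
        ring
      have e2 : κ * (2 * q) = 2 * (κ * q) := by ring
      omega

end
-- A phase and its invariant
/-- Deal with the collision between the multiple `regC` of `regCur` and a multiple of `regJ`. -/
def collide : Prog := block [
  cond (Expr.lt (cell arrD (var regX)) (var regC))
    (block [assign reg_a (var regCur), assign reg_b (var regJ), assign reg_y (var regC),
      assign reg_x (cell arrD (var regX))])
    (block [assign reg_a (var regJ), assign reg_b (var regCur),
      assign reg_y (cell arrD (var regX)), assign reg_x (var regC)]),
  operate,
  cond (Expr.lt (cell arrA (var regCur)) (var regN)) skip (assign regF (const 1))]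

/-- Treat the next multiple of the current progression. -/
def advance : Prog := block [
  assign regC (cell arrKc (var regCur) * var regQ + const 1),
  cond (Expr.lt (cell arrA (var regCur) + var regH) (var regH * var regC + const 1))
    (block [assign regCur (var regP), assign regP (var regP + const 1)])
    (block [
      assign regX (var regC * var regCur % var regN),
      assign regJ (cell arrTbl (var regX)),
      cond (var regJ) collide (block [
        write arrTbl (var regX) (var regCur),
        write arrD (var regX) (var regC),
        write arrKc (var regCur) (cell arrKc (var regCur) + const 1)])])]

/-- The test for the continuation of a phase. -/
def phaseTest : Expr :=
  Expr.lt (var regCur) (var regN) * Expr.lt (var regT) (var regG) * Expr.eq (var regF) (const 0)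

/-- A phase: operations are made until the total length is at least `regG` or one progression has
length at least `n`. -/
def phase : Prog := block [
  assign reg_i (const 0),
  loop (Expr.lt (var reg_i) (var regN)) (block [
    write arrTbl (var reg_i) (const 0),
    write arrKc (var reg_i) (const 0),
    assign reg_i (var reg_i + const 1)]),
  assign regCur (const 0),
  assign regP (const 1),
  loop phaseTest advance]

/-- The invariant of a phase that is started in the store `σ₀`. -/
structure PhaseInv (n q h T₀ : ℕ) (A0 : ZMod n → ℕ) (σ₀ σ : Store) : Prop where
  agree : AgreeOff [1, 2, 3, 4, 5, 10, 11, 12, 13, 14, 15, 16, 17, 18, 19, 20, 21, 22, 23, 24, 25,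
    30] [0, 1, 2, 3, 4, 5, 6, 7, 8, 9, 10] σ₀ σ
  -- As long as the phase goes on all coefficients are below n, hence invertible. An operation can
  -- create only one longer progression, which ends the phase.
  short : σ.reg 5 = 0 → ∀ i < n, σ.mem 0 i < n
  long : σ.reg 5 ≠ 0 → ∃ i < n, n ≤ σ.mem 0 i
  le : ∀ i < n, σ.mem 0 i ≤ 4 * (n * n)
  zero : σ.mem 0 0 = 0
  total : σ.reg 4 = ∑ i ∈ Finset.range n, σ.mem 0 i
  total_ge : T₀ ≤ σ.reg 4
  count_ge : σ₀.reg 1 ≤ σ.reg 1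
  table : TableInv n q h (σ.mem 0) (σ.mem 8) (σ.mem 10) (σ.mem 9)
  -- Below the pointer only the current progression may be incompletely registered.
  scan : ∀ i < n, i < σ.reg 3 → i ≠ σ.reg 2 → σ.mem 0 i + h ≤ h * (σ.mem 9 i * q + 1)
  ptr_le : σ.reg 3 ≤ n + 2
  ptr_le' : σ.reg 2 < n → σ.reg 3 ≤ n + 1
  ptr_lt : n ≤ σ.reg 2 → n < σ.reg 3
  -- At most two operations are recorded for each progression that disappears; so the record has
  -- length at most 2n.
  count : σ.reg 1 + 2 * numAP n (σ.mem 0) ≤ 2 * n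
  trans : Transforms (σ.record n) A0 (σ.sumset n)
  -- The first collision that is met occurs in the unchanged input, so an empty record tells the two
  -- outcomes apart.
  hist : σ.reg 1 = 0 ∧ σ.sumset n = A0 ∨ 0 < σ.reg 1 ∧ HasCollision A0 ∧ n ≤ σ.reg 4

section
variable {B M : ℕ} {σ : Store} {R : ℕ → Store → Prop}

theorem PhaseInv.congr {n q h T₀ : ℕ} {A0 : ZMod n → ℕ} {σ₀ σ τ : Store}
    (I : PhaseInv n q h T₀ A0 σ₀ σ)
    (ha : AgreeOff [10, 11, 12, 13, 14, 15, 16] [] σ τ) :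
    PhaseInv n q h T₀ A0 σ₀ τ := by
  have e1 := ha.1 1 (by simp)
  have e2 := ha.1 2 (by simp)
  have e3 := ha.1 3 (by simp)
  have e4 := ha.1 4 (by simp)
  have e5 := ha.1 5 (by simp)
  have m0 := ha.2 0 (by simp)
  have m8 := ha.2 8 (by simp)
  have m9 := ha.2 9 (by simp)
  have m10 := ha.2 10 (by simp)
  have er : τ.record n = σ.record n := ha.record (by simp) (by simp)
  refine ⟨I.agree.trans (ha.mono (by simp) (by simp)), ?_, ?_, ?_, ?_, ?_, ?_, ?_, ?_, ?_, ?_, ?_, ?_,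
    ?_, ?_, ?_⟩
  · rw [e5, m0]; exact I.short
  · rw [e5, m0]; exact I.long
  · rw [m0]; exact I.le
  · rw [m0]; exact I.zero
  · rw [m0, e4]; exact I.total
  · rw [e4]; exact I.total_ge
  · rw [e1]; exact I.count_ge
  · rw [m0, m8, m9, m10]; exact I.table
  · rw [m0, m9, e2, e3]; exact I.scan
  · rw [e3]; exact I.ptr_le
  · rw [e2, e3]; exact I.ptr_le'
  · rw [e2, e3]; exact I.ptr_lt
  · rw [e1, m0]; exact I.count
  · rw [er, Store.sumset_eq, m0]; exact I.trans
  · rw [e1, e4, Store.sumset_eq, m0]; exact I.hist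

/-- An operation keeps the invariant, apart from the register `regF`. -/
theorem PhaseInv.step {n q h κ T₀ t f : ℕ} [Fact n.Prime] {A0 : ZMod n → ℕ} {σ₀ σ τ : Store}
    (I : PhaseInv n q h T₀ A0 σ₀ σ) (hF : σ.reg 5 = 0) (hcur : σ.reg 2 < n)
    (hT₀ : n ≤ T₀ + 1)
    (S : Step n q h κ A0 σ τ t) (hcol : σ.sumset n = A0 → HasCollision A0)
    (hcur' : ∀ i < n, i < σ.reg 3 → i = σ.reg 2 → i ≠ τ.reg 2 → τ.mem 0 i = 0)
    (hf : f = if τ.mem 0 (τ.reg 2) < n then 0 else 1) :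
    PhaseInv n q h T₀ A0 σ₀ (τ.setReg 5 f) := by
  have e3 : τ.reg 3 = σ.reg 3 := S.agree.1 3 (by simp)
  have hn0 : 0 < n := (Fact.out : n.Prime).pos
  refine ⟨?_, ?_, ?_, ?_, ?_, ?_, ?_, ?_, ?_, ?_, ?_, ?_, ?_, ?_, ?_, ?_⟩
  · exact (I.agree.trans (S.agree.mono (by simp) (by simp))).setReg (by simp)
  · intro h0 i hi
    simp only [Store.setReg_reg, if_true] at h0
    rcases eq_or_ne i (τ.reg 2) with rfl | hne
    · by_contra hcon
      rw [Store.setReg_mem] at hcon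
      rw [if_neg hcon] at hf
      omega
    · have := I.short hF i hi
      simp only [Store.setReg_mem]
      rcases S.rest i hi hne with h1 | h1 <;> omega
  · intro h0
    simp only [Store.setReg_reg, if_true] at h0
    refine ⟨τ.reg 2, S.cur_lt, ?_⟩
    by_contra hcon
    rw [Store.setReg_mem] at hcon
    rw [if_pos (not_le.mp hcon)] at hf
    exact h0 hf
  · exact S.le
  · exact S.zero
  · simpa using S.total
  · have := I.total_ge
    have := S.total_lt
    simp; omega
  · have := I.count_ge
    have := S.count_lt
    simp; omega
  · exact S.table
  · intro i hi h1 h2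
    simp only [Store.setReg_reg, Store.setReg_mem] at h1 h2 ⊢
    simp only [Nat.reduceEqDiff, if_false] at h1 h2
    rw [e3] at h1
    have hz : τ.mem 0 i = 0 → τ.mem 0 i + h ≤ h * (τ.mem 9 i * q + 1) := by
      intro hz
      rw [hz, Nat.zero_add]
      exact Nat.le_mul_of_pos_right h (by omega)
    -- Absent progressions count as complete. The old current progression, possibly incomplete, is
    -- absent unless it is still the current one.
    rcases S.rest i hi h2 with h3 | ⟨h3, h4⟩
    · exact hz h3
    · rcases eq_or_ne i (σ.reg 2) with h5 | h5
      · exact hz (hcur' i hi h1 h5 h2)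
      · rw [h3, h4]
        exact I.scan i hi h1 h5
  · simpa [e3] using I.ptr_le
  · intro _
    simpa [e3] using I.ptr_le' hcur
  · intro h1
    have := S.cur_lt
    simp at h1
    omega
  · have h1 := S.count_le
    have h2 := S.numAP
    have h3 := I.count
    simp only [Store.setReg_reg, Store.setReg_mem]
    simp only [Nat.reduceEqDiff, if_false]
    omega
  · have h1 : (τ.setReg 5 f).record n = τ.record n :=
      Store.record_congr (by simp) (fun _ _ _ => rfl)
    rw [h1]
    exact S.trans
  · right
    have h1 := S.total_lt
    have h2 := S.count_lt
    have h3 := I.total_ge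
    refine ⟨by simp; omega, ?_, by simp; omega⟩
    rcases I.hist with h4 | h4
    · exact hcol h4.2
    · exact h4.2.1

theorem Store.setReg_eq_self {σ : Store} {x v : ℕ} (h : σ.reg x = v) : σ.setReg x v = σ :=
  Store.ext (Function.update_eq_self_iff.mpr h.symm) rfl

/-- The progression with the larger coefficient plays the part of a. The current one is a or b in
either case, which is why no incomplete progression is left behind when the current index changes.
-/
theorem wp_collide {n q h E κ T₀ C : ℕ} [Fact n.Prime] {A0 : ZMod n → ℕ} {σ₀ : Store}
    (hP : Params q h E κ) (I : PhaseInv n q h T₀ A0 σ₀ σ)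
    (hn : σ.reg 0 = n) (hq : σ.reg 6 = q) (hE : σ.reg 8 = E)
    (hF : σ.reg 5 = 0) (hcur : σ.reg 2 < n) (hT₀ : n ≤ T₀ + 1)
    (hC : C = σ.mem 9 (σ.reg 2) * q + 1) (hC' : σ.reg 10 = C)
    (hX : σ.reg 11 = C * σ.reg 2 % n) (hJ : σ.reg 12 = σ.mem 8 (C * σ.reg 2 % n))
    (hJ0 : σ.reg 12 ≠ 0) (hhC : h * C < σ.mem 0 (σ.reg 2) + h)
    (hinv : InvTable n (σ.mem 11)) (hM : n ^ 4 ≤ M)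
    (hR : ∀ t τ u, PhaseInv n q h T₀ A0 σ₀ τ →
      ∑ i ∈ Finset.range n, τ.mem 9 i + u = ∑ i ∈ Finset.range n, σ.mem 9 i →
      t ≤ 80 * u + 500 → κ * q * u + 4 * σ.reg 4 ≤ 4 * τ.reg 4 + 2 * (κ * q) →
      numAP n (τ.mem 0) + 1 ≤ numAP n (σ.mem 0) → τ.reg 3 = σ.reg 3 → R t τ) :
    WP B M collide σ R := by
  have hp : n.Prime := Fact.out
  have hq0 := hP.q_pos
  have hh0 := hP.h_pos
  have H := I.table
  have hA := I.short hF
  set cur := σ.reg 2 with hcurdef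
  set X := C * cur % n with hXdef
  have hXn : X < n := Nat.mod_lt _ hp.pos
  have hcur0 : cur ≠ 0 := by
    intro h0
    rw [h0, I.zero] at hhC
    have : h * 1 ≤ h * C := Nat.mul_le_mul_left h (by omega)
    omega
  obtain ⟨hJn, k, hk, hD, hXJ⟩ := H.owner X hXn (by omega)
  rw [← hJ] at hJn hk hXJ
  have hJcur : σ.reg 12 ≠ cur := by
    rw [hJ, hXdef, hC]
    exact H.owner_ne hq0 hh0 hA hcur (hC ▸ hhC) hcur0
  have hbJ := H.bound _ hJn k hk
  rw [← hD] at hbJ hXJ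
  have hCn := TableInv.coeff_le hh0 hhC (by omega)
  have hDn := TableInv.coeff_le hh0 hbJ (by omega)
  have hAcur := hA _ hcur
  -- Equal coefficients could be cancelled, and the two differences would coincide; so one
  -- coefficient is strictly larger.
  have hkk : k ≠ σ.mem 9 cur := by
    rintro rfl
    rw [← hC] at hD
    rw [hD] at hXJ
    have := (zmod_mul_eq_iff (n := n) C cur C (σ.reg 12)).mpr hXJ
    exact hJcur (natCast_inj_of_lt hJn hcur
      (mul_left_cancel₀ (natCast_ne_zero_of_lt (by omega) (by omega)) this).symm)
  have hcop : q = 1 → Nat.Coprime C (σ.mem 10 X) := by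
    intro h1
    subst h1
    exact H.coprime hcur hJn hJcur.symm (by omega) (by omega) (by omega) (by omega) (by omega) hXJ
  have hcol : σ.sumset n = A0 → HasCollision A0 := by
    rintro rfl
    refine ⟨(cur : ZMod n), (σ.reg 12 : ZMod n), C, σ.mem 10 X, ?_, by omega, ?_, by omega, ?_, ?_⟩
    · exact fun h' => hJcur (natCast_inj_of_lt hcur hJn h').symm
    · rw [Store.sumset_eq, toZ_natCast _ hcur]; exact hCn
    · rw [Store.sumset_eq, toZ_natCast _ hJn]; exact hDn
    · exact (zmod_mul_eq_iff _ _ _ _).mpr hXJ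
  have hn2 := hp.two_le
  have hK : σ.reg 1 + 2 ≤ M := by
    have h1 := I.count
    have h2 : 2 * n + 2 ≤ n ^ 4 := by
      have h3 : 8 ≤ n ^ 3 := Nat.pow_le_pow_left hn2 3
      have h4 : 8 * n ≤ n ^ 3 * n := Nat.mul_le_mul_right n h3
      have h5 : n ^ 3 * n = n ^ 4 := by ring
      omega
    omega
  -- the operation, once its arguments are in place
  have main : ∀ σ' : Store, AgreeOff [13, 14, 15, 16] [] σ σ' → ∀ a b y x ky kx,
      σ'.reg 13 = a → σ'.reg 14 = b → σ'.reg 15 = y → σ'.reg 16 = x → a < n → b < n → a ≠ b →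
      y * a % n = x * b % n → y = ky * q + 1 → x = kx * q + 1 → kx < ky → ky ≤ σ.mem 9 a →
      h * y < σ.mem 0 a + h → h * x < σ.mem 0 b + h → (q = 1 → Nat.Coprime y x) →
      (cur = a ∨ cur = b) → ∀ t₀ ≤ 50,
      WP B M (block [operate,
        Prog.cond (Expr.lt (cell arrA (var regCur)) (var regN)) skip (assign regF (const 1))]) σ'
        (fun t τ => R (t₀ + t) τ) := by
    intro σ' hag a b y x ky kx ha hb hy hx han hbn hab he hky hkx hk hkc hhy hhx hcop hcur2 t₀ ht₀
    have I' := I.congr (hag.mono (by simp) (by simp))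
    have e1 := hag.1 1 (by simp)
    have e2 := hag.1 2 (by simp)
    have e3 := hag.1 3 (by simp)
    have e4 := hag.1 4 (by simp)
    have e5 := hag.1 5 (by simp)
    have m0 := hag.2 0 (by simp)
    have m9 := hag.2 9 (by simp)
    have m11 := hag.2 11 (by simp)
    refine WP.block_cons (wp_operate (A0 := A0) hP (by rw [hag.1 0 (by simp), hn])
      (by rw [hag.1 6 (by simp), hq]) (by rw [hag.1 8 (by simp), hE]) ha hb hy hx han hbn hab he
      hky hkx hk (by rw [m9]; exact hkc) (by rw [m0]; exact hhy) (by rw [m0]; exact hhx)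
      (by rw [m0]; exact hA) I'.zero hcop I'.table (by rw [m11]; exact hinv) I'.total
      (by omega) hM I'.trans ?_)
    intro t τ S
    have hfin := fun f => I'.step (f := f) (by rw [e5, hF]) (by rw [e2]; exact hcur) hT₀ S
      (by rw [Store.sumset_eq, m0, ← Store.sumset_eq]; exact hcol)
      (fun i _ _ hi hne => S.gone i (by rw [ha, hb, hi, e2]; exact hcur2) hne)
    have r0 : τ.reg 0 = n := by rw [S.agree.1 0 (by simp), hag.1 0 (by simp), hn]
    have r5 : τ.reg 5 = 0 := by rw [S.agree.1 5 (by simp), e5, hF]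
    have r3 : τ.reg 3 = σ.reg 3 := by rw [S.agree.1 3 (by simp), e3]
    obtain ⟨u, h1, h2, h3⟩ := S.time
    have h4 := S.numAP
    rw [m9] at h1
    rw [m0] at h4
    rw [e4] at h3
    refine WP.block_cons (WP.cond (fun ht => WP.skip (WP.block_nil ?_)) (fun ht =>
      WP.assign (fun hM _ => le_trans (by simp) hM) (WP.block_nil ?_)))
    · have ht' : τ.mem 0 (τ.reg 2) < n := by
        by_contra hcon
        simp [r0] at ht
        omega
      have := hfin 0 (by rw [if_pos ht'])
      rw [Store.setReg_eq_self r5] at this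
      exact hR _ _ u this h1 (by simp; omega) h3 h4 r3
    · have ht' : ¬ τ.mem 0 (τ.reg 2) < n := by
        intro hcon
        simp [r0] at ht
        omega
      have := hfin 1 (by rw [if_neg ht'])
      exact hR _ _ u this h1 (by simp; omega) h3 h4 (by simpa using r3)
  refine WP.block_cons (WP.cond (fun ht => ?_) (fun ht => ?_))
  · have hlt : σ.mem 10 X < C := by
      by_contra hcon
      simp [hX, hC'] at ht
      omega
    refine WP.block_cons (WP.assign (fun _ hS => hS.reg _) ?_)
    refine WP.block_cons (WP.assign (fun _ hS => hS.reg _) ?_)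
    refine WP.block_cons (WP.assign (fun _ hS => hS.reg _) ?_)
    refine WP.block_cons (WP.assign (fun _ hS => hS.mem _ _) ?_)
    refine WP.block_nil ?_
    refine main _ ?_ cur (σ.reg 12) C (σ.mem 10 X) (σ.mem 9 cur) k ?_ ?_ ?_ ?_ hcur hJn hJcur.symm
      hXJ hC hD ?_ le_rfl hhC hbJ hcop (Or.inl rfl) _ ?_
    · exact ((((AgreeOff.refl _ _ _).setReg (by simp)).setReg (by simp)).setReg (by simp)).setReg
        (by simp)
    · simp [hcurdef]
    · simp
    · simp [hC']
    · simp [hX]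
    · by_contra hcon
      have := Nat.mul_le_mul_right q (not_lt.mp hcon)
      omega
    · simp
  · have hlt : C ≤ σ.mem 10 X := by
      by_contra hcon
      simp [hX, hC'] at ht
      omega
    refine WP.block_cons (WP.assign (fun _ hS => hS.reg _) ?_)
    refine WP.block_cons (WP.assign (fun _ hS => hS.reg _) ?_)
    refine WP.block_cons (WP.assign (fun _ hS => hS.mem _ _) ?_)
    refine WP.block_cons (WP.assign (fun _ hS => hS.reg _) ?_)
    refine WP.block_nil ?_
    refine main _ ?_ (σ.reg 12) cur (σ.mem 10 X) C k (σ.mem 9 cur) ?_ ?_ ?_ ?_ hJn hcur hJcur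
      hXJ.symm hD hC ?_ hk.le hbJ hhC (fun h1 => (hcop h1).symm) (Or.inr rfl) _ ?_
    · exact ((((AgreeOff.refl _ _ _).setReg (by simp)).setReg (by simp)).setReg (by simp)).setReg
        (by simp)
    · simp
    · simp [hcurdef]
    · simp [hX]
    · simp [hC']
    · have : σ.mem 9 cur ≤ k := by
        by_contra hcon
        have := Nat.mul_le_mul_right q (show k + 1 ≤ σ.mem 9 cur by omega)
        rw [add_mul] at this
        omega
      omega
    · simp

end
-- Amortized time of a phase
/-- The potential that pays for the time of a phase. -/
def phasePot (n q κ G : ℕ) (σ : Store) : ℕ :=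
  if σ.reg 2 < n ∧ σ.reg 4 < G ∧ σ.reg 5 = 0 then
    -- An operation that deletes u entries needs κq(1 + u) for its time and κqu for entering as many
    -- again. By `Step.time` this is at most 8 times the gain in length plus 5κq, which explains the
    -- weights 8 and 5. The term 1 + n pays for the last turn.
    700 * (κ * q * ((1 + n) + (n - ∑ i ∈ Finset.range n, σ.mem 9 i) + (n + 2 - σ.reg 3) +
      5 * numAP n (σ.mem 0)) + 8 * (G - σ.reg 4))
  else 0

section
variable {B M : ℕ} {σ : Store} {R : ℕ → Store → Prop}

theorem phaseTest_eval_ne (σ : Store) :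
    phaseTest.eval σ ≠ 0 ↔ σ.reg 2 < σ.reg 0 ∧ σ.reg 4 < σ.reg 9 ∧ σ.reg 5 = 0 := by
  simp only [phaseTest, eval_mul, eval_lt, eval_eq, eval_var, eval_const]
  by_cases h1 : σ.reg 2 < σ.reg 0 <;> by_cases h2 : σ.reg 4 < σ.reg 9 <;>
    by_cases h3 : σ.reg 5 = 0 <;> simp [h1, h2, h3]

/-- In the last turn the total length may overshoot the target, where the truncated difference no
longer pays for the deletions. Then the potential becomes 0, and the reserve 1 + n suffices because
fewer than n entries exist. -/
theorem phasePot_step {n q κ G t u : ℕ} {σ τ : Store}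
    (hc : σ.reg 2 < n ∧ σ.reg 4 < G ∧ σ.reg 5 = 0) 
    (hsum : ∑ i ∈ Finset.range n, σ.mem 9 i < n)
    (ht : t ≤ 700 * (u + 1)) (hu : u ≤ ∑ i ∈ Finset.range n, σ.mem 9 i)
    (hΦ : κ * q * (1 + u) + (κ * q * ((n - ∑ i ∈ Finset.range n, τ.mem 9 i) + (n + 2 - τ.reg 3) +
      5 * numAP n (τ.mem 0))) + 8 * (G - τ.reg 4) ≤
      κ * q * ((n - ∑ i ∈ Finset.range n, σ.mem 9 i) + (n + 2 - σ.reg 3) +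
      5 * numAP n (σ.mem 0)) + 8 * (G - σ.reg 4) ∨
      ¬ (τ.reg 2 < n ∧ τ.reg 4 < G ∧ τ.reg 5 = 0)) :
    t * (κ * q) + phasePot n q κ G τ ≤ phasePot n q κ G σ := by
  have htW : t * (κ * q) ≤ 700 * (κ * q * (1 + u)) := by
    calc t * (κ * q) ≤ 700 * (u + 1) * (κ * q) := Nat.mul_le_mul_right _ ht
      _ = 700 * (κ * q * (1 + u)) := by ring
  unfold phasePot
  rw [if_pos hc]
  split_ifs with h1
  · have hΦ := hΦ.resolve_right (not_not.mpr h1)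
    simp only [Nat.mul_add] at *
    omega
  · have : κ * q * (1 + u) ≤ κ * q * (1 + n) := Nat.mul_le_mul_left _ (by omega)
    simp only [Nat.mul_add] at *
    omega

/-- A turn either moves the pointer, or adds an entry, or removes a progression with a gain in
length; each lowers its own term of the potential. -/
theorem wp_advance {n q h E κ G T₀ : ℕ} [Fact n.Prime] {A0 : ZMod n → ℕ} {σ₀ : Store}
    (hP : Params q h E κ) (hn : σ₀.reg 0 = n) (hq : σ₀.reg 6 = q) (hh : σ₀.reg 7 = h)
    (hE : σ₀.reg 8 = E) (hG : σ₀.reg 9 = G) (hinv : InvTable n (σ₀.mem 11)) (hqn : q ≤ n ^ 2)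
    (hT₀ : n ≤ T₀ + 1) (hM : n ^ 4 ≤ M)
    (I : PhaseInv n q h T₀ A0 σ₀ σ) (hc : phaseTest.eval σ ≠ 0) :
    WP B M advance σ fun t τ => PhaseInv n q h T₀ A0 σ₀ τ ∧
      (t + phaseTest.cost + 1) * (κ * q) + phasePot n q κ G τ ≤ phasePot n q κ G σ := by
  have hp : n.Prime := Fact.out
  have e0 : σ.reg 0 = n := by rw [I.agree.1 0 (by simp), hn]
  have e6 : σ.reg 6 = q := by rw [I.agree.1 6 (by simp), hq]
  have e7 : σ.reg 7 = h := by rw [I.agree.1 7 (by simp), hh]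
  have e8 : σ.reg 8 = E := by rw [I.agree.1 8 (by simp), hE]
  have e9 : σ.reg 9 = G := by rw [I.agree.1 9 (by simp), hG]
  have m11 : σ.mem 11 = σ₀.mem 11 := I.agree.2 11 (by simp)
  rw [phaseTest_eval_ne, e0, e9] at hc
  obtain ⟨hcur, hTG, hF⟩ := hc
  have hq0 := hP.q_pos
  have hA := I.short hF
  have hsum := I.table.sum_kc_lt hq0 hP.h_pos hA
  have hkc : σ.mem 9 (σ.reg 2) < n := lt_of_le_of_lt
    (Finset.single_le_sum (fun i _ => Nat.zero_le (σ.mem 9 i)) (Finset.mem_range.mpr hcur)) hsum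
  have hn2 := hp.two_le
  have hn4 : 8 * n ≤ n ^ 4 := by
    have h3 : 8 ≤ n ^ 3 := Nat.pow_le_pow_left hn2 3
    have h4 : 8 * n ≤ n ^ 3 * n := Nat.mul_le_mul_right n h3
    have h5 : n ^ 3 * n = n ^ 4 := by ring
    omega
  have hCM : σ.mem 9 (σ.reg 2) * q + 1 ≤ M := by
    have h1 : σ.mem 9 (σ.reg 2) * q ≤ n * n ^ 2 := Nat.mul_le_mul hkc.le hqn
    have h2 : n ^ 4 = n * (n * n ^ 2) := by ring
    have h3 : 2 * (n * n ^ 2) ≤ n * (n * n ^ 2) := Nat.mul_le_mul_right _ hn2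
    have h4 : 0 < n * n ^ 2 := by positivity
    omega
  have hcost : phaseTest.cost = 11 := rfl
  have hcond : σ.reg 2 < n ∧ σ.reg 4 < G ∧ σ.reg 5 = 0 := ⟨hcur, hTG, hF⟩
  refine WP.block_cons (WP.assign (fun _ _ => by simpa [e6] using hCM) ?_)
  refine WP.block_cons (WP.cond (fun ht => ?_) (fun ht => ?_))
  · -- the current progression is completely registered
    have hcompl : σ.mem 0 (σ.reg 2) + h ≤ h * (σ.mem 9 (σ.reg 2) * q + 1) := by
      by_contra hcon
      simp [e6, e7] at ht
      omega
    have hP1 := I.ptr_le' hcur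
    refine WP.block_cons (WP.assign (fun _ hS => hS.reg _) ?_)
    refine WP.block_cons (WP.assign (fun _ _ => by simp; omega) ?_)
    refine WP.block_nil (WP.block_nil ⟨?_, ?_⟩)
    · refine ⟨?_, ?_, ?_, I.le, I.zero, ?_, ?_, ?_, I.table, ?_, ?_, ?_, ?_, ?_, ?_, ?_⟩
      · exact ((I.agree.setReg (by simp)).setReg (by simp)).setReg (by simp)
      · simpa using I.short
      · simpa using I.long
      · simpa using I.total
      · simpa using I.total_ge
      · simpa using I.count_ge
      · intro i hi h1 h2
        simp at h1 h2 ⊢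
        rcases eq_or_ne i (σ.reg 2) with rfl | h3
        · exact hcompl
        · exact I.scan i hi (by omega) h3
      · simp; omega
      · simp; omega
      · simp
      · simpa using I.count
      · have := I.trans
        rw [Store.record_congr (σ := σ) (by simp) (fun _ _ _ => by simp)]
        exact this
      · simpa [Store.sumset_eq] using I.hist
    · refine phasePot_step (u := 0) hcond hsum (by rw [hcost]; simp) (Nat.zero_le _)
        (Or.inl ?_)
      simp only [Store.setReg_reg, Store.setReg_mem, eval_var, eval_add, eval_const]
      simp only [Nat.reduceEqDiff, if_false, if_true]
      have : n + 2 - σ.reg 3 = n + 2 - (σ.reg 3 + 1) + 1 := by omega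
      rw [this]
      simp only [Nat.mul_add, Nat.mul_one, Nat.mul_zero]
      omega
  · have hnc : h * (σ.mem 9 (σ.reg 2) * q + 1) < σ.mem 0 (σ.reg 2) + h := by
      by_contra hcon
      simp [e6, e7] at ht
      omega
    have hXM : ∀ c, c % n ≤ M := fun c => (Nat.mod_lt c hp.pos).le.trans (by omega)
    refine WP.block_cons (WP.assign (fun _ _ => by simpa [e0] using hXM _) ?_)
    refine WP.block_cons (WP.assign (fun _ hS => hS.mem _ _) ?_)
    set C := σ.mem 9 (σ.reg 2) * q + 1 with hCdef
    have hstore : (((σ.setReg 10 ((cell arrKc (var regCur) * var regQ + const 1).eval σ)).setReg 11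
        ((var regC * var regCur % var regN).eval
          (σ.setReg 10 ((cell arrKc (var regCur) * var regQ + const 1).eval σ)))).setReg 12
        ((cell arrTbl (var regX)).eval ((σ.setReg 10
          ((cell arrKc (var regCur) * var regQ + const 1).eval σ)).setReg 11
        ((var regC * var regCur % var regN).eval
          (σ.setReg 10 ((cell arrKc (var regCur) * var regQ + const 1).eval σ)))))) =
        ((σ.setReg 10 C).setReg 11 (C * σ.reg 2 % n)).setReg 12 (σ.mem 8 (C * σ.reg 2 % n)) := by
      simp [e0, e6, hCdef]
    rw [hstore]
    have hag : AgreeOff [10, 11, 12, 13, 14, 15, 16] [] σ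
        (((σ.setReg 10 C).setReg 11 (C * σ.reg 2 % n)).setReg 12
          (σ.mem 8 (C * σ.reg 2 % n))) :=
      (((AgreeOff.refl _ _ _).setReg (by simp)).setReg (by simp)).setReg (by simp)
    have I' := I.congr hag
    refine WP.block_cons (WP.cond (fun hJ => ?_) (fun hJ => ?_))
    · refine wp_collide (E := E) (C := C) hP I' (by simp [e0]) (by simp [e6]) (by simp [e8]) (by simp [hF])
        (by simp [hcur]) hT₀ (by simp [hCdef]) (by simp) (by simp) (by simp) (by simpa using hJ)
        (by simpa using hnc) (by simpa [m11] using hinv) hM ?_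
      intro t τ u Iτ h1 h2 h3 h4 h5
      simp only [Store.setReg_reg, Store.setReg_mem] at h1 h3 h4 h5
      simp only [Nat.reduceEqDiff, if_false] at h3 h5
      refine WP.block_nil (WP.block_nil ⟨Iτ, ?_⟩)
      refine phasePot_step (u := u) hcond hsum ?_ (by omega) ?_
      · rw [hcost]; simp; omega
      · by_cases hend : τ.reg 2 < n ∧ τ.reg 4 < G ∧ τ.reg 5 = 0
        · left
          have e : n - ∑ i ∈ Finset.range n, τ.mem 9 i =
            n - ∑ i ∈ Finset.range n, σ.mem 9 i + u := by omega
          have h6 : κ * q * (numAP n (τ.mem 0) + 1) ≤ κ * q * numAP n (σ.mem 0) :=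
            Nat.mul_le_mul_left _ h4
          have h7 : κ * q * (5 * numAP n (τ.mem 0)) = 5 * (κ * q * numAP n (τ.mem 0)) := by ring
          have h8 : κ * q * (5 * numAP n (σ.mem 0)) = 5 * (κ * q * numAP n (σ.mem 0)) := by ring
          rw [e, h5]
          simp only [Nat.mul_add, Nat.mul_one, h7, h8] at *
          omega
        · right; exact hend
    · -- the multiple is registered
      have hJ' : σ.mem 8 (C * σ.reg 2 % n) = 0 := by simpa using hJ
      have hcur0 : σ.reg 2 ≠ 0 := by
        intro h0
        rw [h0, I.zero] at hnc
        have : h * 1 ≤ h * C := Nat.mul_le_mul_left h (by omega)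
        omega
      refine WP.block_cons (WP.write (fun _ hS => hS.reg _) ?_)
      refine WP.block_cons (WP.write (fun _ hS => hS.reg _) ?_)
      refine WP.block_cons (WP.write (fun _ _ => by simp; omega) ?_)
      refine WP.block_nil (WP.block_nil (WP.block_nil ⟨?_, ?_⟩))
      · have htab := I.table.register hcur hcur0 hnc hJ'
        refine ⟨?_, ?_, ?_, ?_, ?_, ?_, ?_, ?_, ?_, ?_, ?_, ?_, ?_, ?_, ?_, ?_⟩
        · exact (((I'.agree.setMem (by simp)).setMem (by simp)).setMem (by simp))
        · simpa using I.short
        · simpa using I.long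
        · simpa using I.le
        · simpa using I.zero
        · simpa using I.total
        · simpa using I.total_ge
        · simpa using I.count_ge
        · simpa [hCdef] using htab
        · intro i hi h1 h2
          simp at h1 h2 ⊢
          rw [Function.update_of_ne h2]
          exact I.scan i hi h1 h2
        · simpa using I.ptr_le
        · simpa using I.ptr_le'
        · simpa using I.ptr_lt
        · simpa using I.count
        · have := I.trans
          rw [Store.record_congr (σ := σ) (by simp) (fun c _ _ => by
            simp [show c ≠ 8 by omega, show c ≠ 9 by omega, show c ≠ 10 by omega]),
            Store.sumset_eq]
          simpa [Store.sumset_eq] using this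
        · simpa [Store.sumset_eq] using I.hist
      · have hs := sum_update (σ.mem 9) hcur (σ.mem 9 (σ.reg 2) + 1)
        refine phasePot_step (u := 0) hcond hsum (by rw [hcost]; simp) (Nat.zero_le _)
          (Or.inl ?_)
        simp
        have e : n - ∑ i ∈ Finset.range n, σ.mem 9 i = n - ∑ i ∈ Finset.range n,
          Function.update (σ.mem 9) (σ.reg 2) (σ.mem 9 (σ.reg 2) + 1) i + 1 := by omega
        rw [e]
        simp only [Nat.mul_add, Nat.mul_one]
        omega

end
-- Time and result of a whole phase
/-- The invariant of the sumset and the record between the phases. -/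
structure SumsetInv (n : ℕ) (A0 : ZMod n → ℕ) (σ : Store) : Prop where
  short : σ.reg 5 = 0 → ∀ i < n, σ.mem 0 i < n
  long : σ.reg 5 ≠ 0 → ∃ i < n, n ≤ σ.mem 0 i
  le : ∀ i < n, σ.mem 0 i ≤ 4 * (n * n)
  zero : σ.mem 0 0 = 0
  total : σ.reg 4 = ∑ i ∈ Finset.range n, σ.mem 0 i
  count : σ.reg 1 + 2 * numAP n (σ.mem 0) ≤ 2 * n
  trans : Transforms (σ.record n) A0 (σ.sumset n)
  hist : σ.reg 1 = 0 ∧ σ.sumset n = A0 ∨ 0 < σ.reg 1 ∧ HasCollision A0 ∧ n ≤ σ.reg 4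

theorem PhaseInv.sumsetInv {n q h T₀ : ℕ} {A0 : ZMod n → ℕ} {σ₀ σ : Store}
    (I : PhaseInv n q h T₀ A0 σ₀ σ) : SumsetInv n A0 σ :=
  ⟨I.short, I.long, I.le, I.zero, I.total, I.count, I.trans, I.hist⟩

/-- The invariant does not depend on the other registers and arrays. -/
theorem SumsetInv.congr {n : ℕ} {A0 : ZMod n → ℕ} {σ τ : Store} {rs as : List ℕ}
    (I : SumsetInv n A0 σ) (h : AgreeOff rs as σ τ) (h1 : 1 ∉ rs) (h4 : 4 ∉ rs) (h5 : 5 ∉ rs)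
    (ha : ∀ a ∈ as, 8 ≤ a) : SumsetInv n A0 τ := by
  have e1 := h.1 1 h1
  have e4 := h.1 4 h4
  have e5 := h.1 5 h5
  have m0 := h.2 0 fun h0 => by have := ha 0 h0; omega
  have er : τ.record n = σ.record n := h.record h1 fun a h0 => Or.inr (ha a h0)
  refine ⟨?_, ?_, ?_, ?_, ?_, ?_, ?_, ?_⟩
  · rw [e5, m0]; exact I.short
  · rw [e5, m0]; exact I.long
  · rw [m0]; exact I.le
  · rw [m0]; exact I.zero
  · rw [m0, e4]; exact I.total
  · rw [e1, m0]; exact I.count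
  · rw [er, Store.sumset_eq, m0]; exact I.trans
  · rw [e1, e4, Store.sumset_eq, m0]; exact I.hist

section
variable {B M : ℕ} {σ : Store} {R : ℕ → Store → Prop}

/-- The bound on G makes the initial potential O(κqn), and time is counted in units of 1/(κq). This
is how growth to a length of order κqn fits into time O(n). -/
theorem wp_phase {n q h E κ G : ℕ} [Fact n.Prime] {A0 : ZMod n → ℕ}
    (hP : Params q h E κ) (hn : σ.reg 0 = n) (hq : σ.reg 6 = q) (hh : σ.reg 7 = h)
    (hE : σ.reg 8 = E) (hG : σ.reg 9 = G) (hinv : InvTable n (σ.mem 11)) (hqn : q ≤ n ^ 2)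
    (hG' : 8 * G ≤ 128 * (κ * q * n)) (hT : n ≤ σ.reg 4 + 1) (hM : n ^ 4 ≤ M)
    (I : SumsetInv n A0 σ)
    (hR : ∀ t τ, t ≤ 100000 * n →
      AgreeOff [1, 2, 3, 4, 5, 10, 11, 12, 13, 14, 15, 16, 17, 18, 19, 20, 21, 22, 23, 24, 25, 30]
        [0, 1, 2, 3, 4, 5, 6, 7, 8, 9, 10] σ τ →
      SumsetInv n A0 τ → σ.reg 4 ≤ τ.reg 4 → σ.reg 1 ≤ τ.reg 1 →
      TableInv n q h (τ.mem 0) (τ.mem 8) (τ.mem 10) (τ.mem 9) →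
      (τ.reg 5 ≠ 0 ∨ G ≤ τ.reg 4 ∨
        ∀ i < n, τ.mem 0 i + h ≤ h * (τ.mem 9 i * q + 1)) → R t τ) :
    WP B M phase σ R := by
  have hn2 : 2 ≤ n := (Fact.out : n.Prime).two_le
  have hnM : n ≤ M := (Nat.le_self_pow (by omega) n).trans hM
  refine WP.block_cons (WP.assign (fun _ _ => Nat.zero_le _) ?_)
  refine WP.block_cons (WP.loop 1 one_pos (fun τ => 40 * (n - τ.reg 30))
    (fun τ => AgreeOff [30] [8, 9] σ τ ∧ τ.reg 30 ≤ n ∧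
      ∀ i < τ.reg 30, τ.mem 8 i = 0 ∧ τ.mem 9 i = 0) ?_
    ⟨(AgreeOff.refl _ _ _).setReg (by simp), by simp, by simp⟩ ?_)
  · rintro τ ⟨h1, h2, h3⟩ hc
    have e0 : τ.reg 0 = n := by rw [h1.1 0 (by simp), hn]
    have hlt : τ.reg 30 < n := by
      by_contra hcon
      simp [e0, hcon] at hc
    refine WP.block_cons (WP.write (fun _ _ => Nat.zero_le _) ?_)
    refine WP.block_cons (WP.write (fun _ _ => Nat.zero_le _) ?_)
    refine WP.block_cons (WP.assign (fun _ _ => by simp; omega) ?_)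
    refine WP.block_nil ⟨⟨?_, ?_, ?_⟩, ?_⟩
    · exact ((h1.setMem (by simp)).setMem (by simp)).setReg (by simp)
    · simp; omega
    · intro i hi
      simp at hi
      simp only [Store.setReg_mem, Store.setMem_mem, Store.setMem_reg, eval_var, eval_const]
      simp only [Nat.reduceEqDiff, if_false, if_true]
      rcases eq_or_ne i (τ.reg 30) with rfl | hne
      · simp
      · rw [Function.update_of_ne hne, Function.update_of_ne hne]
        exact h3 i (by omega)
    · simp; omega
  rintro t1 τ ⟨h1, h2, h3⟩ hz ht1
  have e0 : τ.reg 0 = n := by rw [h1.1 0 (by simp), hn]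
  have hi : τ.reg 30 = n := by
    by_contra hcon
    have : τ.reg 30 < n := by omega
    simp [e0, this] at hz
  rw [hi] at h3
  have I1 := I.congr h1 (by simp) (by simp) (by simp) (by simp)
  refine WP.block_cons (WP.assign (fun _ _ => Nat.zero_le _) ?_)
  refine WP.block_cons (WP.assign (fun hM _ => le_trans (by simp) hM) ?_)
  have hκq : 0 < κ * q := Nat.mul_pos hP.κ_pos hP.q_pos
  set τ' := (τ.setReg 2 ((Expr.const 0).eval τ)).setReg 3
    ((Expr.const 1).eval (τ.setReg 2 ((Expr.const 0).eval τ))) with hτ'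
  have hag : AgreeOff [2, 3] [] τ τ' :=
    ((AgreeOff.refl _ _ _).setReg (by simp)).setReg (by simp)
  have I2 := I1.congr hag (by simp) (by simp) (by simp) (by simp)
  have r2 : τ'.reg 2 = 0 := by simp [hτ']
  have r3 : τ'.reg 3 = 1 := by simp [hτ']
  have r4 : τ'.reg 4 = σ.reg 4 := by rw [hag.1 4 (by simp), h1.1 4 (by simp)]
  have r1 : τ'.reg 1 = σ.reg 1 := by rw [hag.1 1 (by simp), h1.1 1 (by simp)]
  have J : PhaseInv n q h (σ.reg 4) A0 σ τ' := by
    refine ⟨?_, I2.short, I2.long, I2.le, I2.zero, I2.total, r4.ge, r1.ge, ?_, ?_, ?_, ?_, ?_, I2.count,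
      I2.trans, I2.hist⟩
    · exact (h1.mono (by simp) (by simp)).trans (hag.mono (by simp) (by simp))
    · exact TableInv.empty (fun i hi => (h3 i hi).2) (fun i hi => (h3 i hi).1) (by omega)
    · intro i _ h4 h5
      omega
    · omega
    · omega
    · omega
  refine WP.block_cons (WP.loop (κ * q) hκq (phasePot n q κ G)
    (PhaseInv n q h (σ.reg 4) A0 σ) ?_ J ?_)
  · intro υ Iυ hc
    exact wp_advance hP hn hq hh hE hG hinv hqn hT hM Iυ hc
  · intro t υ Iυ hz ht
    refine WP.block_nil (hR _ _ ?_ Iυ.agree Iυ.sumsetInv Iυ.total_ge Iυ.count_ge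
      Iυ.table ?_)
    · have hpot : phasePot n q κ G τ' ≤ κ * q * (98000 * n) := by
        unfold phasePot
        split_ifs
        · have a1 := numAP_le n (τ'.mem 0)
          have a2 : (1 + n) + (n - ∑ i ∈ Finset.range n, τ'.mem 9 i) + (n + 2 - τ'.reg 3) +
              5 * numAP n (τ'.mem 0) ≤ 10 * n := by omega
          have a3 := Nat.mul_le_mul_left (κ * q) a2
          have a4 : κ * q * (98000 * n) = 9800 * (κ * q * (10 * n)) := by ring
          have a5 : 128 * (κ * q * n) * 10 = 128 * (κ * q * (10 * n)) := by ring
          omega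
        · exact Nat.zero_le _
      have hle : t * (κ * q) ≤ (98000 * n + 12) * (κ * q) := by
        rw [add_mul, mul_comm (98000 * n)]
        have : phaseTest.cost + 1 = 12 := rfl
        rw [this] at ht
        omega
      have := Nat.le_of_mul_le_mul_right hle hκq
      simp at ht1
      simp
      omega
    · by_contra hcon
      simp only [not_or, not_not, not_le] at hcon
      obtain ⟨hF, hTG, hcomp⟩ := hcon
      apply hcomp
      -- If neither other reason stopped the loop, the current index has left the range, and `scan`
      -- covers all differences.
      have hcur : n ≤ υ.reg 2 := by
        by_contra hlt
        have e0 : υ.reg 0 = n := by rw [Iυ.agree.1 0 (by simp), hn]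
        have e9 : υ.reg 9 = G := by rw [Iυ.agree.1 9 (by simp), hG]
        exact (phaseTest_eval_ne υ).mpr ⟨by omega, by omega, hF⟩ hz
      have := Iυ.ptr_lt hcur
      intro i hi
      exact Iυ.scan i hi (by omega) (by omega)

end
-- Inverses, logarithm, output of the table, pruning
/-- Compute the inverses modulo `n`. -/
def inverses : Prog := block [
  write arrInv (const 1) (const 1),
  assign reg_i (const 2),
  loop (Expr.lt (var reg_i) (var regN)) (block [
    write arrInv (var reg_i)
      ((var regN - var regN / var reg_i) * cell arrInv (var regN % var reg_i) % var regN),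
    assign reg_i (var reg_i + const 1)])]

/-- Compute the logarithm of `n`, rounded up. -/
def logarithm : Prog := block [
  assign regLg (const 0),
  assign regPow (const 1),
  loop (Expr.lt (var regPow) (var regN)) (block [
    assign regPow (var regPow + var regPow),
    assign regLg (var regLg + const 1)])]

/-- Output the table of the multiples. -/
def tabulate : Prog := block [
  assign reg_i (const 0),
  loop (Expr.lt (var reg_i) (var regN)) (block [
    write 1 (var reg_i) (cell arrD (var reg_i)),
    write 2 (var reg_i) (cell arrTbl (var reg_i)),
    assign reg_i (var reg_i + const 1)]),
  assign regN (const 0)]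

/-- Drop progressions that are shorter than `regThr` or that are not needed for the length `n`. -/
def prune : Prog := block [
  assign regS (const 0),
  assign reg_i (const 0),
  loop (Expr.lt (var reg_i) (var regN)) (block [
    cond (Expr.lt (cell arrA (var reg_i)) (var regThr) + Expr.lt (var regN) (var regS + const 1))
      (block [
        assign regTmp (cell arrA (var reg_i)),
        emit 0 reg_i regTmp reg_i reg_i reg_i reg_i,
        write arrA (var reg_i) (const 0)])
      (assign regS (var regS + cell arrA (var reg_i))),
    assign reg_i (var reg_i + const 1)]),
  assign regN (const 1)]

section
variable {B M : ℕ} {σ : Store} {R : ℕ → Store → Prop}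

/-- From n = i(n/i) + n % i one gets i(n − n/i) ≡ n % i modulo n, so the inverse of i reduces to
that of a smaller number. -/
theorem inverse_step {n i : ℕ} [Fact n.Prime] {inv : ℕ → ℕ}
    (h : n % i * inv (n % i) % n = 1) : i * ((n - n / i) * inv (n % i) % n) % n = 1 := by
  have hn1 : 1 < n := (Fact.out : n.Prime).one_lt
  have h1 : ((n % i * inv (n % i) : ℕ) : ZMod n) = ((1 : ℕ) : ZMod n) := by
    rw [ZMod.natCast_eq_natCast_iff', h, Nat.mod_eq_of_lt hn1]
  have h2 : ((i * ((n - n / i) * inv (n % i) % n) : ℕ) : ZMod n) = ((1 : ℕ) : ZMod n) := by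
    rw [← h1]
    have h3 : ((i * (n / i) + n % i : ℕ) : ZMod n) = 0 := by
      rw [Nat.div_add_mod]; simp
    rw [Nat.cast_mul, ZMod.natCast_mod, Nat.cast_mul, Nat.cast_sub (Nat.div_le_self n i),
      ZMod.natCast_self, Nat.cast_mul]
    push_cast at h3
    linear_combination (-(inv (n % i) : ZMod n)) * h3
  rw [ZMod.natCast_eq_natCast_iff', Nat.mod_eq_of_lt hn1] at h2
  exact h2

theorem wp_inverses {n : ℕ} [Fact n.Prime] (hn : σ.reg 0 = n) (hM : n ^ 4 ≤ M)
    (hR : ∀ t τ, t ≤ 100 * n → AgreeOff [30] [11] σ τ → InvTable n (τ.mem 11) → R t τ) :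
    WP B M inverses σ R := by
  have hp : n.Prime := Fact.out
  have hn2 := hp.two_le
  have hnM : n ≤ M := (Nat.le_self_pow (by omega) n).trans hM
  refine WP.block_cons (WP.write (fun hM _ => le_trans (by simp) hM) ?_)
  refine WP.block_cons (WP.assign (fun hM _ => le_trans (by simp) hM) ?_)
  refine WP.block_cons (WP.loop 1 one_pos (fun τ => 40 * (n - τ.reg 30))
    (fun τ => AgreeOff [30] [11] σ τ ∧ 2 ≤ τ.reg 30 ∧ τ.reg 30 ≤ n ∧
      ∀ i, 0 < i → i < τ.reg 30 → i * τ.mem 11 i % n = 1 ∧ τ.mem 11 i < n) ?_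
    ⟨((AgreeOff.refl _ _ _).setMem (by simp)).setReg (by simp), by simp, by simp; omega, ?_⟩ ?_)
  · rintro τ ⟨h1, h2, h3, h4⟩ hc
    have e0 : τ.reg 0 = n := by rw [h1.1 0 (by simp), hn]
    have hlt : τ.reg 30 < n := by
      by_contra hcon
      simp [e0, hcon] at hc
    have hmod : 0 < n % τ.reg 30 := by
      rw [Nat.pos_iff_ne_zero]
      intro h0
      rcases (Nat.dvd_prime hp).mp (Nat.dvd_of_mod_eq_zero h0) with h5 | h5 <;> omega
    have hmod' : n % τ.reg 30 < τ.reg 30 := Nat.mod_lt _ (by omega)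
    refine WP.block_cons (WP.write (fun _ _ => ?_) ?_)
    · simp only [eval_mod, eval_var, e0]
      exact (Nat.mod_lt _ hp.pos).le.trans hnM
    refine WP.block_cons (WP.assign (fun _ _ => by simp; omega) ?_)
    refine WP.block_nil ⟨⟨?_, ?_, ?_, ?_⟩, ?_⟩
    · exact (h1.setMem (by simp)).setReg (by simp)
    · simp; omega
    · simp; omega
    · intro i hi0 hi
      simp at hi
      simp only [Store.setReg_mem, Store.setMem_mem, eval_var, eval_mod, eval_mul, eval_sub, eval_div, eval_cell, if_true, e0]
      rcases eq_or_ne i (τ.reg 30) with rfl | hne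
      · rw [Function.update_self]
        exact ⟨inverse_step (h4 _ hmod hmod').1, Nat.mod_lt _ hp.pos⟩
      · rw [Function.update_of_ne hne]
        exact h4 i hi0 (by omega)
    · simp; omega
  · intro i hi0 hi
    simp at hi
    obtain rfl : i = 1 := by omega
    simp
    exact ⟨Nat.mod_eq_of_lt hp.one_lt, hp.one_lt⟩
  · rintro t τ ⟨h1, h2, h3, h4⟩ hz ht
    have e0 : τ.reg 0 = n := by rw [h1.1 0 (by simp), hn]
    have hi : τ.reg 30 = n := by
      by_contra hcon
      have : τ.reg 30 < n := by omega
      simp [e0, this] at hz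
    rw [hi] at h4
    refine WP.block_nil (hR _ _ ?_ h1 h4)
    simp at ht
    simp
    omega

theorem wp_logarithm {n : ℕ} (hn2 : 2 ≤ n) (hn : σ.reg 0 = n) (hM : n ^ 4 ≤ M)
    (hR : ∀ t τ, t ≤ 100 * n → AgreeOff [26, 27] [] σ τ → n ≤ 2 ^ τ.reg 26 →
      2 ^ τ.reg 26 < 2 * n → R t τ) :
    WP B M logarithm σ R := by
  have h2M : 2 * n ≤ M := by
    have : 2 * n ≤ n ^ 4 := by
      calc 2 * n ≤ n * n := Nat.mul_le_mul_right n hn2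
        _ = n ^ 2 := by ring
        _ ≤ n ^ 4 := Nat.pow_le_pow_right (by omega) (by omega)
    omega
  refine WP.block_cons (WP.assign (fun _ _ => Nat.zero_le _) ?_)
  refine WP.block_cons (WP.assign (fun hM _ => le_trans (by simp) hM) ?_)
  refine WP.block_cons (WP.loop 1 one_pos (fun τ => 40 * (2 * n - τ.reg 27))
    (fun τ => AgreeOff [26, 27] [] σ τ ∧ τ.reg 27 = 2 ^ τ.reg 26 ∧ τ.reg 27 < 2 * n) ?_
    ⟨((AgreeOff.refl _ _ _).setReg (by simp)).setReg (by simp), by simp, by simp; omega⟩ ?_)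
  · rintro τ ⟨h1, h2, h3⟩ hc
    have e0 : τ.reg 0 = n := by rw [h1.1 0 (by simp), hn]
    have hlt : τ.reg 27 < n := by
      by_contra hcon
      simp [e0, hcon] at hc
    have hpos : 0 < τ.reg 27 := by rw [h2]; positivity
    have hlg : τ.reg 26 < τ.reg 27 := by rw [h2]; exact Nat.lt_two_pow_self
    refine WP.block_cons (WP.assign (fun _ _ => by simp; omega) ?_)
    refine WP.block_cons (WP.assign (fun _ _ => by simp; omega) ?_)
    refine WP.block_nil ⟨⟨(h1.setReg (by simp)).setReg (by simp), ?_, ?_⟩, ?_⟩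
    · simp [pow_succ]; omega
    · simp; omega
    · simp; omega
  · rintro t τ ⟨h1, h2, h3⟩ hz ht
    have e0 : τ.reg 0 = n := by rw [h1.1 0 (by simp), hn]
    have hi : n ≤ τ.reg 27 := by
      by_contra hcon
      have : τ.reg 27 < n := by omega
      simp [e0, this] at hz
    refine WP.block_nil (hR _ _ ?_ h1 (by omega) (by omega))
    simp at ht
    simp
    omega

theorem wp_tabulate {n : ℕ} (hn0 : 0 < n) (hn : σ.reg 0 = n) (hnM : n ≤ M)
    (hR : ∀ t τ, t ≤ 100 * n → τ.reg 0 = 0 → (∀ i < n, τ.mem 1 i = σ.mem 10 i) →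
      (∀ i < n, τ.mem 2 i = σ.mem 8 i) → R t τ) :
    WP B M tabulate σ R := by
  refine WP.block_cons (WP.assign (fun _ _ => Nat.zero_le _) ?_)
  refine WP.block_cons (WP.loop 1 one_pos (fun τ => 40 * (n - τ.reg 30))
    (fun τ => AgreeOff [30] [1, 2] σ τ ∧ τ.reg 30 ≤ n ∧
      ∀ i < τ.reg 30, τ.mem 1 i = σ.mem 10 i ∧ τ.mem 2 i = σ.mem 8 i) ?_
    ⟨(AgreeOff.refl _ _ _).setReg (by simp), by simp, by simp⟩ ?_)
  · rintro τ ⟨h1, h2, h3⟩ hc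
    have e0 : τ.reg 0 = n := by rw [h1.1 0 (by simp), hn]
    have m8 : τ.mem 8 = σ.mem 8 := h1.2 8 (by simp)
    have m10 : τ.mem 10 = σ.mem 10 := h1.2 10 (by simp)
    have hlt : τ.reg 30 < n := by
      by_contra hcon
      simp [e0, hcon] at hc
    refine WP.block_cons (WP.write (fun _ hS => hS.mem _ _) ?_)
    refine WP.block_cons (WP.write (fun _ hS => hS.mem _ _) ?_)
    refine WP.block_cons (WP.assign (fun _ _ => by simp; omega) ?_)
    refine WP.block_nil ⟨⟨?_, ?_, ?_⟩, ?_⟩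
    · exact ((h1.setMem (by simp)).setMem (by simp)).setReg (by simp)
    · simp; omega
    · intro i hi
      simp at hi
      simp [m8, m10]
      rcases eq_or_ne i (τ.reg 30) with rfl | hne
      · simp
      · rw [Function.update_of_ne hne, Function.update_of_ne hne]
        exact h3 i (by omega)
    · simp; omega
  · rintro t τ ⟨h1, h2, h3⟩ hz ht
    have e0 : τ.reg 0 = n := by rw [h1.1 0 (by simp), hn]
    have hi : τ.reg 30 = n := by
      by_contra hcon
      have : τ.reg 30 < n := by omega
      simp [e0, this] at hz
    rw [hi] at h3
    refine WP.block_cons (WP.assign (fun _ _ => Nat.zero_le _) (WP.block_nil ?_))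
    refine hR _ _ ?_ (by simp) (fun i hi => (h3 i hi).1) (fun i hi => (h3 i hi).2)
    simp at ht
    simp
    omega

theorem numAP_succ (n : ℕ) (A : ℕ → ℕ) :
    numAP (n + 1) A = numAP n A + if A n = 0 then 0 else 1 := Finset.sum_range_succ _ _

theorem numAP_update_ge {n a : ℕ} (A : ℕ → ℕ) (ha : n ≤ a) (v : ℕ) :
    numAP n (Function.update A a v) = numAP n A :=
  Finset.sum_congr rfl fun i hi => by
    rw [Function.update_of_ne (by have := Finset.mem_range.mp hi; omega)]

theorem sum_update_ge {n a : ℕ} (A : ℕ → ℕ) (ha : n ≤ a) (v : ℕ) :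
    ∑ i ∈ Finset.range n, Function.update A a v i = ∑ i ∈ Finset.range n, A i :=
  Finset.sum_congr rfl fun i hi => by
    rw [Function.update_of_ne (by have := Finset.mem_range.mp hi; omega)]

/-- A progression is kept only while the length kept before is below n, and each one contributes at
least the threshold; hence all but the last contribute less than n together. -/
theorem wp_prune {n thr : ℕ} [NeZero n] {A0 : ZMod n → ℕ} (hn2 : 2 ≤ n) (hn : σ.reg 0 = n)
    (hthr : σ.reg 29 = thr) (hthr0 : 0 < thr)
    (hle : ∀ i < n, σ.mem 0 i ≤ 4 * (n * n)) (hK : σ.reg 1 ≤ 2 * n) (hM : n ^ 8 ≤ M)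
    (htr : Transforms (σ.record n) A0 (σ.sumset n))
    (hbig : n ≤ ∑ i ∈ Finset.range n, if thr ≤ σ.mem 0 i then σ.mem 0 i else 0)
    (hR : ∀ t τ, t ≤ 200 * n → τ.reg 0 = 1 → Transforms (τ.record n) A0 (τ.sumset n) →
      n ≤ ∑ i ∈ Finset.range n, τ.mem 0 i → thr * numAP n (τ.mem 0) < n + thr → R t τ) :
    WP B M prune σ R := by
  have hnn : n ≤ n * n := Nat.le_mul_self n
  have h8 : 5 * (n * n) ≤ n ^ 8 := by
    have h6 : 2 ^ 6 ≤ n ^ 6 := Nat.pow_le_pow_left hn2 6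
    calc 5 * (n * n) ≤ n ^ 6 * (n * n) := Nat.mul_le_mul_right _ (by omega)
      _ = n ^ 8 := by ring
  have hn3 : 4 * n ≤ n ^ 8 := by omega
  refine WP.block_cons (WP.assign (fun _ _ => Nat.zero_le _) ?_)
  refine WP.block_cons (WP.assign (fun _ _ => Nat.zero_le _) ?_)
  refine WP.block_cons (WP.loop 1 one_pos (fun τ => 100 * (n - τ.reg 30))
    (fun τ => AgreeOff [1, 24, 28, 30] [0, 1, 2, 3, 4, 5, 6, 7] σ τ ∧ τ.reg 30 ≤ n ∧
      τ.reg 1 ≤ 2 * n + τ.reg 30 ∧ (∀ i, τ.reg 30 ≤ i → τ.mem 0 i = σ.mem 0 i) ∧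
      τ.reg 28 = ∑ i ∈ Finset.range (τ.reg 30), τ.mem 0 i ∧
      thr * numAP (τ.reg 30) (τ.mem 0) ≤ τ.reg 28 ∧
      thr * numAP (τ.reg 30) (τ.mem 0) < n + thr ∧
      (τ.reg 28 < n → ∀ i < τ.reg 30, thr ≤ σ.mem 0 i → τ.mem 0 i = σ.mem 0 i) ∧
      Transforms (τ.record n) A0 (τ.sumset n)) ?_
    ⟨((AgreeOff.refl _ _ _).setReg (by simp)).setReg (by simp), by simp, by simpa using hK,
      by simp, by simp, by simp [numAP], by simp [numAP]; omega, by simp, ?_⟩ ?_)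
  · rintro τ ⟨h1, h2, h3, h4, h5, h6, h7, h8', h9⟩ hc
    have e0 : τ.reg 0 = n := by rw [h1.1 0 (by simp), hn]
    have e29 : τ.reg 29 = thr := by rw [h1.1 29 (by simp), hthr]
    have hlt : τ.reg 30 < n := by
      by_contra hcon
      simp [e0, hcon] at hc
    set i := τ.reg 30 with hidef
    have hAi := h4 i le_rfl
    have hlei := hle i hlt
    refine WP.block_cons (WP.cond (fun htest => ?_) (fun htest => ?_))
    · have htest' : σ.mem 0 i < thr ∨ n ≤ τ.reg 28 := by
        by_contra hcon
        rw [not_or] at hcon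
        apply htest
        simp [e0, e29, ← hidef, hAi, hcon.1]
        omega
      obtain ⟨d1, d2⟩ := drop_spec (n := n) (τ.mem 0) hlt
      refine WP.block_cons (WP.assign (fun _ hS => hS.mem _ _) ?_)
      refine WP.block_cons (wp_emit (by omega) (by simp; omega) ?_)
      intro υ k1 k2 k3
      have k3 := k3 n
      simp at k2 k3
      have f30 : υ.reg 30 = i := by simpa [← hidef] using k1.1 30 (by simp)
      have f28 : υ.reg 28 = τ.reg 28 := by simpa using k1.1 28 (by simp)
      have f0 : υ.mem 0 = τ.mem 0 := by simpa using k1.2 0 (by simp)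
      refine WP.block_cons (WP.write (fun _ _ => Nat.zero_le _) ?_)
      refine WP.block_nil ?_
      refine WP.block_cons (WP.assign (fun _ _ => by simp [f30]; omega) ?_)
      refine WP.block_nil ⟨⟨?_, ?_, ?_, ?_, ?_, ?_, ?_, ?_, ?_⟩, ?_⟩
      · have : AgreeOff [1, 24, 28, 30] [0, 1, 2, 3, 4, 5, 6, 7] σ υ :=
          AgreeOff.trans (h1.setReg (by simp)) (k1.mono (by simp) (by simp))
        exact (this.setMem (by simp)).setReg (by simp)
      · simp [f30]; omega
      · simp [f30, k2]; omega
      · intro j hj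
        simp [f30] at hj
        simp [f30, f0, Function.update_of_ne (show j ≠ i by omega)]
        exact h4 j (by omega)
      · simp [f30, f0, f28, Finset.sum_range_succ, sum_update_ge, h5]
      · simpa [f30, f0, f28, numAP_succ, numAP_update_ge] using h6
      · simpa [f30, f0, f28, numAP_succ, numAP_update_ge] using h7
      · intro hS j hj hthj
        simp [f30, f28] at hS hj
        have hji : j ≠ i := by
          rintro rfl
          omega
        simp [f30, f0, Function.update_of_ne hji]
        exact h8' hS j (by omega) hthj
      · rw [Store.record_congr (σ := υ) (by simp) (fun c _ _ => by
          simp [show c ≠ 0 by omega]), k3, Store.record_congr (σ := τ) (by simp) (fun c _ _ => by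
          simp)]
        have := Transforms.snoc h9 (o := Op.drop (i : ZMod n) (τ.mem 0 i)) d1
        rw [Store.sumset_eq, d2] at this
        simpa [Store.sumset_eq, f30, f0, opOf, ← hidef] using this
      · simp [f30]; omega
    · have htest' : thr ≤ σ.mem 0 i ∧ τ.reg 28 < n := by
        by_contra hcon
        rw [not_and_or, not_le, not_lt] at hcon
        simp [e0, e29, ← hidef, hAi] at htest
        omega
      refine WP.assign (fun _ _ => by simp [← hidef]; omega) ?_
      refine WP.block_cons (WP.assign (fun _ _ => by simp [← hidef]; omega) ?_)
      have hAi0 : τ.mem 0 i ≠ 0 := by omega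
      refine WP.block_nil ⟨⟨?_, ?_, ?_, ?_, ?_, ?_, ?_, ?_, ?_⟩, ?_⟩
      · exact (h1.setReg (by simp)).setReg (by simp)
      · simp [← hidef]; omega
      · simp [← hidef]; omega
      · intro j hj
        simp [← hidef] at hj
        exact h4 j (by omega)
      · simp [← hidef, Finset.sum_range_succ, h5]
      · simp [← hidef, numAP_succ, hAi0, mul_add]; omega
      · simp [← hidef, numAP_succ, hAi0, mul_add]; omega
      · intro hS j hj hthj
        simp [← hidef] at hj
        rcases eq_or_ne j i with rfl | hji
        · exact hAi
        · exact h8' htest'.2 j (by omega) hthj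
      · rw [Store.record_congr (σ := τ) (by simp) (fun c _ _ => by simp)]
        exact h9
      · simp [← hidef]; omega
  · rw [Store.record_congr (σ := σ) (by simp) (fun c _ _ => by simp)]
    exact htr
  · rintro t τ ⟨h1, h2, h3, h4, h5, h6, h7, h8', h9⟩ hz ht
    have e0 : τ.reg 0 = n := by rw [h1.1 0 (by simp), hn]
    have hi : τ.reg 30 = n := by
      by_contra hcon
      have : τ.reg 30 < n := by omega
      simp [e0, this] at hz
    rw [hi] at h5 h6 h7 h8'
    refine WP.block_cons (WP.assign (fun hM _ => le_trans (by simp) hM) (WP.block_nil ?_))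
    refine hR _ _ ?_ (by simp) ?_ ?_ (by simpa using h7)
    · simp at ht
      simp
      omega
    · rw [Store.record_congr (σ := τ) (by simp) (fun c _ _ => by simp)]
      exact h9
    · by_contra hcon
      simp only [Store.setReg_mem, not_le] at hcon
      rw [← h5] at hcon
      -- If the kept length stayed below n, then no long progression was dropped, and the long ones
      -- alone have total length at least n.
      have h10 := h8' hcon
      have : ∑ i ∈ Finset.range n, (if thr ≤ σ.mem 0 i then σ.mem 0 i else 0) ≤
          ∑ i ∈ Finset.range n, τ.mem 0 i := by
        refine Finset.sum_le_sum fun j hj => ?_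
        split_ifs with h11
        · exact (h10 j (Finset.mem_range.mp hj) h11).ge
        · exact Nat.zero_le _
      omega

end
/-! ### The number of rounds -/

/-- A bound for the number of rounds that are still to come, if the parameter is `e`. -/
noncomputable def roundPot (X : ℝ) (e : ℕ) : ℕ :=
  ⌈X + 1 - Real.logb (3 / 2) (Real.logb 2 (e : ℝ))⌉₊

theorem one_lt_logb_two {e : ℕ} (he : 4 ≤ e) : 1 < Real.logb 2 (e : ℝ) := by
  have h : (4 : ℝ) ≤ e := by exact_mod_cast he
  rw [Real.lt_logb_iff_rpow_lt (by norm_num) (by linarith)]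
  norm_num
  linarith

/-- Passing to e' with e'² ≥ e³ multiplies log₂ e by at least 3/2, so the outer logarithm to base
3/2 grows by at least 1. -/
theorem roundPot_step {X : ℝ} {e e' : ℕ} (he : 4 ≤ e) (h : e * e * e ≤ e' * e')
    (hX : Real.logb (3 / 2) (Real.logb 2 (e : ℝ)) ≤ X) :
    roundPot X e' + 1 ≤ roundPot X e := by
  have h1 := one_lt_logb_two he
  have he0 : (0 : ℝ) < e := by exact_mod_cast (by omega : 0 < e)
  have he'0 : (0 : ℝ) < e' := by
    have : 0 < e' := by
      rcases Nat.eq_zero_or_pos e' with rfl | h0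
      · have : 0 < e * e * e := by positivity
        omega
      · exact h0
    exact_mod_cast this
  have h2 : 3 / 2 * Real.logb 2 (e : ℝ) ≤ Real.logb 2 (e' : ℝ) := by
    have h3 : ((e : ℝ) ^ 3) ≤ (e' : ℝ) ^ 2 := by
      have : ((e * e * e : ℕ) : ℝ) ≤ ((e' * e' : ℕ) : ℝ) := by exact_mod_cast h
      push_cast at this
      nlinarith
    have h4 := Real.logb_le_logb_of_le (b := 2) (by norm_num) (by positivity) h3
    rw [Real.logb_pow, Real.logb_pow] at h4
    push_cast at h4
    linarith
  have h5 : Real.logb (3 / 2) (Real.logb 2 (e : ℝ)) + 1 ≤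
      Real.logb (3 / 2) (Real.logb 2 (e' : ℝ)) := by
    have h6 := Real.logb_le_logb_of_le (b := 3 / 2) (by norm_num) (by linarith) h2
    rw [Real.logb_mul (by norm_num) (by linarith), Real.logb_self_eq_one (by norm_num)] at h6
    linarith
  unfold roundPot
  have hz := Nat.le_ceil (X + 1 - Real.logb (3 / 2) (Real.logb 2 (e : ℝ)))
  -- While a round is still made, the real number is at least 1, so its ceiling is positive and can
  -- drop.
  have hpos : 1 ≤ ⌈X + 1 - Real.logb (3 / 2) (Real.logb 2 (e : ℝ))⌉₊ :=
    Nat.one_le_ceil_iff.mpr (by linarith)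
  have : ⌈X + 1 - Real.logb (3 / 2) (Real.logb 2 (e' : ℝ))⌉₊ ≤
      ⌈X + 1 - Real.logb (3 / 2) (Real.logb 2 (e : ℝ))⌉₊ - 1 := by
    rw [Nat.ceil_le, Nat.cast_sub hpos]
    push_cast
    linarith
  omega

/-- The bound for `log log e` in the rounds. -/
noncomputable def roundBound (lg : ℕ) : ℝ := Real.logb (3 / 2) ((1 + Real.logb 2 (lg : ℝ)) / 2)

/-- The test of the rounds, e² < 2 lg, means 2 log₂ e < 1 + log₂ lg. -/
theorem le_roundBound {e lg : ℕ} (he : 4 ≤ e) (h : e * e < 2 * lg) :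
    Real.logb (3 / 2) (Real.logb 2 (e : ℝ)) ≤ roundBound lg := by
  have h1 := one_lt_logb_two he
  have he0 : (0 : ℝ) < e := by exact_mod_cast (by omega : 0 < e)
  have hlg : (0 : ℝ) < lg := by
    have : 0 < e * e := by positivity
    exact_mod_cast (by omega : 0 < lg)
  refine Real.logb_le_logb_of_le (by norm_num) (by linarith) ?_
  have h2 : (e : ℝ) ^ 2 ≤ 2 * lg := by
    have : ((e * e : ℕ) : ℝ) ≤ ((2 * lg : ℕ) : ℝ) := by exact_mod_cast h.le
    push_cast at this
    nlinarith
  have h3 := Real.logb_le_logb_of_le (b := 2) (by norm_num) (by positivity) h2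
  rw [Real.logb_pow, Real.logb_mul (by norm_num) (by linarith),
    Real.logb_self_eq_one (by norm_num)] at h3
  push_cast at h3
  linarith

theorem lg_le {n lg : ℕ} (hn : 2 ≤ n) (h : 2 ^ lg < 2 * n) :
    (lg : ℝ) ≤ 1 + Real.logb 2 (n : ℝ) := by
  have hn0 : (0 : ℝ) < n := by exact_mod_cast (by omega : 0 < n)
  have h1 : ((2 : ℝ) ^ lg) ≤ 2 * n := by exact_mod_cast h.le
  have h2 := Real.logb_le_logb_of_le (b := 2) (by norm_num) (by positivity) h1
  rw [Real.logb_pow, Real.logb_mul (by norm_num) (by linarith),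
    Real.logb_self_eq_one (by norm_num)] at h2
  linarith

/-- Change of base with (3/2)² ≥ 2. -/
theorem logb_three_halves_le {u : ℝ} (hu : 1 ≤ u) : Real.logb (3 / 2) u ≤ 2 * Real.logb 2 u := by
  have h1 : 0 ≤ Real.log u := Real.log_nonneg hu
  have h2 : 0 < Real.log 2 := Real.log_pos (by norm_num)
  have h3 : 0 < Real.log (3 / 2) := Real.log_pos (by norm_num)
  have h4 : Real.log 2 ≤ 2 * Real.log (3 / 2) := by
    have := Real.log_le_log (x := 2) (y := (3 / 2) ^ 2) (by norm_num) (by norm_num)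
    rw [Real.log_pow] at this
    exact_mod_cast this
  rw [Real.logb, Real.logb, ← mul_div_assoc, div_le_div_iff₀ h3 h2]
  nlinarith

/-- For n ≥ 4 put u = log₂ log₂ n ≥ 1. Then lg ≤ 2 log₂ n gives log₂ lg ≤ 1 + u, the argument is at
most 3u/2, and the bound is at most 1 + 2 log₂ u. For n < 4 it is not positive. -/
theorem roundBound_le {n lg : ℕ} (hn : 2 ≤ n) (hlg1 : 1 ≤ lg) (hlg : 2 ^ lg < 2 * n) :
    roundBound lg ≤ 3 * max 1 (Real.logb 2 (Real.logb 2 (Real.logb 2 (n : ℝ)))) := by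
  have hm1 := le_max_left 1 (Real.logb 2 (Real.logb 2 (Real.logb 2 (n : ℝ))))
  have hm2 := le_max_right 1 (Real.logb 2 (Real.logb 2 (Real.logb 2 (n : ℝ))))
  have hlgpos : (1 : ℝ) ≤ lg := by exact_mod_cast hlg1
  have hlg0 : 0 ≤ Real.logb 2 (lg : ℝ) := Real.logb_nonneg (by norm_num) hlgpos
  rcases lt_or_ge n 4 with h4 | h4
  · have hlg2 : lg ≤ 2 := by
      by_contra hcon
      have : 2 ^ 3 ≤ 2 ^ lg := Nat.pow_le_pow_right (by norm_num) (by omega)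
      omega
    have h5 : Real.logb 2 (lg : ℝ) ≤ 1 := by
      have := Real.logb_le_logb_of_le (b := 2) (x := lg) (y := 2) (by norm_num) (by linarith)
        (by exact_mod_cast hlg2)
      rwa [Real.logb_self_eq_one (by norm_num)] at this
    have : roundBound lg ≤ 0 := Real.logb_nonpos (by norm_num) (by linarith) (by linarith)
    linarith
  · have hn4 : (4 : ℝ) ≤ n := by exact_mod_cast h4
    have hl2 : 2 ≤ Real.logb 2 (n : ℝ) := by
      rw [Real.le_logb_iff_rpow_le (by norm_num) (by linarith)]
      norm_num
      linarith
    have hu : 1 ≤ Real.logb 2 (Real.logb 2 (n : ℝ)) := by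
      rw [Real.le_logb_iff_rpow_le (by norm_num) (by linarith)]
      norm_num
      linarith
    set l := Real.logb 2 (n : ℝ)
    set u := Real.logb 2 l
    have h6 := lg_le hn hlg
    have h7 : Real.logb 2 (lg : ℝ) ≤ 1 + u := by
      have := Real.logb_le_logb_of_le (b := 2) (x := lg) (y := 2 * l) (by norm_num) (by linarith)
        (by linarith)
      rwa [Real.logb_mul (by norm_num) (by linarith), Real.logb_self_eq_one (by norm_num)] at this
    have h8 : roundBound lg ≤ Real.logb (3 / 2) (3 / 2 * u) :=
      Real.logb_le_logb_of_le (by norm_num) (by linarith) (by linarith)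
    rw [Real.logb_mul (by norm_num) (by linarith), Real.logb_self_eq_one (by norm_num)] at h8
    have h9 := logb_three_halves_le hu
    linarith

theorem roundPot_le {n lg : ℕ} (hn : 2 ≤ n) (hlg1 : 1 ≤ lg) (hlg : 2 ^ lg < 2 * n) :
    (roundPot (roundBound lg) 4 : ℝ) ≤
      5 * max 1 (Real.logb 2 (Real.logb 2 (Real.logb 2 (n : ℝ)))) := by
  have hm1 := le_max_left 1 (Real.logb 2 (Real.logb 2 (Real.logb 2 (n : ℝ))))
  have h1 := roundBound_le hn hlg1 hlg
  set m := max 1 (Real.logb 2 (Real.logb 2 (Real.logb 2 (n : ℝ))))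
  have h2 : 0 ≤ Real.logb (3 / 2) (Real.logb 2 ((4 : ℕ) : ℝ)) :=
    Real.logb_nonneg (by norm_num) (one_lt_logb_two le_rfl).le
  have h3 : roundPot (roundBound lg) 4 ≤ ⌈4 * m⌉₊ := Nat.ceil_mono (by linarith)
  have h4 := Nat.ceil_lt_add_one (a := 4 * m) (by linarith)
  have h5 : (roundPot (roundBound lg) 4 : ℝ) ≤ ⌈4 * m⌉₊ := by exact_mod_cast h3
  linarith

/-! ### The rounds -/

/-- A phase with `regQ = regE ^ 2`. -/
def round : Prog := block [
  assign regRoot (var regE),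
  -- Doubling from e replaces a square root: it stops with e³ ≤ e'² ≤ 4e³.
  loop (Expr.lt (var regRoot * var regRoot) (var regE * var regE * var regE))
    (assign regRoot (var regRoot + var regRoot)),
  assign regQ (var regE * var regE),
  assign regH (const 2),
  -- The target is at most 8e³n = 8κqn, which a phase can afford, and it is the starting length
  -- required for the next parameter e'.
  assign regG (const 2 * (var regRoot * var regRoot) * var regN),
  phase,
  assign regE (var regRoot)]

/-- Phases with increasing parameters. -/
def rounds : Prog :=
  loop (Expr.eq (var regF) (const 0) * Expr.lt (var regE * var regE) (const 2 * var regLg)) round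

/-- The invariant of the rounds. -/
structure RoundInv (n lg : ℕ) (A0 : ZMod n → ℕ) (σ : Store) : Prop where
  reg_n : σ.reg 0 = n
  reg_lg : σ.reg 26 = lg
  inv : InvTable n (σ.mem 11)
  e_ge : 4 ≤ σ.reg 8
  e_le : σ.reg 8 ≤ n ^ 3
  sumset : SumsetInv n A0 σ
  pos : 0 < σ.reg 1
  -- This is exactly the length that a completely registered sumset cannot have when q = e² and h =
  -- 2.
  big : σ.reg 5 = 0 → 2 * (σ.reg 8 * σ.reg 8) * n ≤ σ.reg 4

section
variable {B M : ℕ} {σ : Store} {R : ℕ → Store → Prop}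

/-- Ending with everything registered would bound the total length by 2e² times a number of entries
below n, against the starting length. So the target is reached or some progression has length n. -/
theorem wp_round {n lg : ℕ} [Fact n.Prime] {A0 : ZMod n → ℕ} (hlg : 2 ^ lg < 2 * n)
    (hM : n ^ 8 ≤ M) (I : RoundInv n lg A0 σ) (hF : σ.reg 5 = 0)
    (he : σ.reg 8 * σ.reg 8 < 2 * lg)
    (hR : ∀ t τ, t ≤ 101000 * n → RoundInv n lg A0 τ →
      σ.reg 8 * σ.reg 8 * σ.reg 8 ≤ τ.reg 8 * τ.reg 8 → R t τ) :
    WP B M round σ R := by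
  have hn2 : 2 ≤ n := (Fact.out : n.Prime).two_le
  obtain ⟨e, hedef⟩ : ∃ e, e = σ.reg 8 := ⟨_, rfl⟩
  rw [← hedef] at he hR
  have he4 : 4 ≤ e := hedef ▸ I.e_ge
  have hlgn : lg ≤ n := by
    have h1 : lg - 1 < 2 ^ (lg - 1) := Nat.lt_two_pow_self
    rcases Nat.eq_zero_or_pos lg with h0 | h0
    · omega
    · have h2 : 2 ^ lg = 2 * 2 ^ (lg - 1) := by
        rw [← pow_succ']; congr 1; omega
      omega
  have hen : e * e < 2 * n := by omega
  have hnn : 2 * n ≤ n * n := Nat.mul_le_mul_right n hn2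
  have hM4 : n ^ 4 ≤ M := (Nat.pow_le_pow_right (by omega) (by omega)).trans hM
  have hpow : ∀ k, n ^ (k + 1) = n * n ^ k := fun k => pow_succ' n k
  have hn3 : 2 * (n * n) ≤ n ^ 3 := by
    calc 2 * (n * n) ≤ n * (n * n) := Nat.mul_le_mul_right _ hn2
      _ = n ^ 3 := by ring
  have hn8 : n ^ 3 ≤ n ^ 8 := Nat.pow_le_pow_right (by omega) (by omega)
  have hee : e ≤ e * e := Nat.le_mul_self e
  refine WP.block_cons (WP.assign (fun _ hS => hS.reg _) ?_)
  refine WP.block_cons (WP.loop 1 one_pos (fun τ => 40 * (2 * (e * e) - τ.reg 31))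
    (fun τ => AgreeOff [31] [] σ τ ∧ e ≤ τ.reg 31 ∧ τ.reg 31 ≤ 2 * (e * e) ∧
      τ.reg 31 * τ.reg 31 ≤ 4 * (e * e * e)) ?_
    ⟨(AgreeOff.refl _ _ _).setReg (by simp), by simp [hedef], by simp [← hedef]; omega, ?_⟩ ?_)
  · rintro τ ⟨h1, h2, h3, h4⟩ hc
    have e8 : τ.reg 8 = e := by rw [h1.1 8 (by simp), hedef]
    have hlt : τ.reg 31 * τ.reg 31 < e * e * e := by
      by_contra hcon
      simp [e8, hcon] at hc
    have hle : τ.reg 31 + τ.reg 31 ≤ 2 * (e * e) := by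
      by_contra hcon
      have : e * e < τ.reg 31 := by omega
      have h5 : (e * e) * (e * e) ≤ τ.reg 31 * τ.reg 31 := Nat.mul_le_mul this.le this.le
      have h6 : e * e * e * 1 ≤ e * e * e * e := Nat.mul_le_mul_left _ (by omega)
      have h7 : (e * e) * (e * e) = e * e * e * e := by ring
      omega
    refine WP.assign (fun _ _ => by simp; omega) ?_
    refine ⟨⟨h1.setReg (by simp), by simp; omega, by simp; omega, ?_⟩, ?_⟩
    · simp only [Store.setReg_reg, eval_add, eval_var, if_true]
      nlinarith
    · simp; omega
  · simp [← hedef]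
    have : e * e * 1 ≤ e * e * e := Nat.mul_le_mul_left _ (by omega)
    omega
  rintro t1 τ ⟨h1, h2, h3, h4⟩ hz ht1
  have e8 : τ.reg 8 = e := by rw [h1.1 8 (by simp), hedef]
  have e0 : τ.reg 0 = n := by rw [h1.1 0 (by simp), I.reg_n]
  have e1 : τ.reg 1 = σ.reg 1 := h1.1 1 (by simp)
  have e4 : τ.reg 4 = σ.reg 4 := h1.1 4 (by simp)
  have e5 : τ.reg 5 = σ.reg 5 := h1.1 5 (by simp)
  have m11 : τ.mem 11 = σ.mem 11 := h1.2 11 (by simp)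
  have e26 : τ.reg 26 = lg := by rw [h1.1 26 (by simp), I.reg_lg]
  obtain ⟨e', he'⟩ : ∃ e', e' = τ.reg 31 := ⟨_, rfl⟩
  rw [← he'] at h2 h3 h4
  have hge : e * e * e ≤ e' * e' := by
    by_contra hcon
    have : e' * e' < e * e * e := by omega
    simp [e8, ← he', this] at hz
  have hG : 2 * (e' * e') * n ≤ n ^ 8 := by
    have h5 : e' ≤ n ^ 3 := by omega
    calc 2 * (e' * e') * n ≤ n * (n ^ 3 * n ^ 3) * n :=
          Nat.mul_le_mul_right _ (Nat.mul_le_mul hn2 (Nat.mul_le_mul h5 h5))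
      _ = n ^ 8 := by ring
  have hq8 : e * e ≤ n ^ 8 := by omega
  refine WP.block_cons (WP.assign (fun _ _ => by simp [e8]; omega) ?_)
  refine WP.block_cons (WP.assign (fun hM _ => le_trans (by simp) hM) ?_)
  refine WP.block_cons (WP.assign (fun _ _ => by simp [e0, ← he']; omega) ?_)
  have hag : AgreeOff [6, 7, 9, 31] [] σ ((((τ.setReg 6 (e * e)).setReg 7 2).setReg 9
      (2 * (e' * e') * n))) :=
    (((h1.mono (by simp) (by simp)).setReg (by simp)).setReg (by simp)).setReg (by simp)
  have I1 := I.sumset.congr hag (by simp) (by simp) (by simp) (by simp)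
  have hstore : (((τ.setReg 6 ((var regE * var regE).eval τ)).setReg 7
      ((Expr.const 2).eval (τ.setReg 6 ((var regE * var regE).eval τ)))).setReg 9
      ((Expr.const 2 * (var regRoot * var regRoot) * var regN).eval
        ((τ.setReg 6 ((var regE * var regE).eval τ)).setReg 7
          ((Expr.const 2).eval (τ.setReg 6 ((var regE * var regE).eval τ)))))) =
      (((τ.setReg 6 (e * e)).setReg 7 2).setReg 9 (2 * (e' * e') * n)) := by
    simp [e8, e0, ← he']
  rw [hstore]
  have hbig := I.big hF
  rw [← hedef] at hbig
  have hbig' : n ≤ σ.reg 4 := by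
    have : 1 * n ≤ 2 * (e * e) * n := Nat.mul_le_mul_right n (by omega)
    omega
  refine WP.block_cons (wp_phase (n := n) (G := 2 * (e' * e') * n) (params_two he4) (by simp [e0]) (by simp) (by simp) (by simp [e8])
    (by simp) (by simpa [m11] using I.inv) ?_ ?_ (by simp [e4]; omega) hM4 I1 ?_)
  · rw [pow_two]; omega
  · have h5 : (e' * e') * n ≤ 4 * (e * e * e) * n := Nat.mul_le_mul_right n h4
    have h6 : e * (e * e) * n = e * e * e * n := by ring
    have h7 : 4 * (e * e * e) * n = 4 * (e * e * e * n) := by ring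
    have h8 : 2 * (e' * e') * n = 2 * ((e' * e') * n) := by ring
    omega
  intro t υ ht k1 Iυ k2 k2' k3 k4
  simp [e4] at k2
  simp [e1] at k2'
  have g31 : υ.reg 31 = e' := by simpa [he'] using k1.1 31 (by simp)
  have g0 : υ.reg 0 = n := by simpa [e0] using k1.1 0 (by simp)
  have g26 : υ.reg 26 = lg := by simpa [e26] using k1.1 26 (by simp)
  have g11 : υ.mem 11 = σ.mem 11 := by simpa [m11] using k1.2 11 (by simp)
  refine WP.block_cons (WP.assign (fun _ hS => hS.reg _) (WP.block_nil ?_))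
  refine hR _ _ ?_ ⟨?_, ?_, ?_, ?_, ?_, ?_, ?_, ?_⟩ ?_
  · simp at ht1
    simp
    omega
  · simp [g0]
  · simp [g26]
  · simpa [g11] using I.inv
  · simp [g31]; omega
  · simp [g31]; omega
  · exact Iυ.congr (rs := [8]) (as := []) ((AgreeOff.refl _ _ _).setReg (by simp)) (by simp)
      (by simp) (by simp) (by simp)
  · have := I.pos
    simp; omega
  · intro h5
    simp at h5
    simp [g31]
    rcases k4 with h6 | h6 | h6
    · exact absurd h5 h6
    · exact h6
    · exfalso
      have h7 := TableInv.sum_le_of_complete h6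
      have h8 := k3.sum_kc_lt (by positivity) (by omega) (Iυ.short h5)
      rw [← Iυ.total] at h7
      have h9 : 2 * (e * e) * (∑ i ∈ Finset.range n, υ.mem 9 i) < 2 * (e * e) * n :=
        Nat.mul_lt_mul_of_pos_left h8 (by positivity)
      omega
  · simpa [g31] using hge

theorem wp_rounds {n lg : ℕ} [Fact n.Prime] {A0 : ZMod n → ℕ} (hlg : 2 ^ lg < 2 * n)
    (hM : n ^ 8 ≤ M) (I : RoundInv n lg A0 σ)
    (hR : ∀ t τ, t ≤ 102000 * n * (roundPot (roundBound lg) (σ.reg 8) + 1) →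
      RoundInv n lg A0 τ → (τ.reg 5 = 0 → 2 * lg ≤ τ.reg 8 * τ.reg 8) → R t τ) :
    WP B M rounds σ R := by
  have hn2 : 2 ≤ n := (Fact.out : n.Prime).two_le
  refine WP.loop 1 one_pos (fun τ => 102000 * n * roundPot (roundBound lg) (τ.reg 8))
    (RoundInv n lg A0) ?_ I ?_
  · intro τ J hc
    have hF : τ.reg 5 = 0 := by
      by_contra hcon
      simp [hcon] at hc
    have he : τ.reg 8 * τ.reg 8 < 2 * lg := by
      by_contra hcon
      simp [hcon, J.reg_lg] at hc
    refine wp_round hlg hM J hF he ?_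
    intro t υ ht K hk
    refine ⟨K, ?_⟩
    have h1 := Nat.mul_le_mul_left (102000 * n)
      (roundPot_step J.e_ge hk (le_roundBound J.e_ge he))
    rw [mul_add] at h1
    simp
    omega
  · intro t τ J hz ht
    refine hR t τ ?_ J ?_
    · simp at ht
      rw [mul_add]
      omega
    · intro hF
      by_contra hcon
      have : τ.reg 8 * τ.reg 8 < 2 * lg := by omega
      simp [hF, J.reg_lg, this] at hz

end
-- The whole algorithm
/-- The algorithm. -/
def algorithm : Prog := block [
  inverses,
  logarithm,
  assign regT (var regN - const 1),
  assign regQ (const 1),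
  assign regH (const 1),
  assign regE (const 4),
  -- This is 2·4²·n, the length with which the rounds may start at e = 4.
  assign regG (const 32 * var regN),
  phase,
  cond (Expr.eq (var regK) (const 0)) tabulate (block [
    rounds,
    cond (Expr.eq (var regF) (const 0))
      (assign regThr (var regE * var regE)) (assign regThr (var regN)),
    prune])]

theorem sum_zmod {n : ℕ} [NeZero n] (f : ℕ → ℕ) :
    ∑ i : ZMod n, f i.val = ∑ i ∈ Finset.range n, f i :=
  Finset.sum_nbij' ZMod.val (fun i => (i : ZMod n))
    (fun i _ => Finset.mem_range.mpr (ZMod.val_lt i)) (fun _ _ => Finset.mem_univ _)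
    (fun _ _ => ZMod.natCast_zmod_val _)
    (fun _ hi => ZMod.val_cast_of_lt (Finset.mem_range.mp hi)) (fun _ _ => rfl)

theorem card_filter_toZ {n : ℕ} [NeZero n] (A : ℕ → ℕ) :
    (Finset.univ.filter fun i : ZMod n => toZ n A i ≠ 0).card = numAP n A := by
  rw [numAP, ← sum_zmod (fun i => if A i = 0 then 0 else 1), Finset.card_filter]
  exact Finset.sum_congr rfl fun i _ => by simp only [toZ]; split_ifs <;> simp_all

/-- All progressions but one account for less than n/thr. With thr ≥ 2 lg the factor 2 absorbs the
exceptional one as soon as there are two; a single one is allowed because log₂ n ≤ n. -/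
theorem count_mul_logb_le {n lg thr cnt : ℕ} (hn : 2 ≤ n) (hlg : n ≤ 2 ^ lg)
    (hthr : thr = n ∨ 2 * lg ≤ thr) (hc : thr * cnt < n + thr) :
    (cnt : ℝ) ≤ (n : ℝ) / Real.logb 2 (n : ℝ) := by
  have hn0 : (2 : ℝ) ≤ n := by exact_mod_cast hn
  have hl0 : 0 < Real.logb 2 (n : ℝ) := Real.logb_pos (by norm_num) (by linarith)
  have hln : Real.logb 2 (n : ℝ) ≤ n := by
    rw [Real.logb_le_iff_le_rpow (by norm_num) (by linarith), Real.rpow_natCast]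
    exact_mod_cast (Nat.lt_two_pow_self (n := n)).le
  have hllg : Real.logb 2 (n : ℝ) ≤ lg := by
    rw [Real.logb_le_iff_le_rpow (by norm_num) (by linarith), Real.rpow_natCast]
    exact_mod_cast hlg
  rw [le_div_iff₀ hl0]
  rcases Nat.lt_or_ge cnt 2 with h | h
  · have : (cnt : ℝ) ≤ 1 := by exact_mod_cast (by omega : cnt ≤ 1)
    nlinarith
  · obtain ⟨k, rfl⟩ : ∃ k, cnt = k + 1 := ⟨cnt - 1, by omega⟩
    have h1 : thr * k < n := by rw [mul_add] at hc; omega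
    rcases hthr with rfl | hthr
    · have : thr * 1 ≤ thr * k := Nat.mul_le_mul_left _ (by omega)
      omega
    · have h2 : (2 * lg) * k ≤ thr * k := Nat.mul_le_mul_right k hthr
      have h3 : ((2 * lg * k : ℕ) : ℝ) ≤ n := by exact_mod_cast (by omega : 2 * lg * k ≤ n)
      have h4 : (1 : ℝ) ≤ k := by exact_mod_cast (by omega : 1 ≤ k)
      push_cast at h3 ⊢
      nlinarith

section
variable {B M : ℕ}

theorem inputStore_mem_zero {n : ℕ} (A : ZMod n → ℕ) {i : ℕ} (hi : i < n) :
    (inputStore n A).mem 0 i = A (i : ZMod n) := by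
  simp [inputStore, hi]

theorem inputStore_sumset {n : ℕ} [NeZero n] (A : ZMod n → ℕ) :
    toZ n ((inputStore n A).mem 0) = A := by
  funext i
  rw [toZ, inputStore_mem_zero A (ZMod.val_lt i), ZMod.natCast_zmod_val]

theorem inputStore_sum {n : ℕ} [NeZero n] (A : ZMod n → ℕ) :
    ∑ i ∈ Finset.range n, (inputStore n A).mem 0 i = ∑ i : ZMod n, A i := by
  rw [← sum_zmod]
  exact Finset.sum_congr rfl fun i _ => congrFun (inputStore_sumset A) i

/-- If no operation is possible, then the table is full and the sumset has no collision. -/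
theorem tabulated_of_complete {n : ℕ} [Fact n.Prime] {A : ZMod n → ℕ} {τ υ : Store}
    (hsum : (∑ i : ZMod n, A i) + 1 = n) (hA : toZ n (τ.mem 0) = A)
    (hlt : ∀ i < n, τ.mem 0 i < n)
    (H : TableInv n 1 1 (τ.mem 0) (τ.mem 8) (τ.mem 10) (τ.mem 9))
    (hc : ∀ i < n, τ.mem 0 i + 1 ≤ 1 * (τ.mem 9 i * 1 + 1))
    (h0 : υ.reg 0 = 0) (h1 : ∀ i < n, υ.mem 1 i = τ.mem 10 i)
    (h2 : ∀ i < n, υ.mem 2 i = τ.mem 8 i) :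
    Tabulated A υ ∧ ¬ HasCollision A := by
  have hval : ∀ i : ZMod n, A i = τ.mem 0 i.val := fun i => by rw [← hA]; rfl
  have hle : ∀ i < n, τ.mem 9 i ≤ τ.mem 0 i := by
    intro i hi
    rcases Nat.eq_zero_or_pos (τ.mem 9 i) with h | h
    · omega
    · have := H.bound i hi (τ.mem 9 i - 1) (by omega)
      omega
  have heq : ∑ i ∈ Finset.range n, τ.mem 9 i = ∑ i ∈ Finset.range n, τ.mem 0 i :=
    Finset.sum_congr rfl fun i hi => by
      have := hle i (Finset.mem_range.mp hi)
      have := hc i (Finset.mem_range.mp hi)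
      omega
  -- Complete registration with q = h = 1 means as many entries as the total length n − 1, so all
  -- nonzero slots are taken.
  have hs : ∑ i ∈ Finset.range n, τ.mem 9 i + 1 = n := by
    have hA' : ∑ i : ZMod n, A i = ∑ i ∈ Finset.range n, τ.mem 0 i := by
      rw [← sum_zmod]
      exact Finset.sum_congr rfl fun i _ => hval i
    rw [heq, ← hA', hsum]
  refine ⟨⟨h0, fun x hx => ?_⟩, ?_⟩
  · have hxn := ZMod.val_lt x
    have hx0 : x.val ≠ 0 := fun h => hx ((ZMod.val_eq_zero x).mp h)
    have hne := H.full one_pos one_pos hlt hs hxn hx0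
    obtain ⟨h3, k, h4, h5, h6⟩ := H.owner _ hxn hne
    rw [h1 _ hxn, h2 _ hxn]
    have h7 := hle _ h3
    have h8 : A (τ.mem 8 x.val : ZMod n) = τ.mem 0 (τ.mem 8 x.val) := by
      rw [hval, ZMod.val_cast_of_lt h3]
    refine ⟨by omega, by rw [h8]; omega, ?_⟩
    rw [h5, ← Nat.cast_mul, ← ZMod.natCast_mod, ← h6, ZMod.natCast_zmod_val]
  · rintro ⟨i, j, c, d, hij, hc1, hci, hd1, hdj, he⟩
    have hi := ZMod.val_lt i
    have hj := ZMod.val_lt j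
    rw [hval] at hci hdj
    rw [← ZMod.natCast_zmod_val i, ← ZMod.natCast_zmod_val j, zmod_mul_eq_iff] at he
    have hi' := hc _ hi
    have hj' := hc _ hj
    -- Both sides of a collision would be registered in one slot, which has only one owner.
    have e1 := (H.entry _ hi (c - 1) (by omega)).1
    have e2 := (H.entry _ hj (d - 1) (by omega)).1
    rw [mul_one, Nat.sub_add_cancel hc1] at e1
    rw [mul_one, Nat.sub_add_cancel hd1] at e2
    rw [he, e2] at e1
    exact hij (ZMod.val_injective n e1.symm)

/-- After the first phase the number of recorded operations decides: zero means that the table is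
complete, otherwise the recorded history contains a collision of the input. -/
theorem wp_algorithm {n : ℕ} [Fact n.Prime] (A : ZMod n → ℕ) (hA0 : A 0 = 0)
    (hsum : (∑ i : ZMod n, A i) + 1 = n) (hM : n ^ 8 ≤ M) :
    WP B M algorithm (inputStore n A) fun t τ =>
      (t : ℝ) ≤ 1000000 * n * max 1 (Real.logb 2 (Real.logb 2 (Real.logb 2 (n : ℝ)))) ∧
      (HasCollision A ∧ Reached A τ ∨ ¬ HasCollision A ∧ Tabulated A τ) := by
  have hp : n.Prime := Fact.out
  have hn2 := hp.two_le
  have hM4 : n ^ 4 ≤ M := (Nat.pow_le_pow_right (by omega) (by omega)).trans hM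
  have hnM : n ≤ M := (Nat.le_self_pow (by omega) n).trans hM4
  have h32 : 32 * n ≤ M := by
    have h7 : 2 ^ 7 ≤ n ^ 7 := Nat.pow_le_pow_left hn2 7
    calc 32 * n ≤ n ^ 7 * n := Nat.mul_le_mul_right n (by omega)
      _ = n ^ 8 := by ring
      _ ≤ M := hM
  have hm1 := le_max_left 1 (Real.logb 2 (Real.logb 2 (Real.logb 2 (n : ℝ))))
  have hσ0 : (inputStore n A).reg 0 = n := by simp [inputStore]
  have hσ : ∀ x, x ≠ 0 → (inputStore n A).reg x = 0 := fun x hx => by simp [inputStore, hx]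
  have hs := inputStore_sum A
  have hlt : ∀ i < n, (inputStore n A).mem 0 i < n := by
    intro i hi
    have := Finset.single_le_sum (f := (inputStore n A).mem 0) (fun i _ => Nat.zero_le _)
      (Finset.mem_range.mpr hi)
    omega
  refine WP.block_cons (wp_inverses hσ0 hM4 ?_)
  intro t1 σ1 ht1 a1 hinv
  refine WP.block_cons (wp_logarithm hn2 (by rw [a1.1 0 (by simp), hσ0]) hM4 ?_)
  intro t2 σ2 ht2 a2 hlg1 hlg2
  obtain ⟨lg, hlg⟩ : ∃ lg, lg = σ2.reg 26 := ⟨_, rfl⟩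
  rw [← hlg] at hlg1 hlg2
  have a3 : AgreeOff [26, 27, 30] [11] (inputStore n A) σ2 :=
    (a1.mono (by simp) (by simp)).trans (a2.mono (by simp) (by simp))
  have e0 : σ2.reg 0 = n := by rw [a3.1 0 (by simp), hσ0]
  have e1 : σ2.reg 1 = 0 := by rw [a3.1 1 (by simp), hσ 1 (by simp)]
  have e5 : σ2.reg 5 = 0 := by rw [a3.1 5 (by simp), hσ 5 (by simp)]
  have m0 : σ2.mem 0 = (inputStore n A).mem 0 := a3.2 0 (by simp)
  have m11 : σ2.mem 11 = σ1.mem 11 := a2.2 11 (by simp)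
  refine WP.block_cons (WP.assign (fun _ hS => (Nat.sub_le _ _).trans (hS.reg _)) ?_)
  refine WP.block_cons (WP.assign (fun hM _ => le_trans (by simp) hM) ?_)
  refine WP.block_cons (WP.assign (fun hM _ => le_trans (by simp) hM) ?_)
  refine WP.block_cons (WP.assign (fun hM _ => le_trans (by simp) hM) ?_)
  refine WP.block_cons (WP.assign (fun _ _ => by simp [e0]; omega) ?_)
  refine WP.block_cons (wp_phase (n := n) (q := 1) (h := 1) (E := 4) (κ := 2) (G := 32 * n)
    (A0 := A) params_one (by simp [e0]) (by simp) (by simp) (by simp) (by simp [e0])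
    (by simpa [m11] using hinv) (Nat.one_le_pow _ _ (by omega)) (by omega)
    (by simp [e0]; omega) hM4 ?_ ?_)
  · refine ⟨?_, ?_, ?_, ?_, ?_, ?_, ?_, ?_⟩
    · simpa [m0] using fun _ => hlt
    · simp [e5]
    · intro i hi
      simp only [Store.setReg_mem, m0]
      have := hlt i hi
      have := Nat.le_mul_self n
      omega
    · simp [m0, inputStore, hA0]
    · simp [e0, m0, hs]; omega
    · have := numAP_le n ((inputStore n A).mem 0)
      simp [e1, m0]; omega
    · rw [Store.sumset_eq]
      simp [Store.record, e1, m0, inputStore_sumset, Transforms]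
    · left
      rw [Store.sumset_eq]
      simp [e1, m0, inputStore_sumset]
  intro t3 σ3 ht3 a4 I hT hK H hend
  simp [e0] at hT
  have f0 : σ3.reg 0 = n := by simpa [e0] using a4.1 0 (by simp)
  have f8 : σ3.reg 8 = 4 := by simpa using a4.1 8 (by simp)
  have f26 : σ3.reg 26 = lg := by simpa [hlg] using a4.1 26 (by simp)
  have f11 : σ3.mem 11 = σ1.mem 11 := by simpa [m11] using a4.2 11 (by simp)
  refine WP.block_cons (WP.cond (fun ht => ?_) (fun ht => ?_))
  · -- no operation was made
    have hK0 : σ3.reg 1 = 0 := by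
      by_contra hcon
      simp [hcon] at ht
    have hA : toZ n (σ3.mem 0) = A := by
      rcases I.hist with h | h
      · exact h.2
      · omega
    have hst : ∑ i ∈ Finset.range n, σ3.mem 0 i = ∑ i : ZMod n, A i := by
      rw [← sum_zmod, ← hA]; rfl
    have hF : σ3.reg 5 = 0 := by
      by_contra hcon
      obtain ⟨i, hi, h⟩ := I.long hcon
      have := Finset.single_le_sum (f := σ3.mem 0) (fun i _ => Nat.zero_le _)
        (Finset.mem_range.mpr hi)
      omega
    have hcomp : ∀ i < n, σ3.mem 0 i + 1 ≤ 1 * (σ3.mem 9 i * 1 + 1) := by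
      have := I.total
      rcases hend with h | h | h
      · exact absurd hF h
      · omega
      · exact h
    refine wp_tabulate (by omega) f0 hnM ?_
    intro t4 σ4 ht4 g0 g1 g2
    obtain ⟨h1, h2⟩ := tabulated_of_complete hsum hA (I.short hF) H hcomp g0 g1 g2
    refine WP.block_nil ⟨?_, Or.inr ⟨h2, h1⟩⟩
    have : t1 + (t2 + 100 + t3 + t4) ≤ 200000 * n := by omega
    have h3 : ((t1 + (t2 + 100 + t3 + t4) : ℕ) : ℝ) ≤ 200000 * n := by exact_mod_cast this
    have h4 : (0 : ℝ) ≤ n := Nat.cast_nonneg n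
    push_cast at h3 ⊢
    simp only [Expr.cost_const, Expr.cost_var, Expr.cost_sub, Expr.cost_mul, Expr.cost_eq]
    push_cast
    nlinarith
  · -- there was a collision
    have hK0 : 0 < σ3.reg 1 := by
      by_contra hcon
      have : σ3.reg 1 = 0 := by omega
      simp [this] at ht
    obtain ⟨hcol, hTn⟩ : HasCollision A ∧ n ≤ σ3.reg 4 := by
      rcases I.hist with h | h
      · omega
      · exact h.2
    have J : RoundInv n lg A σ3 := by
      refine ⟨f0, f26, by rw [f11]; exact hinv, by omega, ?_, I, hK0, ?_⟩
      · have h3 : 2 ^ 3 ≤ n ^ 3 := Nat.pow_le_pow_left hn2 3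
        omega
      · intro hF
        rw [f8]
        rcases hend with h | h | h
        · exact absurd hF h
        · omega
        -- Complete registration would give a total length below n, but the first operation has
        -- raised it to at least n.
        · exfalso
          have h7 := TableInv.sum_le_of_complete h
          have h8 := H.sum_kc_lt one_pos one_pos (I.short hF)
          rw [← I.total] at h7
          omega
    refine WP.block_cons (wp_rounds hlg2 hM J ?_)
    intro t4 σ4 ht4 J4 hlarge
    rw [f8] at ht4
    have hrest : ∀ σ5, AgreeOff [29] [] σ4 σ5 → 0 < σ5.reg 29 →
        (σ5.reg 29 = n ∨ 2 * lg ≤ σ5.reg 29) →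
        (n ≤ ∑ i ∈ Finset.range n, if σ5.reg 29 ≤ σ4.mem 0 i then σ4.mem 0 i else 0) →
        ∀ t₀ ≤ 20, WP B M (block [prune]) σ5 fun t τ =>
          t₀ + t ≤ 201 * n + 50 ∧ Reached A τ := by
      intro σ5 hag h0 hthr hbig t₀ ht₀
      have I5 := J4.sumset.congr hag (by simp) (by simp) (by simp) (by simp)
      have hc5 := I5.count
      have g0 : σ5.mem 0 = σ4.mem 0 := hag.2 0 (by simp)
      refine WP.block_cons (wp_prune hn2 (by rw [hag.1 0 (by simp), J4.reg_n]) rfl h0 I5.le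
        (by omega) hM I5.trans (by rw [g0]; exact hbig) ?_)
      intro t τ ht h1 h2 h3 h4
      refine WP.block_nil ⟨by omega, h1, h2, ?_, ?_⟩
      · rw [Store.sumset_eq, card_filter_toZ]
        exact count_mul_logb_le hn2 hlg1 hthr h4
      · rw [Store.sumset_eq]
        exact h3.trans (sum_zmod (τ.mem 0)).ge
    have hfin : WP B M (block [Prog.cond (Expr.eq (var regF) (const 0))
        (assign regThr (var regE * var regE)) (assign regThr (var regN)), prune]) σ4
        fun t τ => t ≤ 201 * n + 50 ∧ Reached A τ := by
      refine WP.block_cons (WP.cond (fun hF => ?_) (fun hF => ?_))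
      · have hF' : σ4.reg 5 = 0 := by
          by_contra hcon
          simp [hcon] at hF
        have he := J4.e_le
        have he4 := J4.e_ge
        refine WP.assign (fun _ _ => ?_) ?_
        · calc σ4.reg 8 * σ4.reg 8 ≤ n ^ 3 * n ^ 3 := Nat.mul_le_mul he he
            _ = n ^ 6 := by ring
            _ ≤ n ^ 8 := Nat.pow_le_pow_right (by omega) (by omega)
            _ ≤ M := hM
        refine hrest _ ((AgreeOff.refl _ _ _).setReg (by simp)) ?_ ?_ ?_ _ (by simp)
        · simp
          omega
        · right
          simpa using hlarge hF'
        · have hb := J4.big hF'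
          rw [J4.sumset.total] at hb
          simp
          -- Dropping what is shorter than e² loses at most e²n of at least 2e²n.
          have hsplit : ∑ i ∈ Finset.range n, σ4.mem 0 i ≤
              ∑ i ∈ Finset.range n, ((if σ4.reg 8 * σ4.reg 8 ≤ σ4.mem 0 i then σ4.mem 0 i else 0) +
                σ4.reg 8 * σ4.reg 8) :=
            Finset.sum_le_sum fun i _ => by split_ifs <;> omega
          rw [Finset.sum_add_distrib, Finset.sum_const, Finset.card_range, smul_eq_mul] at hsplit
          have h5 : 1 * n ≤ σ4.reg 8 * σ4.reg 8 * n := Nat.mul_le_mul_right n (by nlinarith)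
          have h6 : n * (σ4.reg 8 * σ4.reg 8) = σ4.reg 8 * σ4.reg 8 * n := mul_comm _ _
          have h7 : 2 * (σ4.reg 8 * σ4.reg 8) * n = 2 * (σ4.reg 8 * σ4.reg 8 * n) := by ring
          omega
      · have hF' : σ4.reg 5 ≠ 0 := by
          intro hcon
          simp [hcon] at hF
        refine WP.assign (fun _ hS => hS.reg _) ?_
        refine hrest _ ((AgreeOff.refl _ _ _).setReg (by simp)) ?_ ?_ ?_ _ (by simp)
        · simp [J4.reg_n]; omega
        · left; simp [J4.reg_n]
        -- With threshold n a single progression of length at least n already suffices.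
        · obtain ⟨i, hi, h⟩ := J4.sumset.long hF'
          have := Finset.single_le_sum (f := fun i => if n ≤ σ4.mem 0 i then σ4.mem 0 i else 0)
            (fun i _ => Nat.zero_le _) (Finset.mem_range.mpr hi)
          simp only [if_pos h] at this
          simp [J4.reg_n]
          omega
    refine hfin.mono ?_
    rintro t5 σ5 ⟨ht5, hreach⟩
    refine WP.block_nil ⟨?_, Or.inl ⟨hcol, hreach⟩⟩
    have hlgpos : 1 ≤ lg := by
      rcases Nat.eq_zero_or_pos lg with h | h
      · rw [h] at hlg1; omega
      · exact h
    have hpot := roundPot_le hn2 hlgpos hlg2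
    have h1 : t1 + (t2 + 100 + t3 + t5) ≤ 200000 * n := by omega
    have h3 : ((t1 + (t2 + 100 + t3 + t5) : ℕ) : ℝ) ≤ 200000 * n := by exact_mod_cast h1
    have h4 : (0 : ℝ) ≤ n := Nat.cast_nonneg n
    have h5 : (t4 : ℝ) ≤ 102000 * n * (roundPot (roundBound lg) 4 + 1) := by exact_mod_cast ht4
    have h6 := mul_le_mul_of_nonneg_left hpot h4
    have h7 := mul_le_mul_of_nonneg_left hm1 h4
    push_cast at h3 ⊢
    simp only [Expr.cost_const, Expr.cost_var, Expr.cost_sub, Expr.cost_mul, Expr.cost_eq]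
    push_cast
    nlinarith

end
end EGZ

theorem mainTheorem6 :
    ∃ (P : EGZ.Prog) (C : ℕ),
      ∀ (n : ℕ) [Fact n.Prime] (A : ZMod n → ℕ),
        A 0 = 0 → (∑ i : ZMod n, A i) + 1 = n →
          ∃ (t : ℕ) (σ : EGZ.Store),
            EGZ.Exec (n ^ C) P (EGZ.inputStore n A) t σ ∧
            (t : ℝ) ≤ (C : ℝ) * (n : ℝ) *
              max 1 (Real.logb 2 (Real.logb 2 (Real.logb 2 (n : ℝ)))) ∧
            (EGZ.HasCollision A → EGZ.Reached A σ) ∧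
            (¬ EGZ.HasCollision A → EGZ.Tabulated A σ) := by
  refine ⟨EGZ.algorithm, 1000000, ?_⟩
  intro n _ A hA0 hsum
  have hn2 : 2 ≤ n := (Fact.out : n.Prime).two_le
  -- Stored values are bounded by n⁸, which covers the target lengths 2e'²n because e' ≤ n³; the
  -- exponent 40 is the limit on the cost of an expression.
  have hB : (n ^ 8) ^ 40 ≤ n ^ 1000000 := by
    exact (pow_mul n 8 40).symm.trans_le (Nat.pow_le_pow_right (by omega) (by omega))
  have h64 : 64 ≤ n ^ 8 := le_trans (by norm_num) (Nat.pow_le_pow_left hn2 8)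
  have hnM : n ≤ n ^ 8 := Nat.le_self_pow (by norm_num) n
  have hsmall : EGZ.Small (n ^ 8) (EGZ.inputStore n A) := by
    refine ⟨fun x => ?_, fun a i => ?_⟩
    · simp only [EGZ.inputStore]
      split_ifs <;> omega
    · simp only [EGZ.inputStore]
      split_ifs with h
      · have := Finset.single_le_sum (f := A) (fun i _ => Nat.zero_le _)
          (Finset.mem_univ (i : ZMod n))
        omega
      · omega
  obtain ⟨t, σ, h1, -, h2, h3⟩ :=
    EGZ.wp_algorithm A hA0 hsum le_rfl h64 hB hsmall
  refine ⟨t, σ, h1, by exact_mod_cast h2, fun hc => ?_, fun hc => ?_⟩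
  · rcases h3 with h | h
    · exact h.2
    · exact absurd hc h.1
  · rcases h3 with h | h
    · exact absurd h.1 hc
    · exact h.2
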